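/- Let $E=\mathbb{R}^r$ with its Euclidean inner product, identified with $E^*$; let $R\subset E$ be a finite root system (finite, $0\notin R$, stable under the orthogonal reflections $s_\alpha$, $\alpha\in R$) with a choice of positive roots, $W$ the reflection group generated by the $s_\alpha$, $\mathfrak{h}=E_{\mathbb{C}}$, and $\alpha^\vee=2\alpha/(\alpha,\alpha)$. Let $c:R\to\mathbb{C}$ be a $W$-invariant function and let $\mathsf{H}_c$ be the rational Cherednik algebra (at $t=1$), generated by $\mathfrak{h},\mathfrak{h}^*,W$ with $[y,x]=\langle x,y\rangle-\sum_{\alpha>0}c_\alpha\langle\alpha,y\rangle\langle x,\alpha^\vee\rangle s_\alpha$. For an irreducible complex representation $\tau$ of $W$ let $M_c(\tau)=\mathbb{C}[\mathfrak{h}]\otimes V(\tau)$ be the standard module of $\mathsf{H}_c$, on which $y\in\mathfrak{h}$ acts by the Dunkl operator $p\otimes v\mapsto\partial_y p\otimes v-\sum_{\alpha>0}c_\alpha\langle\alpha,y\rangle\frac{p-s_\alpha p}{\alpha}\otimes s_\alpha v$. Let $N_c(\sigma)$ be the scalar by which $\sum_{\alpha>0}c_\alpha s_\alpha$ acts on an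 irreducible representation $\sigma$. Put $\mathbb{S}=\bigwedge\mathfrak{h}^*$, on which $x\in\mathfrak{h}^*$ acts by exterior multiplication and $y\in\mathfrak{h}$ by contraction, and $K_c(\tau)=M_c(\tau)\otimes\mathbb{S}$ with the diagonal $W$-action and the bigrading $K_m^l=\mathbb{C}[\mathfrak{h}]_m\otimes V(\tau)\otimes\bigwedge^l\mathfrak{h}^*$. With an orthonormal basis $y_i$ of $E$ and the dual basis $x_i$, consider the operators $$E_1^-=\tfrac12\sum_i y_i^2\otimes 1,\quad E_2^+=\sum_i y_i\otimes x_i,\quad E_2^-=\sum_i x_i\otimes y_i,\quad E_3^-=-\sum_i y_i\otimes y_i$$ on $K_c(\tau)$. Let $\mathcal{A}_c(\tau)=\ker E_1^-\cap\ker E_3^-$ and $\mathcal{M}_c(\tau)=\mathcal{A}_c(\tau)\cap\ker E_2^-$ (the space of lowest weight vectors). For $n\in\mathbb{Z}_{\ge0}$ and an irreducible representation $\sigma$ let $\mathcal{A}_c(\tau,n,\sigma)=\bigoplus_{m+l=n}\big(\mathcal{A}_c(\tau)\cap K_m^l(\sigma)\big)$, where $K_m^l(\sigma)$ is the $\sigma$-isotypic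 component of $K_m^l$, graded by $l$. Assume that $c$ is generic in the sense that $N_c(\tau)-N_c(\sigma)\notin\mathbb{Z}_{\ge0}$ for every irreducible representation $\sigma\not\cong\tau$ of $W$. Then for all $n\in\mathbb{Z}_{\ge0}$ and all irreducible $\sigma$: 1. $(\mathcal{A}_0(\tau,n,\sigma),E_2^+)$ and $(\mathcal{A}_c(\tau,n,\sigma),E_2^+)$ are complexes (with $E_2^+$ raising $l$ by one), and they are isomorphic, $W$-equivariantly, as complexes; 2. $(\mathcal{A}_0(\tau,n,\sigma),E_2^-)$ and $(\mathcal{A}_c(\tau,n,\sigma),E_2^-)$ are complexes (with $E_2^-$ lowering $l$ by one), and they are isomorphic, $W$-equivariantly, as complexes. Here the operators on the complexes at $0$ are those for the parameter $c=0$. In particular, $\mathcal{M}_0(\tau)\cong\mathcal{M}_c(\tau)$ as bigraded $W$-representations. -/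

import Mathlib

open scoped TensorProduct Matrix

noncomputable section

namespace DunklHowe

/-- The Euclidean space `E = ℝ^r`, identified with its dual by the Euclidean structure. -/
abbrev Euc (r : ℕ) := EuclideanSpace ℝ (Fin r)

/-- A finite root system in `E` (neither crystallographic, nor reduced, nor spanning is required)
with the choice of a positive system, given by a vector off all the root hyperplanes. -/
structure RootDatum (r : ℕ) where
  R : Finset (Euc r)
  zero_notMem : (0 : Euc r) ∉ R
  reflection_mem : ∀ α ∈ R, ∀ β ∈ R, (ℝ ∙ α)ᗮ.reflection β ∈ R
  chamber : Euc r
  regular : ∀ α ∈ R, inner ℝ α chamber ≠ 0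

variable {r : ℕ} (Φ : RootDatum r)

namespace RootDatum

/-- The finite reflection group generated by the reflections in the roots. -/
def W : Subgroup (Euc r ≃ₗᵢ[ℝ] Euc r) :=
  Subgroup.closure {g | ∃ α ∈ Φ.R, g = (ℝ ∙ α)ᗮ.reflection}

/-- The reflection `s_α`. -/
def s (α : Φ.R) : Φ.W :=
  ⟨(ℝ ∙ (α : Euc r))ᗮ.reflection, Subgroup.subset_closure ⟨α, α.2, rfl⟩⟩

open Classical in
/-- The positive roots. -/
def Pos : Finset Φ.R := Finset.univ.filter fun α => 0 < inner ℝ (α : Euc r) Φ.chamber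

theorem ne_zero (α : Φ.R) : (α : Euc r) ≠ 0 := fun h => Φ.zero_notMem (h ▸ α.2)

/-- Parameter functions: functions on the roots that are constant on the orbits of the group. -/
def IsParam (c : Φ.R → ℂ) : Prop :=
  ∀ (w : Φ.W) (α β : Φ.R), (β : Euc r) = (w : Euc r ≃ₗᵢ[ℝ] Euc r) α → c β = c α

/-- The matrix of `w` in the standard orthonormal basis. -/
def mat (w : Φ.W) : Matrix (Fin r) (Fin r) ℂ :=
  Matrix.of fun i j => (((w : Euc r ≃ₗᵢ[ℝ] Euc r) (EuclideanSpace.single j 1) i : ℝ) : ℂ)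

theorem apply_eq (g : Euc r ≃ₗᵢ[ℝ] Euc r) (v : Euc r) (i : Fin r) :
    g v i = ∑ j, g (EuclideanSpace.single j 1) i * v j := by
  have hv : v = ∑ j, v j • EuclideanSpace.single j (1 : ℝ) := by
    ext k; simp [Finset.sum_apply, Pi.single_apply]
  conv_lhs => rw [hv]
  simp [map_sum, mul_comm]

theorem mat_mul (w w' : Φ.W) : Φ.mat (w * w') = Φ.mat w * Φ.mat w' := by
  ext i j
  simp only [mat, Matrix.mul_apply, Matrix.of_apply]
  norm_cast
  exact apply_eq (w : Euc r ≃ₗᵢ[ℝ] Euc r) _ i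

theorem mat_one : Φ.mat 1 = 1 := by
  ext i j
  by_cases h : i = j <;> simp [mat, Matrix.one_apply, h]

/-- The action of the group on `𝔥 = E_ℂ`, and on `𝔥^*`, in coordinates. -/
def hRep : Representation ℂ Φ.W (Fin r → ℂ) where
  toFun w := Matrix.toLin' (Φ.mat w)
  map_one' := by rw [mat_one, Matrix.toLin'_one]; rfl
  map_mul' w w' := by rw [mat_mul, Matrix.toLin'_mul]; rfl

end RootDatum

/-- The element of `𝔥^* ⊆ ℂ[𝔥]` with the given coordinates. -/
def linForm : (Fin r → ℂ) →ₗ[ℂ] MvPolynomial (Fin r) ℂ :=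
  Fintype.linearCombination ℂ MvPolynomial.X

/-- The inclusion of `E` into its complexification. -/
def cplx (α : Euc r) : Fin r → ℂ := fun i => ((α i : ℝ) : ℂ)

/-- The coroot `α^∨ = 2 α / (α, α)`. -/
def coroot (α : Euc r) : Fin r → ℂ := (2 / (cplx α ⬝ᵥ cplx α)) • cplx α

theorem linForm_apply (v : Fin r → ℂ) :
    linForm v = ∑ i, v i • (MvPolynomial.X i : MvPolynomial (Fin r) ℂ) := rfl

theorem linForm_single (i : Fin r) :
    linForm (Pi.single i 1 : Fin r → ℂ) = (MvPolynomial.X i : MvPolynomial (Fin r) ℂ) := by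
  simp [linForm_apply, Pi.single_apply]

theorem cplx_dotProduct (u v : Euc r) : cplx u ⬝ᵥ cplx v = ((inner ℝ u v : ℝ) : ℂ) := by
  simp [dotProduct, cplx, PiLp.inner_apply, mul_comm]

theorem cplx_single (i : Fin r) :
    cplx (EuclideanSpace.single i (1 : ℝ)) = (Pi.single i 1 : Fin r → ℂ) := by
  ext k
  by_cases h : k = i <;> simp [cplx, h]

theorem dotProduct_cplx_self_ne {α : Euc r} (h : α ≠ 0) : cplx α ⬝ᵥ cplx α ≠ 0 := by
  rw [cplx_dotProduct]
  exact_mod_cast inner_self_ne_zero.2 h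

namespace RootDatum

/-- The action of `w` on `ℂ[𝔥]`, extending the one on `𝔥^*`. -/
def polyAct (w : Φ.W) : MvPolynomial (Fin r) ℂ →ₐ[ℂ] MvPolynomial (Fin r) ℂ :=
  MvPolynomial.aeval fun i => linForm (Φ.hRep w (Pi.single i 1))

theorem polyAct_linForm (w : Φ.W) (v : Fin r → ℂ) :
    Φ.polyAct w (linForm v) = linForm (Φ.hRep w v) := by
  have hv : v = ∑ i, v i • (Pi.single i 1 : Fin r → ℂ) := by
    ext k; simp [Finset.sum_apply, Pi.single_apply]
  conv_rhs => rw [hv]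
  simp only [linForm_apply v, map_sum, map_smul, polyAct, MvPolynomial.aeval_X]

theorem polyAct_one : Φ.polyAct 1 = AlgHom.id ℂ _ := by
  apply MvPolynomial.algHom_ext
  intro i
  simp [polyAct, linForm_apply, Pi.single_apply]

theorem polyAct_mul (w w' : Φ.W) : Φ.polyAct (w * w') = (Φ.polyAct w).comp (Φ.polyAct w') := by
  apply MvPolynomial.algHom_ext
  intro i
  rw [AlgHom.comp_apply, ← linForm_single i, polyAct_linForm, polyAct_linForm, polyAct_linForm,
    map_mul]
  rfl

/-- The representation of the group on `ℂ[𝔥]`. -/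
def polyRep : Representation ℂ Φ.W (MvPolynomial (Fin r) ℂ) where
  toFun w := (Φ.polyAct w).toLinearMap
  map_one' := by rw [polyAct_one]; rfl
  map_mul' w w' := by rw [polyAct_mul]; rfl

theorem hRep_cplx (w : Φ.W) (v : Euc r) :
    Φ.hRep w (cplx v) = cplx ((w : Euc r ≃ₗᵢ[ℝ] Euc r) v) := by
  ext i
  simp only [hRep, MonoidHom.coe_mk, OneHom.coe_mk, Matrix.toLin'_apply, Matrix.mulVec,
    dotProduct, mat, Matrix.of_apply, cplx]
  rw [apply_eq (w : Euc r ≃ₗᵢ[ℝ] Euc r) v i]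
  push_cast; rfl

theorem hRep_single (w : Φ.W) (i : Fin r) :
    Φ.hRep w (Pi.single i 1) =
      cplx ((w : Euc r ≃ₗᵢ[ℝ] Euc r) (EuclideanSpace.single i (1 : ℝ))) := by
  rw [← cplx_single, hRep_cplx]

theorem hRep_dotProduct (w : Φ.W) (u v : Fin r → ℂ) :
    Φ.hRep w u ⬝ᵥ Φ.hRep w v = u ⬝ᵥ v := by
  have h : ((Φ.mat w)ᵀ * Φ.mat w) = 1 := by
    ext i j
    have h1 : ((Φ.mat w)ᵀ * Φ.mat w) i j
        = Φ.hRep w (Pi.single i 1) ⬝ᵥ Φ.hRep w (Pi.single j 1) := by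
      simp [Matrix.mul_apply, hRep, dotProduct]
    rw [h1, hRep_single, hRep_single, cplx_dotProduct, LinearIsometryEquiv.inner_map_map,
      ← cplx_dotProduct, cplx_single, cplx_single]
    by_cases h : i = j <;> simp [Matrix.one_apply, h]
  change (Φ.mat w *ᵥ u) ⬝ᵥ (Φ.mat w *ᵥ v) = _
  rw [Matrix.dotProduct_mulVec, ← Matrix.mulVec_transpose, Matrix.mulVec_mulVec, h,
    Matrix.one_mulVec]

theorem hRep_s (α : Φ.R) (v : Fin r → ℂ) :
    Φ.hRep (Φ.s α) v = v - (v ⬝ᵥ coroot (α : Euc r)) • cplx (α : Euc r) := by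
  have key : Φ.hRep (Φ.s α) = LinearMap.id -
      ((dotProductBilin ℂ ℂ).flip (coroot (α : Euc r))).smulRight (cplx (α : Euc r)) := by
    apply LinearMap.pi_ext'
    intro i
    apply LinearMap.ext_ring
    simp only [LinearMap.comp_apply, LinearMap.coe_single, LinearMap.sub_apply,
      LinearMap.id_apply, LinearMap.smulRight_apply]
    rw [hRep_single]
    simp only [s]
    rw [Submodule.reflection_orthogonal_apply, Submodule.reflection_singleton_apply]
    ext k
    have h1 : inner ℝ (α : Euc r) (EuclideanSpace.single i (1 : ℝ)) = (α : Euc r) i := by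
      simp [EuclideanSpace.inner_single_right]
    have h2 : ((Pi.single i 1 : Fin r → ℂ) ⬝ᵥ coroot (α : Euc r)) =
        2 / (((‖(α : Euc r)‖ ^ 2 : ℝ)) : ℂ) * (((α : Euc r) i : ℝ) : ℂ) := by
      simp [coroot, cplx, cplx_dotProduct]
    have h3 : (dotProductBilin ℂ ℂ).flip (coroot (α : Euc r)) (Pi.single i 1) =
        ((Pi.single i 1 : Fin r → ℂ) ⬝ᵥ coroot (α : Euc r)) := rfl
    rw [h1, Pi.sub_apply, Pi.smul_apply, h3, h2, ← cplx_single]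
    simp only [cplx, PiLp.neg_apply, PiLp.sub_apply, PiLp.smul_apply, smul_eq_mul]
    push_cast
    simp
    ring
  rw [key]
  simp [dotProductBilin]

theorem polyAct_s_linForm (α : Φ.R) (v : Fin r → ℂ) :
    Φ.polyAct (Φ.s α) (linForm v) =
      linForm v - (v ⬝ᵥ coroot (α : Euc r)) • linForm (cplx (α : Euc r)) := by
  rw [polyAct_linForm, hRep_s, map_sub, map_smul]

theorem linForm_ne_zero (α : Φ.R) : linForm (cplx (α : Euc r)) ≠ 0 := by
  intro h
  apply dotProduct_cplx_self_ne (Φ.ne_zero α)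
  have := congrArg (MvPolynomial.aeval (cplx (α : Euc r))) h
  simpa [linForm_apply, dotProduct] using this

theorem linForm_dvd (α : Φ.R) (p : MvPolynomial (Fin r) ℂ) :
    linForm (cplx (α : Euc r)) ∣ p - Φ.polyAct (Φ.s α) p := by
  induction p using MvPolynomial.induction_on with
  | C a => simp [polyAct]
  | add p q hp hq =>
    rw [map_add, add_sub_add_comm]
    exact dvd_add hp hq
  | mul_X p i hp =>
    have h : p * MvPolynomial.X i - Φ.polyAct (Φ.s α) (p * MvPolynomial.X i) =
        (p - Φ.polyAct (Φ.s α) p) * MvPolynomial.X i + Φ.polyAct (Φ.s α) p *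
          (MvPolynomial.X i - Φ.polyAct (Φ.s α) (MvPolynomial.X i)) := by
      rw [map_mul]; ring
    rw [h, ← linForm_single i, polyAct_s_linForm, sub_sub_cancel, MvPolynomial.smul_eq_C_mul]
    exact dvd_add (Dvd.dvd.mul_right hp _) (Dvd.intro_left _ (by rw [mul_assoc]))

/-- The divided difference operator `Δ_α = (1 - s_α) / α` on `ℂ[𝔥]`. -/
def divDiff (α : Φ.R) : MvPolynomial (Fin r) ℂ →ₗ[ℂ] MvPolynomial (Fin r) ℂ where
  toFun p := (Φ.linForm_dvd α p).choose
  map_add' p q := by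
    apply mul_left_cancel₀ (Φ.linForm_ne_zero α)
    rw [mul_add, ← (Φ.linForm_dvd α p).choose_spec, ← (Φ.linForm_dvd α q).choose_spec,
      ← (Φ.linForm_dvd α (p + q)).choose_spec, map_add, add_sub_add_comm]
  map_smul' a p := by
    apply mul_left_cancel₀ (Φ.linForm_ne_zero α)
    rw [RingHom.id_apply, mul_smul_comm, ← (Φ.linForm_dvd α p).choose_spec,
      ← (Φ.linForm_dvd α (a • p)).choose_spec, map_smul, smul_sub]

theorem linForm_mul_divDiff (α : Φ.R) (p : MvPolynomial (Fin r) ℂ) :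
    linForm (cplx (α : Euc r)) * Φ.divDiff α p = p - Φ.polyRep (Φ.s α) p :=
  ((Φ.linForm_dvd α p).choose_spec).symm

end RootDatum

/-- The directional derivative `∂_y` on `ℂ[𝔥]`. -/
def dirDeriv (y : Fin r → ℂ) :
    Derivation ℂ (MvPolynomial (Fin r) ℂ) (MvPolynomial (Fin r) ℂ) :=
  MvPolynomial.mkDerivation ℂ fun i => MvPolynomial.C (y i)

theorem dirDeriv_linForm (y x : Fin r → ℂ) :
    dirDeriv y (linForm x) = MvPolynomial.C (x ⬝ᵥ y) := by
  simp [dirDeriv, linForm_apply, dotProduct, MvPolynomial.mkDerivation_X,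
    MvPolynomial.smul_eq_C_mul, MvPolynomial.C_mul]

namespace RootDatum

section Standard

variable {V : Type*} [AddCommGroup V] [Module ℂ V]

/-- The diagonal action of the group on `M_c(τ) = ℂ[𝔥] ⊗ V(τ)`. -/
def stdRep (τ : Representation ℂ Φ.W V) :
    Representation ℂ Φ.W (MvPolynomial (Fin r) ℂ ⊗[ℂ] V) :=
  Φ.polyRep.tprod τ

/-- Multiplication by `x ∈ 𝔥^*` on `M_c(τ) = ℂ[𝔥] ⊗ V(τ)`. -/
def mulOp (V : Type*) [AddCommGroup V] [Module ℂ V] (x : Fin r → ℂ) :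
    Module.End ℂ (MvPolynomial (Fin r) ℂ ⊗[ℂ] V) :=
  TensorProduct.map (LinearMap.mulLeft ℂ (linForm x)) LinearMap.id

/-- The action of `y ∈ 𝔥` on `M_c(τ) = ℂ[𝔥] ⊗ V(τ)`, that is, the Dunkl operator
`p ⊗ v ↦ ∂_y p ⊗ v - ∑_{α > 0} c_α ⟨α, y⟩ Δ_α p ⊗ s_α v`. -/
def dunkl (c : Φ.R → ℂ) (τ : Representation ℂ Φ.W V) (y : Fin r → ℂ) :
    Module.End ℂ (MvPolynomial (Fin r) ℂ ⊗[ℂ] V) :=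
  TensorProduct.map (dirDeriv y).toLinearMap LinearMap.id -
    ∑ α ∈ Φ.Pos, (c α * (cplx (α : Euc r) ⬝ᵥ y)) •
      TensorProduct.map (Φ.divDiff α) (τ (Φ.s α))

variable {Φ}
variable (c : Φ.R → ℂ) (τ : Representation ℂ Φ.W V)

theorem dunkl_tmul (y : Fin r → ℂ) (p : MvPolynomial (Fin r) ℂ) (v : V) :
    Φ.dunkl c τ y (p ⊗ₜ v) = dirDeriv y p ⊗ₜ v -
      ∑ α ∈ Φ.Pos, (c α * (cplx (α : Euc r) ⬝ᵥ y)) • (Φ.divDiff α p ⊗ₜ τ (Φ.s α) v) := by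
  simp [dunkl, LinearMap.sum_apply]

theorem divDiff_mul (α : Φ.R) (x : Fin r → ℂ) (p : MvPolynomial (Fin r) ℂ) :
    Φ.divDiff α (linForm x * p) = linForm x * Φ.divDiff α p +
      (x ⬝ᵥ coroot (α : Euc r)) • Φ.polyRep (Φ.s α) p := by
  apply mul_left_cancel₀ (Φ.linForm_ne_zero α)
  have h : Φ.polyRep (Φ.s α) (linForm x * p) =
      (linForm x - (x ⬝ᵥ coroot (α : Euc r)) • linForm (cplx (α : Euc r))) *
        Φ.polyRep (Φ.s α) p := by
    rw [← polyAct_s_linForm]; exact map_mul (Φ.polyAct (Φ.s α)) _ _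
  rw [mul_add, mul_left_comm, linForm_mul_divDiff, linForm_mul_divDiff, h]
  simp only [MvPolynomial.smul_eq_C_mul]
  ring

theorem dunkl_mulOp (x y : Fin r → ℂ) :
    Φ.dunkl c τ y * mulOp V x = mulOp V x * Φ.dunkl c τ y + (x ⬝ᵥ y) • 1 -
      ∑ α ∈ Φ.Pos, (c α * (cplx (α : Euc r) ⬝ᵥ y) * (x ⬝ᵥ coroot (α : Euc r))) •
        Φ.stdRep τ (Φ.s α) := by
  apply TensorProduct.ext'
  intro p v
  simp only [LinearMap.sub_apply, LinearMap.add_apply, Module.End.mul_apply, LinearMap.smul_apply,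
    Module.End.one_apply, LinearMap.sum_apply, mulOp, TensorProduct.map_tmul, LinearMap.mulLeft_apply,
    LinearMap.id_apply, dunkl_tmul, divDiff_mul, stdRep, Representation.tprod_apply,
    map_sub, map_sum, map_smul, TensorProduct.add_tmul, smul_add, Finset.sum_add_distrib,
    Derivation.leibniz, dirDeriv_linForm]
  have h : (p • MvPolynomial.C (x ⬝ᵥ y)) ⊗ₜ[ℂ] v = (x ⬝ᵥ y) • (p ⊗ₜ[ℂ] v) := by
    rw [smul_eq_mul, mul_comm, ← MvPolynomial.smul_eq_C_mul, TensorProduct.smul_tmul']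
  rw [h, smul_eq_mul]
  simp only [mul_smul, TensorProduct.smul_tmul']
  abel

theorem apply_mem_iff (w : Φ.W) (α : Euc r) :
    α ∈ Φ.R ↔ (w : Euc r ≃ₗᵢ[ℝ] Euc r) α ∈ Φ.R := by
  obtain ⟨g, hg⟩ := w
  change α ∈ Φ.R ↔ g α ∈ Φ.R
  induction hg using Subgroup.closure_induction generalizing α with
  | mem g hg =>
    obtain ⟨β, hβ, rfl⟩ := hg
    refine ⟨Φ.reflection_mem β hβ α, fun h => ?_⟩
    simpa using Φ.reflection_mem β hβ _ h
  | one => rfl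
  | mul g g' _ _ h h' => rw [h' α, h (g' α)]; rfl
  | inv g _ h => rw [h (g⁻¹ α)]; simp [LinearIsometryEquiv.inv_def]

/-- The permutation of the roots given by `w`. -/
def act (Φ : RootDatum r) (w : Φ.W) : Φ.R ≃ Φ.R :=
  (w : Euc r ≃ₗᵢ[ℝ] Euc r).toEquiv.subtypeEquiv (apply_mem_iff w)

theorem act_coe (w : Φ.W) (α : Φ.R) :
    (Φ.act w α : Euc r) = (w : Euc r ≃ₗᵢ[ℝ] Euc r) α := rfl

theorem s_coe_apply (α : Φ.R) (v : Euc r) :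
    (Φ.s α : Euc r ≃ₗᵢ[ℝ] Euc r) v =
      v - (2 * (inner ℝ (α : Euc r) v / ‖(α : Euc r)‖ ^ 2)) • (α : Euc r) := by
  simp only [s]
  rw [Submodule.reflection_orthogonal_apply, Submodule.reflection_singleton_apply, neg_sub]
  simp only [RCLike.ofReal_real_eq_id, id_eq]
  rw [mul_smul, two_smul, two_smul]

theorem s_mul (w : Φ.W) (α : Φ.R) : Φ.s (Φ.act w α) * w = w * Φ.s α := by
  apply Subtype.ext
  apply LinearIsometryEquiv.ext
  intro v
  change (Φ.s (Φ.act w α) : Euc r ≃ₗᵢ[ℝ] Euc r) ((w : Euc r ≃ₗᵢ[ℝ] Euc r) v) =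
    (w : Euc r ≃ₗᵢ[ℝ] Euc r) ((Φ.s α : Euc r ≃ₗᵢ[ℝ] Euc r) v)
  rw [s_coe_apply, s_coe_apply, act_coe, LinearIsometryEquiv.inner_map_map,
    LinearIsometryEquiv.norm_map, map_sub, map_smul]

theorem s_self (α : Φ.R) : (Φ.s α : Euc r ≃ₗᵢ[ℝ] Euc r) α = -(α : Euc r) :=
  Submodule.reflection_orthogonalComplement_singleton_eq_neg _

theorem s_neg {α β : Φ.R} (h : (β : Euc r) = -α) : Φ.s β = Φ.s α := by
  apply Subtype.ext
  apply LinearIsometryEquiv.ext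
  intro v
  rw [s_coe_apply, s_coe_apply, h]
  simp [neg_div]

theorem cplx_neg (v : Euc r) : cplx (-v) = -cplx v := by
  ext i; simp [cplx]

theorem divDiff_neg {α β : Φ.R} (h : (β : Euc r) = -α) : Φ.divDiff β = -Φ.divDiff α := by
  refine LinearMap.ext fun p => ?_
  apply mul_left_cancel₀ (Φ.linForm_ne_zero β)
  rw [linForm_mul_divDiff, s_neg h, ← linForm_mul_divDiff, h, cplx_neg, map_neg]
  simp

theorem divDiff_act (w : Φ.W) (α : Φ.R) (p : MvPolynomial (Fin r) ℂ) :
    Φ.divDiff (Φ.act w α) (Φ.polyRep w p) = Φ.polyRep w (Φ.divDiff α p) := by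
  apply mul_left_cancel₀ (Φ.linForm_ne_zero (Φ.act w α))
  have h1 : linForm (cplx (Φ.act w α : Euc r)) * Φ.polyRep w (Φ.divDiff α p) =
      Φ.polyRep w (linForm (cplx (α : Euc r)) * Φ.divDiff α p) := by
    rw [act_coe, ← hRep_cplx, ← polyAct_linForm]
    exact (map_mul (Φ.polyAct w) _ _).symm
  rw [h1, linForm_mul_divDiff, linForm_mul_divDiff, map_sub, ← Module.End.mul_apply,
    ← map_mul, s_mul, map_mul, Module.End.mul_apply]

theorem IsParam.act {c : Φ.R → ℂ} (hc : Φ.IsParam c) (w : Φ.W) (α : Φ.R) :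
    c (Φ.act w α) = c α := hc w α _ (act_coe w α)

theorem IsParam.neg {c : Φ.R → ℂ} (hc : Φ.IsParam c) {α β : Φ.R} (h : (β : Euc r) = -α) :
    c β = c α := hc (Φ.s α) α β (by rw [h, s_self])

theorem sum_pos_act {N : Type*} [AddCommGroup N] [Module ℂ N] (F : Φ.R → N)
    (hF : ∀ α β : Φ.R, (β : Euc r) = -α → F β = F α) (w : Φ.W) :
    ∑ α ∈ Φ.Pos, F (Φ.act w α) = ∑ α ∈ Φ.Pos, F α := by
  classical
  have half : ∀ G : Φ.R → N, (∀ α β : Φ.R, (β : Euc r) = -α → G β = G α) →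
      ∑ α, G α = (2 : ℂ) • ∑ α ∈ Φ.Pos, G α := by
    intro G hG
    have hP : Φ.Pos = Finset.univ.filter
        (fun α : Φ.R => 0 < inner ℝ (α : Euc r) Φ.chamber) := by
      ext α; simp [Pos]
    rw [two_smul, hP, ← Finset.sum_filter_add_sum_filter_not Finset.univ
      (fun α : Φ.R => 0 < inner ℝ (α : Euc r) Φ.chamber)]
    congr 1
    · let e : Φ.R → Φ.R := fun α => Φ.act (Φ.s α) α
      have he : ∀ α, (e α : Euc r) = -α := fun α => by simp only [e, act_coe, s_self]
      have hee : ∀ α, e (e α) = α := fun α => Subtype.ext (by rw [he, he, neg_neg])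
      refine Finset.sum_bij' (fun α _ => e α) (fun α _ => e α) ?_ ?_ ?_ ?_ ?_
      · intro α h
        have h := (Finset.mem_filter.1 h).2
        simp only [Finset.mem_filter, Finset.mem_univ, true_and]
        rw [he, inner_neg_left]
        have := Φ.regular α α.2
        push Not at h
        have := lt_of_le_of_ne h this
        linarith
      · intro α h
        have h := (Finset.mem_filter.1 h).2
        simp only [Finset.mem_filter, Finset.mem_univ, true_and]
        rw [he, inner_neg_left]
        linarith
      · intro α _; exact hee α
      · intro α _; exact hee α
      · intro α _; exact (hG α _ (he α)).symm
  have h2 := half F hF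
  have h3 := half (fun α => F (Φ.act w α)) (fun α β h => hF _ _ (by
    rw [act_coe, act_coe, h, map_neg]))
  rw [Equiv.sum_comp (Φ.act w) F, h2] at h3
  have : (2 : ℂ) ≠ 0 := two_ne_zero
  exact (smul_right_injective N this h3).symm

theorem dirDeriv_polyRep (w : Φ.W) (y : Fin r → ℂ) (p : MvPolynomial (Fin r) ℂ) :
    Φ.polyRep w (dirDeriv y p) = dirDeriv (Φ.hRep w y) (Φ.polyRep w p) := by
  change Φ.polyAct w (dirDeriv y p) = dirDeriv (Φ.hRep w y) (Φ.polyAct w p)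
  induction p using MvPolynomial.induction_on with
  | C a => simp [polyAct, dirDeriv]
  | add p q hp hq => simp only [map_add, hp, hq]
  | mul_X p i hp =>
    rw [← linForm_single i, Derivation.leibniz, map_mul, Derivation.leibniz, polyAct_linForm,
      dirDeriv_linForm, dirDeriv_linForm, hRep_dotProduct, map_add, smul_eq_mul, smul_eq_mul,
      smul_eq_mul, smul_eq_mul, map_mul, map_mul, hp, polyAct_linForm]
    simp [polyAct]

theorem stdRep_mul_mulOp (w : Φ.W) (x : Fin r → ℂ) :
    Φ.stdRep τ w * mulOp V x = mulOp V (Φ.hRep w x) * Φ.stdRep τ w := by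
  apply TensorProduct.ext'
  intro p v
  have h : Φ.polyRep w (linForm x * p) = linForm (Φ.hRep w x) * Φ.polyRep w p := by
    rw [← polyAct_linForm]; exact map_mul (Φ.polyAct w) _ _
  simp [stdRep, mulOp, Module.End.mul_apply, h]

theorem stdRep_mul_dunkl {c : Φ.R → ℂ} (hc : Φ.IsParam c) (w : Φ.W) (y : Fin r → ℂ) :
    Φ.stdRep τ w * Φ.dunkl c τ y = Φ.dunkl c τ (Φ.hRep w y) * Φ.stdRep τ w := by
  apply TensorProduct.ext'
  intro p v
  simp only [Module.End.mul_apply, dunkl_tmul, stdRep, Representation.tprod_apply,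
    map_sub, map_sum, map_smul, TensorProduct.map_tmul, dirDeriv_polyRep]
  congr 1
  rw [← sum_pos_act (fun β : Φ.R => (c β * (cplx (β : Euc r) ⬝ᵥ Φ.hRep w y)) •
    Φ.divDiff β (Φ.polyRep w p) ⊗ₜ[ℂ] τ (Φ.s β) (τ w v)) _ w]
  · refine Finset.sum_congr rfl fun α _ => ?_
    rw [divDiff_act, act_coe, ← hRep_cplx, hRep_dotProduct, hc.act, ← Module.End.mul_apply (τ _),
      ← Module.End.mul_apply (τ _), ← map_mul, ← map_mul, s_mul]
  · intro α β h
    rw [divDiff_neg h, s_neg h, hc.neg h, h, cplx_neg, neg_dotProduct, LinearMap.neg_apply,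
      TensorProduct.neg_tmul, mul_neg, neg_smul_neg]

theorem dunkl_add (y y' : Fin r → ℂ) :
    Φ.dunkl c τ (y + y') = Φ.dunkl c τ y + Φ.dunkl c τ y' := by
  have h : ∀ p, dirDeriv (y + y') p = dirDeriv y p + dirDeriv y' p := by
    intro p
    have : dirDeriv (y + y') = dirDeriv y + dirDeriv y' := by
      apply MvPolynomial.derivation_ext
      intro i
      simp [dirDeriv, MvPolynomial.mkDerivation_X]
    rw [this]; rfl
  apply TensorProduct.ext'
  intro p v
  simp only [LinearMap.add_apply, dunkl_tmul, dotProduct_add, mul_add, add_smul,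
    Finset.sum_add_distrib, h, TensorProduct.add_tmul]
  abel

theorem dunkl_smul (a : ℂ) (y : Fin r → ℂ) :
    Φ.dunkl c τ (a • y) = a • Φ.dunkl c τ y := by
  have h : ∀ p, dirDeriv (a • y) p = a • dirDeriv y p := by
    intro p
    have : dirDeriv (a • y) = a • dirDeriv y := by
      apply MvPolynomial.derivation_ext
      intro i
      simp [dirDeriv, MvPolynomial.mkDerivation_X, MvPolynomial.smul_eq_C_mul]
    rw [this]; rfl
  apply TensorProduct.ext'
  intro p v
  simp only [LinearMap.smul_apply, dunkl_tmul, dotProduct_smul, h, smul_sub, Finset.smul_sum,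
    TensorProduct.smul_tmul', smul_smul, smul_eq_mul]
  congr 1
  refine Finset.sum_congr rfl fun α _ => ?_
  congr 2
  ring

theorem dunkl_one_tmul (y : Fin r → ℂ) (v : V) :
    Φ.dunkl c τ y ((1 : MvPolynomial (Fin r) ℂ) ⊗ₜ v) = 0 := by
  have h : ∀ α : Φ.R, Φ.divDiff α 1 = 0 := by
    intro α
    apply mul_left_cancel₀ (Φ.linForm_ne_zero α)
    rw [linForm_mul_divDiff, mul_zero, sub_eq_zero]
    exact (map_one (Φ.polyAct (Φ.s α))).symm
  simp [dunkl_tmul, h]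

theorem std_ext {N : Type*} [AddCommGroup N] [Module ℂ N]
    {f g : MvPolynomial (Fin r) ℂ ⊗[ℂ] V →ₗ[ℂ] N}
    (h1 : ∀ v, f ((1 : MvPolynomial (Fin r) ℂ) ⊗ₜ v) = g ((1 : MvPolynomial (Fin r) ℂ) ⊗ₜ v))
    (h2 : ∀ x m, f m = g m → f (mulOp V x m) = g (mulOp V x m)) : f = g := by
  apply TensorProduct.ext'
  intro p v
  induction p using MvPolynomial.induction_on with
  | C a =>
    rw [MvPolynomial.C_eq_smul_one, ← TensorProduct.smul_tmul', map_smul, map_smul, h1]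
  | add p q hp hq => rw [TensorProduct.add_tmul, map_add, map_add, hp, hq]
  | mul_X p i hp =>
    have := h2 (Pi.single i 1) _ hp
    rwa [mulOp, TensorProduct.map_tmul, linForm_single, LinearMap.mulLeft_apply, mul_comm] at this

theorem dunkl_comm {c : Φ.R → ℂ} (hc : Φ.IsParam c) (y y' : Fin r → ℂ) :
    Φ.dunkl c τ y * Φ.dunkl c τ y' = Φ.dunkl c τ y' * Φ.dunkl c τ y := by
  have hs : ∀ (α : Φ.R) (η : Fin r → ℂ) (m : MvPolynomial (Fin r) ℂ ⊗[ℂ] V),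
      Φ.dunkl c τ η (Φ.stdRep τ (Φ.s α) m) =
      Φ.stdRep τ (Φ.s α) (Φ.dunkl c τ η m) - (η ⬝ᵥ coroot (α : Euc r)) •
        (Φ.stdRep τ (Φ.s α) (Φ.dunkl c τ (cplx (α : Euc r)) m)) := by
    intro α η m
    have h := stdRep_mul_dunkl τ hc (Φ.s α)
      (η + (-(η ⬝ᵥ coroot (α : Euc r))) • cplx (α : Euc r))
    have h' : Φ.hRep (Φ.s α) (η + (-(η ⬝ᵥ coroot (α : Euc r))) • cplx (α : Euc r)) = η := by
      rw [neg_smul, ← sub_eq_add_neg, ← hRep_s, ← Module.End.mul_apply, ← map_mul]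
      have : Φ.s α * Φ.s α = 1 := by
        apply Subtype.ext
        exact Submodule.reflection_mul_reflection _
      rw [this, map_one]; rfl
    rw [h', dunkl_add, dunkl_smul] at h
    have h := LinearMap.congr_fun h m
    simp only [Module.End.mul_apply, LinearMap.add_apply, LinearMap.smul_apply, map_add,
      map_smul] at h
    rw [← h, sub_eq_add_neg]
    congr 1
    exact (neg_smul (η ⬝ᵥ coroot (α : Euc r))
      (Φ.stdRep τ (Φ.s α) (Φ.dunkl c τ (cplx (α : Euc r)) m)))
  have hx : ∀ (x y : Fin r → ℂ) (m : MvPolynomial (Fin r) ℂ ⊗[ℂ] V),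
      Φ.dunkl c τ y (mulOp V x m) = mulOp V x (Φ.dunkl c τ y m) + (x ⬝ᵥ y) • m -
      ∑ α ∈ Φ.Pos, (c α * (cplx (α : Euc r) ⬝ᵥ y) * (x ⬝ᵥ coroot (α : Euc r))) •
        Φ.stdRep τ (Φ.s α) m := by
    intro x y m
    have h := LinearMap.congr_fun (dunkl_mulOp c τ x y) m
    simpa only [Module.End.mul_apply, LinearMap.add_apply, LinearMap.smul_apply,
      LinearMap.sub_apply, LinearMap.sum_apply, Module.End.one_apply] using h
  have e : ∀ (x η η' : Fin r → ℂ) (m : MvPolynomial (Fin r) ℂ ⊗[ℂ] V),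
      Φ.dunkl c τ η (Φ.dunkl c τ η' (mulOp V x m)) =
      mulOp V x (Φ.dunkl c τ η (Φ.dunkl c τ η' m)) + (x ⬝ᵥ η) • Φ.dunkl c τ η' m +
        (x ⬝ᵥ η') • Φ.dunkl c τ η m -
        ∑ α ∈ Φ.Pos, (c α * (x ⬝ᵥ coroot (α : Euc r))) • (Φ.stdRep τ (Φ.s α)
          ((cplx (α : Euc r) ⬝ᵥ η) • Φ.dunkl c τ η' m + (cplx (α : Euc r) ⬝ᵥ η') •
            Φ.dunkl c τ η m - ((cplx (α : Euc r) ⬝ᵥ η') * (η ⬝ᵥ coroot (α : Euc r))) •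
            Φ.dunkl c τ (cplx (α : Euc r)) m)) := by
    intro x η η' m
    rw [hx, map_sub, map_add, hx, map_smul, map_sum]
    simp only [map_smul, hs, map_add, map_sub, smul_add, smul_sub, Finset.sum_add_distrib,
      Finset.sum_sub_distrib, smul_smul]
    have c1 : ∀ a b d : ℂ, a * b * d = a * d * b := fun a b d => by ring
    have c2 : ∀ a b d f : ℂ, a * b * d * f = a * d * (b * f) := fun a b d f => by ring
    simp only [c2]
    simp only [c1 _ _ (x ⬝ᵥ _)]
    abel
  have key : ∀ x m, Φ.dunkl c τ y (Φ.dunkl c τ y' (mulOp V x m)) -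
      Φ.dunkl c τ y' (Φ.dunkl c τ y (mulOp V x m)) =
      mulOp V x (Φ.dunkl c τ y (Φ.dunkl c τ y' m)) -
        mulOp V x (Φ.dunkl c τ y' (Φ.dunkl c τ y m)) := by
    intro x m
    rw [e, e]
    have : ∀ α : Φ.R, (cplx (α : Euc r) ⬝ᵥ y') * (y ⬝ᵥ coroot (α : Euc r)) =
        (cplx (α : Euc r) ⬝ᵥ y) * (y' ⬝ᵥ coroot (α : Euc r)) := by
      intro α
      simp only [coroot, smul_dotProduct, smul_eq_mul, dotProduct_comm y, dotProduct_comm y']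
      ring
    simp only [this]
    have h3 : ∀ α : Φ.R, (cplx (α : Euc r) ⬝ᵥ y') • Φ.dunkl c τ y m +
        (cplx (α : Euc r) ⬝ᵥ y) • Φ.dunkl c τ y' m = (cplx (α : Euc r) ⬝ᵥ y) • Φ.dunkl c τ y' m +
        (cplx (α : Euc r) ⬝ᵥ y') • Φ.dunkl c τ y m := fun α => add_comm _ _
    simp only [h3]
    abel
  refine std_ext ?_ ?_
  · intro v
    simp only [Module.End.mul_apply, dunkl_one_tmul, map_zero]
  · intro x m hm
    simp only [Module.End.mul_apply] at hm ⊢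
    have := key x m
    rwa [hm, sub_self, sub_eq_zero] at this

end Standard

section Cherednik

/-- Generators of the rational Cherednik algebra. -/
inductive Gen
  | x (ξ : Fin r → ℂ)
  | y (η : Fin r → ℂ)
  | g (w : Φ.W)

variable {Φ}

open FreeAlgebra in
/-- Relations of the rational Cherednik algebra `H_c(W, 𝔥)`. -/
inductive CherednikRel (c : Φ.R → ℂ) :
    FreeAlgebra ℂ (Gen Φ) → FreeAlgebra ℂ (Gen Φ) → Prop
  | x_add (ξ ξ') : CherednikRel c (ι ℂ (.x (ξ + ξ'))) (ι ℂ (.x ξ) + ι ℂ (.x ξ'))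
  | x_smul (a : ℂ) (ξ) : CherednikRel c (ι ℂ (.x (a • ξ))) (a • ι ℂ (.x ξ))
  | y_add (η η') : CherednikRel c (ι ℂ (.y (η + η'))) (ι ℂ (.y η) + ι ℂ (.y η'))
  | y_smul (a : ℂ) (η) : CherednikRel c (ι ℂ (.y (a • η))) (a • ι ℂ (.y η))
  | g_one : CherednikRel c (ι ℂ (.g 1)) 1
  | g_mul (w w') : CherednikRel c (ι ℂ (.g (w * w'))) (ι ℂ (.g w) * ι ℂ (.g w'))
  | g_x (w ξ) : CherednikRel c (ι ℂ (.g w) * ι ℂ (.x ξ)) (ι ℂ (.x (Φ.hRep w ξ)) * ι ℂ (.g w))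
  | g_y (w η) : CherednikRel c (ι ℂ (.g w) * ι ℂ (.y η)) (ι ℂ (.y (Φ.hRep w η)) * ι ℂ (.g w))
  | x_x (ξ ξ') : CherednikRel c (ι ℂ (.x ξ) * ι ℂ (.x ξ')) (ι ℂ (.x ξ') * ι ℂ (.x ξ))
  | y_y (η η') : CherednikRel c (ι ℂ (.y η) * ι ℂ (.y η')) (ι ℂ (.y η') * ι ℂ (.y η))
  | y_x (ξ η) : CherednikRel c (ι ℂ (.y η) * ι ℂ (.x ξ))
      (ι ℂ (.x ξ) * ι ℂ (.y η) + (ξ ⬝ᵥ η) • 1 -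
        ∑ α ∈ Φ.Pos, (c α * (cplx (α : Euc r) ⬝ᵥ η) * (ξ ⬝ᵥ coroot (α : Euc r))) •
          ι ℂ (.g (Φ.s α)))

/-- The rational Cherednik algebra `H_c(W, 𝔥)` (with `t = 1`). -/
abbrev Cherednik (c : Φ.R → ℂ) := RingQuot (CherednikRel c)

/-- The generators of the rational Cherednik algebra. -/
def Cherednik.gen (c : Φ.R → ℂ) (a : Gen Φ) : Cherednik c :=
  RingQuot.mkAlgHom ℂ (CherednikRel c) (FreeAlgebra.ι ℂ a)

variable {V : Type*} [AddCommGroup V] [Module ℂ V]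

/-- The operators by which the generators of `H_c(W, 𝔥)` act on `M_c(τ) = ℂ[𝔥] ⊗ V(τ)`. -/
def genOp (c : Φ.R → ℂ) (τ : Representation ℂ Φ.W V) :
    Gen Φ → Module.End ℂ (MvPolynomial (Fin r) ℂ ⊗[ℂ] V)
  | .x ξ => mulOp V ξ
  | .y η => Φ.dunkl c τ η
  | .g w => Φ.stdRep τ w

/-- The standard module `M_c(τ) = ℂ[𝔥] ⊗ V(τ)` as a module over `H_c(W, 𝔥)`. -/
def stdAction {c : Φ.R → ℂ} (hc : Φ.IsParam c) (τ : Representation ℂ Φ.W V) :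
    Cherednik c →ₐ[ℂ] Module.End ℂ (MvPolynomial (Fin r) ℂ ⊗[ℂ] V) :=
  RingQuot.liftAlgHom ℂ ⟨FreeAlgebra.lift ℂ (genOp c τ), by
    intro a b h
    induction h with
    | x_add ξ ξ' =>
      simp only [map_add, FreeAlgebra.lift_ι_apply, genOp]
      apply TensorProduct.ext'
      intro p v
      simp [mulOp, TensorProduct.add_tmul, add_mul]
    | x_smul a ξ =>
      simp only [map_smul, FreeAlgebra.lift_ι_apply, genOp]
      apply TensorProduct.ext'
      intro p v
      simp [mulOp, TensorProduct.smul_tmul']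
    | y_add η η' => simp only [map_add, FreeAlgebra.lift_ι_apply, genOp, dunkl_add]
    | y_smul a η => simp only [map_smul, FreeAlgebra.lift_ι_apply, genOp, dunkl_smul]
    | g_one => simp only [FreeAlgebra.lift_ι_apply, genOp, map_one]
    | g_mul w w' => simp only [map_mul, FreeAlgebra.lift_ι_apply, genOp]
    | g_x w ξ => simp only [map_mul, FreeAlgebra.lift_ι_apply, genOp, stdRep_mul_mulOp]
    | g_y w η => simp only [map_mul, FreeAlgebra.lift_ι_apply, genOp, stdRep_mul_dunkl τ hc]
    | x_x ξ ξ' =>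
      simp only [map_mul, FreeAlgebra.lift_ι_apply, genOp]
      apply TensorProduct.ext'
      intro p v
      simp [mulOp, Module.End.mul_apply, mul_left_comm]
    | y_y η η' =>
      simp only [map_mul, FreeAlgebra.lift_ι_apply, genOp]
      exact dunkl_comm τ hc η η'
    | y_x ξ η =>
      simp only [map_mul, map_add, map_sub, map_sum, map_smul, map_one, FreeAlgebra.lift_ι_apply,
        genOp]
      exact dunkl_mulOp c τ ξ η⟩

theorem stdAction_gen {c : Φ.R → ℂ} (hc : Φ.IsParam c) (τ : Representation ℂ Φ.W V)
    (a : Gen Φ) : stdAction hc τ (Cherednik.gen c a) = genOp c τ a := by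
  simp [stdAction, Cherednik.gen]

/-- The universal property of the standard module, which says that `ℂ[𝔥] ⊗ V(τ)` is
the `H_c(W, 𝔥)`-module induced from the module `V(τ)` of `W # ℂ[𝔥^*]` on which `𝔥` acts by zero. -/
theorem stdAction_universal {c : Φ.R → ℂ} (hc : Φ.IsParam c) (τ : Representation ℂ Φ.W V)
    {N : Type*} [AddCommGroup N] [Module ℂ N] (ρ : Cherednik c →ₐ[ℂ] Module.End ℂ N)
    (f : V →ₗ[ℂ] N) (hf : ∀ w v, f (τ w v) = ρ (Cherednik.gen c (.g w)) (f v))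
    (hf' : ∀ η v, ρ (Cherednik.gen c (.y η)) (f v) = 0) :
    ∃! F : MvPolynomial (Fin r) ℂ ⊗[ℂ] V →ₗ[ℂ] N,
      (∀ h m, F (stdAction hc τ h m) = ρ h (F m)) ∧
        ∀ v, F ((1 : MvPolynomial (Fin r) ℂ) ⊗ₜ v) = f v := by
  have rel : ∀ {a b}, CherednikRel c a b → RingQuot.mkAlgHom ℂ (CherednikRel c) a =
      RingQuot.mkAlgHom ℂ (CherednikRel c) b := fun h => RingQuot.mkAlgHom_rel ℂ h
  let X : (Fin r → ℂ) →ₗ[ℂ] Module.End ℂ N :=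
    { toFun ξ := ρ (Cherednik.gen c (.x ξ))
      map_add' ξ ξ' := by
        have := rel (.x_add ξ ξ')
        simp only [Cherednik.gen, this, map_add]
      map_smul' a ξ := by
        have := rel (.x_smul a ξ)
        simp only [Cherednik.gen, this, map_smul, RingHom.id_apply] }
  have hX : ∀ ξ ξ', X ξ * X ξ' = X ξ' * X ξ := by
    intro ξ ξ'
    have := rel (.x_x ξ ξ')
    rw [map_mul, map_mul] at this
    simp only [X, LinearMap.coe_mk, AddHom.coe_mk, Cherednik.gen, ← map_mul, this]
  obtain ⟨P, hP⟩ : ∃ P : MvPolynomial (Fin r) ℂ →ₐ[ℂ] Module.End ℂ N,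
      ∀ ξ, P (linForm ξ) = X ξ := by
    let B := Algebra.adjoin ℂ (Set.range X)
    let _ : CommRing B := Algebra.adjoinCommRingOfComm ℂ (by
      rintro _ ⟨ξ, rfl⟩ _ ⟨ξ', rfl⟩; exact hX ξ ξ')
    refine ⟨B.val.comp (MvPolynomial.aeval fun i =>
      (⟨X (Pi.single i 1), Algebra.subset_adjoin ⟨_, rfl⟩⟩ : B)), fun ξ => ?_⟩
    have hv : ξ = ∑ i, ξ i • (Pi.single i 1 : Fin r → ℂ) := by
      ext k; simp [Finset.sum_apply, Pi.single_apply]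
    conv_rhs => rw [hv]
    simp [linForm_apply]
  let F : MvPolynomial (Fin r) ℂ ⊗[ℂ] V →ₗ[ℂ] N :=
    TensorProduct.lift ((LinearMap.lcomp ℂ N f).comp P.toLinearMap)
  have hF : ∀ p v, F (p ⊗ₜ v) = P p (f v) := fun p v => by simp [F]
  have hF1 : ∀ v, F ((1 : MvPolynomial (Fin r) ℂ) ⊗ₜ v) = f v := fun v => by simp [hF]
  have hFx : ∀ ξ m, F (mulOp V ξ m) = X ξ (F m) := by
    intro ξ m
    have : F ∘ₗ mulOp V ξ = X ξ ∘ₗ F := by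
      apply TensorProduct.ext'
      intro p v
      simp [mulOp, hF, map_mul, hP, Module.End.mul_apply]
    exact LinearMap.congr_fun this m
  have hFg : ∀ w m, F (Φ.stdRep τ w m) = ρ (Cherednik.gen c (.g w)) (F m) := by
    intro w m
    have : F ∘ₗ Φ.stdRep τ w = ρ (Cherednik.gen c (.g w)) ∘ₗ F := by
      refine std_ext ?_ ?_
      · intro v
        have h1 : Φ.polyRep w 1 = 1 := map_one (Φ.polyAct w)
        simp [stdRep, h1, hF1, hf]
      · intro ξ m hm
        have e1 := LinearMap.congr_fun (stdRep_mul_mulOp τ w ξ) m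
        have e2 := congrArg ρ (rel (.g_x w ξ))
        rw [map_mul, map_mul, map_mul, map_mul] at e2
        have e2 := LinearMap.congr_fun e2 (F m)
        simp only [Module.End.mul_apply, LinearMap.comp_apply] at e1 e2 hm ⊢
        rw [e1, hFx, hFx, hm]
        exact e2.symm
    exact LinearMap.congr_fun this m
  have hFy : ∀ η m, F (Φ.dunkl c τ η m) = ρ (Cherednik.gen c (.y η)) (F m) := by
    intro η m
    have : F ∘ₗ Φ.dunkl c τ η = ρ (Cherednik.gen c (.y η)) ∘ₗ F := by
      refine std_ext ?_ ?_
      · intro v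
        simp [dunkl_one_tmul, hF1, hf']
      · intro ξ m hm
        have e1 := LinearMap.congr_fun (dunkl_mulOp c τ ξ η) m
        have e2 := congrArg ρ (rel (.y_x ξ η))
        simp only [map_mul, map_add, map_sub, map_sum, map_smul, map_one] at e2
        have e2 := LinearMap.congr_fun e2 (F m)
        simp only [Module.End.mul_apply, LinearMap.comp_apply, LinearMap.add_apply,
          LinearMap.sub_apply, LinearMap.smul_apply, Module.End.one_apply, LinearMap.sum_apply]
          at e1 e2 hm ⊢
        rw [e1, map_sub, map_add, map_sum, hFx, hFx, hm, map_smul]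
        simp only [map_smul, hFg]
        exact e2.symm
    exact LinearMap.congr_fun this m
  refine ⟨F, ⟨?_, hF1⟩, ?_⟩
  · intro h
    obtain ⟨a, rfl⟩ := RingQuot.mkAlgHom_surjective ℂ (CherednikRel c) h
    induction a using FreeAlgebra.induction with
    | grade0 z => intro m; simp [Algebra.algebraMap_eq_smul_one]
    | grade1 a =>
      intro m
      change F (stdAction hc τ (Cherednik.gen c a) m) = ρ (Cherednik.gen c a) (F m)
      rw [stdAction_gen]
      cases a with
      | x ξ => exact hFx ξ m
      | y η => exact hFy η m
      | g w => exact hFg w m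
    | mul a b ha hb =>
      intro m
      rw [map_mul, map_mul, map_mul, Module.End.mul_apply, ha, hb, Module.End.mul_apply]
    | add a b ha hb =>
      intro m
      rw [map_add, map_add, map_add, LinearMap.add_apply, map_add, ha, hb, LinearMap.add_apply]
  · rintro G ⟨hG, hG1⟩
    refine std_ext (fun v => by rw [hG1, hF1]) fun ξ m hm => ?_
    have := hG (Cherednik.gen c (.x ξ)) m
    rw [stdAction_gen] at this
    rw [hFx, ← hm]
    exact this

end Cherednik

section Scalar

variable {Φ} {V : Type*} [AddCommGroup V] [Module ℂ V]

/-- The scalar `N_c(τ)` by which `∑_{α > 0} c_α s_α` acts on an irreducible representation `τ`,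
computed as a normalised trace. -/
def Nc (c : Φ.R → ℂ) (τ : Representation ℂ Φ.W V) : ℂ :=
  (∑ α ∈ Φ.Pos, c α * LinearMap.trace ℂ V (τ (Φ.s α))) / Module.finrank ℂ V

theorem Nc_spec {c : Φ.R → ℂ} (hc : Φ.IsParam c) [FiniteDimensional ℂ V]
    (τ : Representation ℂ Φ.W V) [τ.IsIrreducible] (v : V) :
    ∑ α ∈ Φ.Pos, c α • τ (Φ.s α) v = Nc c τ • v := by
  have hcomm : ∀ w v, ∑ α ∈ Φ.Pos, c α • τ (Φ.s α) (τ w v) =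
      τ w (∑ α ∈ Φ.Pos, c α • τ (Φ.s α) v) := by
    intro w v
    rw [← sum_pos_act (fun α => c α • τ (Φ.s α) (τ w v)) (fun α β h => by
      simp only [s_neg h, hc.neg h]) w, map_sum]
    refine Finset.sum_congr rfl fun α _ => ?_
    rw [map_smul, hc.act, ← Module.End.mul_apply, ← Module.End.mul_apply, ← map_mul, ← map_mul,
      s_mul]
  let T : τ.IntertwiningMap τ :=
    { toLinearMap := ∑ α ∈ Φ.Pos, c α • τ (Φ.s α)
      isIntertwining' := by
        intro w
        refine LinearMap.ext fun v => ?_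
        simpa [LinearMap.sum_apply] using hcomm w v }
  obtain ⟨a, ha⟩ :=
    (Representation.IsIrreducible.algebraMap_intertwiningMap_bijective_of_isAlgClosed
      (ρ := τ)).2 T
  have hT : ∑ α ∈ Φ.Pos, c α • τ (Φ.s α) = a • (LinearMap.id : V →ₗ[ℂ] V) := by
    have : T.toLinearMap = (algebraMap ℂ (τ.IntertwiningMap τ) a).toLinearMap := by rw [ha]
    exact this
  have hne : (Module.finrank ℂ V : ℂ) ≠ 0 := by
    have : Nontrivial V := by
      by_contra h
      rw [not_nontrivial_iff_subsingleton] at h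
      apply (bot_ne_top : (⊥ : Subrepresentation τ) ≠ ⊤)
      apply SetLike.ext
      intro x
      rw [Subsingleton.elim x 0]
      exact ⟨fun _ => trivial, fun _ => Submodule.zero_mem _⟩
    exact_mod_cast (Module.finrank_pos (R := ℂ) (M := V)).ne'
  have htr : Nc c τ = a := by
    have := congrArg (LinearMap.trace ℂ V) hT
    rw [map_sum, map_smul, LinearMap.trace_id] at this
    simp only [map_smul, smul_eq_mul] at this
    rw [Nc, this, mul_div_cancel_right₀ _ hne]
  have := LinearMap.congr_fun hT v
  simpa [LinearMap.sum_apply, htr] using this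

end Scalar

end RootDatum

/-- The spinor module `𝕊 = ⋀ 𝔥^*`. -/
abbrev Spinor (r : ℕ) := ExteriorAlgebra ℂ (Fin r → ℂ)

/-- The Clifford action of `x ∈ 𝔥^*` on `𝕊`: left exterior multiplication. -/
def wedge (x : Fin r → ℂ) : Module.End ℂ (Spinor r) :=
  LinearMap.mulLeft ℂ (ExteriorAlgebra.ι ℂ x)

/-- The Clifford action of `y ∈ 𝔥` on `𝕊`: the contraction, that is, the odd derivation
that extends `x ↦ ⟨x, y⟩`. -/
def contr (y : Fin r → ℂ) : Module.End ℂ (Spinor r) :=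
  CliffordAlgebra.contractLeft ((dotProductBilin ℂ ℂ).flip y)

theorem contr_ι_mul (y x : Fin r → ℂ) (ω : Spinor r) :
    contr y (ExteriorAlgebra.ι ℂ x * ω) =
      (x ⬝ᵥ y) • ω - ExteriorAlgebra.ι ℂ x * contr y ω :=
  CliffordAlgebra.contractLeft_ι_mul _ _ _

/-- The standard orthonormal basis of `E ⊆ 𝔥`, which is also the dual basis of `𝔥^*`. -/
def basisVec (i : Fin r) : Fin r → ℂ := Pi.single i 1

namespace RootDatum

/-- The action of the group on `𝕊`. -/
def spinRep : Representation ℂ Φ.W (Spinor r) where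
  toFun w := (ExteriorAlgebra.map (Φ.hRep w)).toLinearMap
  map_one' := by
    rw [map_one]
    exact congrArg AlgHom.toLinearMap (ExteriorAlgebra.map_id (R := ℂ) (M := Fin r → ℂ))
  map_mul' w w' := by
    rw [map_mul]
    exact congrArg AlgHom.toLinearMap
      (ExteriorAlgebra.map_comp_map (Φ.hRep w') (Φ.hRep w)).symm

end RootDatum

/-- The standard module `M_c(τ) = ℂ[𝔥] ⊗ V(τ)` as a vector space (a type synonym). -/
def Std (r : ℕ) (V : Type*) [AddCommGroup V] [Module ℂ V] := MvPolynomial (Fin r) ℂ ⊗[ℂ] V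

instance (V : Type*) [AddCommGroup V] [Module ℂ V] : AddCommGroup (Std r V) :=
  inferInstanceAs (AddCommGroup (MvPolynomial (Fin r) ℂ ⊗[ℂ] V))

instance (V : Type*) [AddCommGroup V] [Module ℂ V] : Module ℂ (Std r V) :=
  inferInstanceAs (Module ℂ (MvPolynomial (Fin r) ℂ ⊗[ℂ] V))

/-- The subspace `ℂ[𝔥]_m ⊗ V(τ)` of `M_c(τ)`. -/
def stdDeg (V : Type*) [AddCommGroup V] [Module ℂ V] (m : ℕ) : Submodule ℂ (Std r V) :=
  LinearMap.range (TensorProduct.map (MvPolynomial.homogeneousSubmodule (Fin r) ℂ m).subtype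
      (LinearMap.id : V →ₗ[ℂ] V))

/-- Multiplication by `x ∈ 𝔥^*` on `M_c(τ)`. -/
def stdX (V : Type*) [AddCommGroup V] [Module ℂ V] (x : Fin r → ℂ) : Module.End ℂ (Std r V) :=
  RootDatum.mulOp V x

/-- The action of `y ∈ 𝔥` on `M_c(τ)`, by the Dunkl operator. -/
def RootDatum.stdY {V : Type*} [AddCommGroup V] [Module ℂ V] (c : Φ.R → ℂ)
    (τ : Representation ℂ Φ.W V) (y : Fin r → ℂ) : Module.End ℂ (Std r V) :=
  Φ.dunkl c τ y

/-- The action of the group on `M_c(τ)`. -/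
def RootDatum.stdW {V : Type*} [AddCommGroup V] [Module ℂ V]
    (τ : Representation ℂ Φ.W V) : Representation ℂ Φ.W (Std r V) :=
  Φ.stdRep τ

/-- The space `K_c(τ) = M_c(τ) ⊗ 𝕊`. -/
abbrev KMod (r : ℕ) (V : Type*) [AddCommGroup V] [Module ℂ V] := Std r V ⊗[ℂ] Spinor r

/-- The subspace `K_m^l = ℂ[𝔥]_m ⊗ V(τ) ⊗ ⋀^l 𝔥^*`. -/
def bideg (V : Type*) [AddCommGroup V] [Module ℂ V] (m l : ℕ) : Submodule ℂ (KMod r V) :=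
  LinearMap.range (TensorProduct.map (stdDeg V m).subtype (⋀[ℂ]^l (Fin r → ℂ)).subtype)

/-- The `σ`-isotypic component: the sum of the images of all the intertwining maps from `σ`. -/
def isotypic {G K S : Type*} [Monoid G] [AddCommGroup K] [Module ℂ K] [AddCommGroup S] [Module ℂ S]
    (κ : Representation ℂ G K) (σ : Representation ℂ G S) : Submodule ℂ K :=
  ⨆ f : σ.IntertwiningMap κ, LinearMap.range f.toLinearMap

namespace RootDatum

section Howe

variable {V : Type*} [AddCommGroup V] [Module ℂ V]

/-- The diagonal action of the group on `K_c(τ)`. -/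
def kRep (τ : Representation ℂ Φ.W V) : Representation ℂ Φ.W (KMod r V) :=
  (Φ.stdW τ).tprod Φ.spinRep

/-- `E_1^- = ∑_i y_i² / 2 ⊗ 1`. -/
def E1minus (c : Φ.R → ℂ) (τ : Representation ℂ Φ.W V) : Module.End ℂ (KMod r V) :=
  ∑ i, (1 / 2 : ℂ) •
    TensorProduct.map (Φ.stdY c τ (basisVec i) * Φ.stdY c τ (basisVec i)) LinearMap.id

/-- `E_2^+ = ∑_i y_i ⊗ x_i`. -/
def E2plus (c : Φ.R → ℂ) (τ : Representation ℂ Φ.W V) : Module.End ℂ (KMod r V) :=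
  ∑ i, TensorProduct.map (Φ.stdY c τ (basisVec i)) (wedge (basisVec i))

/-- `E_2^- = ∑_i x_i ⊗ y_i`. -/
def E2minus (r : ℕ) (V : Type*) [AddCommGroup V] [Module ℂ V] : Module.End ℂ (KMod r V) :=
  ∑ i, TensorProduct.map (stdX V (basisVec i)) (contr (basisVec i))

/-- `E_3^- = - ∑_i y_i ⊗ y_i`. -/
def E3minus (c : Φ.R → ℂ) (τ : Representation ℂ Φ.W V) : Module.End ℂ (KMod r V) :=
  -∑ i, TensorProduct.map (Φ.stdY c τ (basisVec i)) (contr (basisVec i))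

/-- The space `𝒜_c(τ)` of vectors killed by `𝔲^- = ℂ E_1^- ⊕ ℂ E_3^-`. -/
def AHarm (c : Φ.R → ℂ) (τ : Representation ℂ Φ.W V) : Submodule ℂ (KMod r V) :=
  LinearMap.ker (Φ.E1minus c τ) ⊓ LinearMap.ker (Φ.E3minus c τ)

/-- The space `ℳ_c(τ)` of vectors killed by `𝔫^- = 𝔲^- ⊕ ℂ E_2^-`. -/
def Monog (c : Φ.R → ℂ) (τ : Representation ℂ Φ.W V) : Submodule ℂ (KMod r V) :=
  Φ.AHarm c τ ⊓ LinearMap.ker (E2minus r V)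

variable {S : Type*} [AddCommGroup S] [Module ℂ S]

/-- The space `𝒜_c(τ)_m^l(σ)`. -/
def AHarmIso (c : Φ.R → ℂ) (τ : Representation ℂ Φ.W V) (σ : Representation ℂ Φ.W S)
    (m l : ℕ) : Submodule ℂ (KMod r V) :=
  Φ.AHarm c τ ⊓ (bideg V m l ⊓ isotypic (Φ.kRep τ) σ)

/-- The component of exterior degree `l` of `𝒜_c(τ, n, σ) = ⨁_{m + l = n} 𝒜_c(τ)_m^l(σ)`,
which is zero for `l > n`. -/
def ACplx (c : Φ.R → ℂ) (τ : Representation ℂ Φ.W V) (n : ℕ) (σ : Representation ℂ Φ.W S)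
    (l : ℕ) : Submodule ℂ (KMod r V) :=
  ⨆ (m : ℕ) (_ : m + l = n), Φ.AHarmIso c τ σ m l

end Howe

/-- The genericity of `c`: for every irreducible representation `σ` that is not isomorphic to `τ`,
the number `N_c(τ) - N_c(σ)` is not a non-negative integer. -/
def IsGeneric.{u} {V : Type u} [AddCommGroup V] [Module ℂ V] (c : Φ.R → ℂ)
    (τ : Representation ℂ Φ.W V) : Prop :=
  ∀ (S : Type u) [AddCommGroup S] [Module ℂ S] [FiniteDimensional ℂ S]
    (σ : Representation ℂ Φ.W S), σ.IsIrreducible → IsEmpty (τ.Equiv σ) →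
      ∀ k : ℕ, Nc c τ - Nc c σ ≠ k

end RootDatum

section Complexes

variable {G K : Type*} [Monoid G] [AddCommGroup K] [Module ℂ K]

/-- `d` makes the family of subspaces `C 0, C 1, …` of `K` a complex `C 0 → C 1 → ⋯`. -/
structure IsUpComplex (C : ℕ → Submodule ℂ K) (d : Module.End ℂ K) : Prop where
  map_mem : ∀ l, ∀ θ ∈ C l, d θ ∈ C (l + 1)
  sq_zero : ∀ l, ∀ θ ∈ C l, d (d θ) = 0

/-- `d` makes the family of subspaces `C 0, C 1, …` of `K` a complex `⋯ → C 1 → C 0 → 0`. -/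
structure IsDownComplex (C : ℕ → Submodule ℂ K) (d : Module.End ℂ K) : Prop where
  map_mem : ∀ l, ∀ θ ∈ C (l + 1), d θ ∈ C l
  map_zero : ∀ θ ∈ C 0, d θ = 0
  sq_zero : ∀ l, ∀ θ ∈ C l, d (d θ) = 0

/-- A linear isomorphism between invariant subspaces that commutes with the group action. -/
def IsEquivariant (κ : Representation ℂ G K) {A B : Submodule ℂ K} (φ : A ≃ₗ[ℂ] B) : Prop :=
  ∀ (w : G) (θ : A), ∃ θ' : A, (θ' : K) = κ w θ ∧ (φ θ' : K) = κ w (φ θ)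

/-- The complexes `(C, d)` and `(C', d')` with rising differentials are isomorphic,
equivariantly for the group. -/
def UpIso (κ : Representation ℂ G K) (C C' : ℕ → Submodule ℂ K) (d d' : Module.End ℂ K) : Prop :=
  ∃ φ : ∀ l, C l ≃ₗ[ℂ] C' l, (∀ l, IsEquivariant κ (φ l)) ∧
    ∀ (l : ℕ) (θ : C l) (θ' : C (l + 1)), (θ' : K) = d θ → (φ (l + 1) θ' : K) = d' (φ l θ)

/-- The complexes `(C, d)` and `(C', d')` with lowering differentials are isomorphic,
equivariantly for the group. -/
def DownIso (κ : Representation ℂ G K) (C C' : ℕ → Submodule ℂ K) (d d' : Module.End ℂ K) :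
    Prop :=
  ∃ φ : ∀ l, C l ≃ₗ[ℂ] C' l, (∀ l, IsEquivariant κ (φ l)) ∧
    ∀ (l : ℕ) (θ : C (l + 1)) (θ' : C l), (θ' : K) = d θ → (φ l θ' : K) = d' (φ (l + 1) θ)

end Complexes

end DunklHowe

end

universe u

open DunklHowe

/-! The proof rests on the anticommutator H_c of E_2^+ and E_2^- (`Hop`). At c = 0 these operators
are the de Rham and Koszul differentials with values in V(τ), and H_0 is multiplication by m + l on
K_m^l. For general c, `Hop_eq` gives H_c = H_0 - N_c(τ) + ∑ c_α s_α with s_α acting diagonally on K.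
So H_c acts on a copy of σ inside K_m^l by m + l - N_c(τ) + N_c(σ), and genericity makes this number
nonzero unless m + l = 0. The form used later is `eq_zero_of_Hop_add`: for every natural number k, a
vector killed by H_c + k is zero once its K_0^0-component is.

For E_2^+: if q in M_c(τ) is killed by all y, then H_c(q ⊗ 1) = 0, so M_c(τ) has no singular vectors
without constant term. A graded equivariant map from M_c(τ) to M_0(τ), the Taylor expansion with
Dunkl operators in place of partial derivatives, intertwines the two actions of 𝔥. The absence of
singular vectors makes it injective, hence bijective degree by degree. Since E_1^-, E_3^- and E_2^+
involve only the y_i on the polynomial side, tensoring with 𝕊 identifies the spaces 𝒜 together with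
E_2^+ (`taylorEquiv`).

For E_2^-: this operator contains multiplications by x_i, which the Taylor map has no reason to
respect. An isomorphism e for E_2^+ is therefore replaced by E_2^- e E_2^+ + e E_2^+ E_2^- + e P_0,
with P_0 the projection to K_0^0. It commutes with E_2^-, and composing it with the analogous map
built from the inverse of e gives H_{c'} H_c + P_0 (`transfer_transfer`), which is invertible by the
injectivity above. It also respects 𝒜 in both directions, because E_1^- and E_3^- lower total degree
by two (`exists_lowering_equiv`). Restriction to ker E_2^- yields the statement on lowest weight
vectors. -/

noncomputable section

/-! ### Clifford calculus on spinors and its equivariance. -/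

namespace DunklHowe

variable {r : ℕ} {Φ : RootDatum r}

/-- The exterior multiplication as a linear function of the covector. -/
def wedgeL (r : ℕ) : (Fin r → ℂ) →ₗ[ℂ] Module.End ℂ (Spinor r) :=
  LinearMap.mul ℂ (Spinor r) ∘ₗ ExteriorAlgebra.ι ℂ

theorem wedgeL_apply (x : Fin r → ℂ) : wedgeL r x = wedge x := rfl

/-- The contraction as a linear function of the vector. -/
def contrL (r : ℕ) : (Fin r → ℂ) →ₗ[ℂ] Module.End ℂ (Spinor r) :=
  CliffordAlgebra.contractLeft ∘ₗ (dotProductBilin ℂ ℂ).flip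

theorem contrL_apply (y : Fin r → ℂ) : contrL r y = contr y := rfl

theorem wedge_mul_wedge (x x' : Fin r → ℂ) : wedge x * wedge x' = -(wedge x' * wedge x) := by
  refine LinearMap.ext fun ω => ?_
  have h := ExteriorAlgebra.ι_add_mul_swap (R := ℂ) x x'
  have h' := congrArg (· * ω) h
  simp only [add_mul, zero_mul, mul_assoc] at h'
  exact eq_neg_of_add_eq_zero_left h'

theorem contr_mul_contr (y y' : Fin r → ℂ) : contr y * contr y' = -(contr y' * contr y) := by
  refine LinearMap.ext fun ω => ?_
  exact CliffordAlgebra.contractLeft_comm (Q := (0 : QuadraticForm ℂ (Fin r → ℂ))) _ _ ω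

theorem contr_mul_wedge (y x : Fin r → ℂ) :
    contr y * wedge x = (x ⬝ᵥ y) • 1 - wedge x * contr y :=
  LinearMap.ext fun ω => contr_ι_mul y x ω

theorem contr_one (y : Fin r → ℂ) : contr y (1 : Spinor r) = 0 :=
  CliffordAlgebra.contractLeft_one (Q := (0 : QuadraticForm ℂ (Fin r → ℂ))) _

/-- Induction for the exterior algebra, by left multiplication with vectors. -/
theorem spinor_ext {N : Type*} [AddCommGroup N] [Module ℂ N] {f g : Spinor r →ₗ[ℂ] N}
    (h1 : f 1 = g 1) (h2 : ∀ x ω, f ω = g ω → f (wedge x ω) = g (wedge x ω)) : f = g := by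
  refine LinearMap.ext fun ω => ?_
  induction ω using CliffordAlgebra.left_induction with
  | algebraMap a => rw [Algebra.algebraMap_eq_smul_one, map_smul, map_smul, h1]
  | add a b ha hb => rw [map_add, map_add, ha, hb]
  | ι_mul ω x h => exact h2 x ω h

namespace RootDatum

theorem spinRep_one (w : Φ.W) : Φ.spinRep w (1 : Spinor r) = 1 := map_one (ExteriorAlgebra.map _)

theorem spinRep_mul_wedge (w : Φ.W) (x : Fin r → ℂ) :
    Φ.spinRep w * wedge x = wedge (Φ.hRep w x) * Φ.spinRep w := by
  refine LinearMap.ext fun ω => ?_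
  change ExteriorAlgebra.map (Φ.hRep w) (ExteriorAlgebra.ι ℂ x * ω) = _
  rw [map_mul, ExteriorAlgebra.map_apply_ι]
  rfl

/-- Moving both sides past an exterior multiplication leaves only the pairing of x with y, and that
pairing is invariant because W acts by orthogonal matrices. -/
theorem spinRep_mul_contr (w : Φ.W) (y : Fin r → ℂ) :
    Φ.spinRep w * contr y = contr (Φ.hRep w y) * Φ.spinRep w := by
  refine spinor_ext ?_ fun x ω h => ?_
  · simp only [Module.End.mul_apply, spinRep_one, contr_one, map_zero]
  · have e1 : ∀ ω, Φ.spinRep w (wedge x ω) = wedge (Φ.hRep w x) (Φ.spinRep w ω) := fun ω =>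
      LinearMap.congr_fun (spinRep_mul_wedge w x) ω
    have e2 : ∀ (x y : Fin r → ℂ) (ω), contr y (wedge x ω) = (x ⬝ᵥ y) • ω - wedge x (contr y ω) :=
      fun x y ω => LinearMap.congr_fun (contr_mul_wedge y x) ω
    simp only [Module.End.mul_apply] at h ⊢
    rw [e1, e2, e2, map_sub, map_smul, e1, h, hRep_dotProduct]

/-- The reflection `s_α` acts on the spinors by `1 - α ∧ ∂_{α^∨}`. -/
theorem spinRep_s (α : Φ.R) :
    Φ.spinRep (Φ.s α) = 1 - wedge (cplx (α : Euc r)) * contr (coroot (α : Euc r)) := by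
  refine spinor_ext ?_ fun x ω h => ?_
  · simp [spinRep_one, contr_one, Module.End.mul_apply]
  · have e1 := LinearMap.congr_fun (spinRep_mul_wedge (Φ.s α) x) ω
    have e2 := LinearMap.congr_fun (contr_mul_wedge (coroot (α : Euc r)) x) ω
    have e3 := fun x x' ω => LinearMap.congr_fun (wedge_mul_wedge (r := r) x x') ω
    have e5 : ∀ ω, wedge (cplx (α : Euc r)) (wedge (cplx (α : Euc r)) ω) = 0 := fun ω => by
      change ExteriorAlgebra.ι ℂ _ * (ExteriorAlgebra.ι ℂ _ * ω) = 0
      rw [← mul_assoc, ExteriorAlgebra.ι_sq_zero, zero_mul]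
    simp only [Module.End.mul_apply, LinearMap.sub_apply, LinearMap.neg_apply, LinearMap.smul_apply,
      Module.End.one_apply] at e1 e2 e3 h ⊢
    -- Expanding s_α x ∧ (ω - α ∧ ∂ω) produces one term quadratic in α, which vanishes because α ∧ α
    -- = 0; the other terms match after α and x are interchanged.
    rw [e1, e2, h, hRep_s, ← wedgeL_apply (x - _), (wedgeL r).map_sub, (wedgeL r).map_smul, wedgeL_apply, wedgeL_apply]
    simp only [LinearMap.sub_apply, LinearMap.smul_apply, map_sub, map_smul, e5,
      e3 (cplx (α : Euc r)) x]
    abel_nf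
    simp

/-- An invariant bilinear expression in an orthonormal basis and its image under the group. -/
theorem sum_hRep_basisVec {N : Type*} [AddCommGroup N] [Module ℂ N]
    (B : (Fin r → ℂ) →ₗ[ℂ] (Fin r → ℂ) →ₗ[ℂ] N) (w : Φ.W) :
    ∑ i, B (Φ.hRep w (basisVec i)) (Φ.hRep w (basisVec i)) =
      ∑ i, B (basisVec i) (basisVec i) := by
  have hv : ∀ v : Fin r → ℂ, v = ∑ i, (v ⬝ᵥ basisVec i) • basisVec i := by
    intro v; ext k; simp [basisVec, Finset.sum_apply, Pi.single_apply]
  have hw : ∀ u v : Fin r → ℂ, Φ.hRep w u ⬝ᵥ v = u ⬝ᵥ Φ.hRep w⁻¹ v := by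
    intro u v
    rw [← hRep_dotProduct Φ w u, ← Module.End.mul_apply, ← map_mul, mul_inv_cancel, map_one]
    rfl
  -- The j-th coordinate of w e_i is the i-th coordinate of w⁻¹ e_j. Summing over i therefore turns
  -- the coefficient of B(e_j, e_k) into the pairing of w⁻¹ e_j with w⁻¹ e_k, which is δ_jk.
  have h1 : ∀ i, B (Φ.hRep w (basisVec i)) (Φ.hRep w (basisVec i)) =
      ∑ j, ∑ k, ((Φ.hRep w⁻¹ (basisVec j)) i * (Φ.hRep w⁻¹ (basisVec k)) i) •
        B (basisVec j) (basisVec k) := by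
    intro i
    conv_lhs => rw [hv (Φ.hRep w (basisVec i))]
    simp only [hw, map_sum, map_smul, LinearMap.sum_apply, LinearMap.smul_apply, Finset.smul_sum,
      smul_smul]
    rw [Finset.sum_comm]
    simp [basisVec, mul_comm]
  simp only [h1]
  rw [Finset.sum_comm]
  refine Finset.sum_congr rfl fun j _ => ?_
  rw [Finset.sum_comm]
  have h2 : ∀ k, ∑ i, ((Φ.hRep w⁻¹ (basisVec j)) i * (Φ.hRep w⁻¹ (basisVec k)) i) •
      B (basisVec j) (basisVec k) = (basisVec j ⬝ᵥ basisVec k : ℂ) •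
        B (basisVec j) (basisVec k) := by
    intro k
    rw [← Finset.sum_smul, ← hRep_dotProduct Φ w⁻¹]
    rfl
  simp only [h2]
  simp [basisVec, Pi.single_apply]

/-! ### Commutators of Dunkl operators and the Dunkl Laplacian with coordinates. -/

section Std

variable {V : Type*} [AddCommGroup V] [Module ℂ V] (c : Φ.R → ℂ) (τ : Representation ℂ Φ.W V)

theorem mulOp_add (x x' : Fin r → ℂ) : mulOp V (x + x') = mulOp V x + mulOp V x' := by
  refine TensorProduct.ext' fun p v => ?_
  simp [mulOp, TensorProduct.add_tmul, add_mul]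

theorem mulOp_smul (a : ℂ) (x : Fin r → ℂ) : mulOp V (a • x) = a • mulOp V x := by
  refine TensorProduct.ext' fun p v => ?_
  simp [mulOp, TensorProduct.smul_tmul']

theorem mulOp_comm (x x' : Fin r → ℂ) : mulOp V x * mulOp V x' = mulOp V x' * mulOp V x := by
  refine TensorProduct.ext' fun p v => ?_
  simp [mulOp, Module.End.mul_apply, mul_left_comm]

/-- Multiplication by `x` on the standard module, as a linear function of `x`. -/
def stdXL (r : ℕ) (V : Type*) [AddCommGroup V] [Module ℂ V] :
    (Fin r → ℂ) →ₗ[ℂ] Module.End ℂ (Std r V) where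
  toFun := stdX V
  map_add' := mulOp_add
  map_smul' := mulOp_smul

theorem stdXL_apply (x : Fin r → ℂ) : stdXL r V x = stdX V x := rfl

/-- The Dunkl operator on the standard module, as a linear function of the vector. -/
def stdYL : (Fin r → ℂ) →ₗ[ℂ] Module.End ℂ (Std r V) where
  toFun := Φ.stdY c τ
  map_add' := dunkl_add c τ
  map_smul' := dunkl_smul c τ

theorem stdYL_apply (y : Fin r → ℂ) : stdYL c τ y = Φ.stdY c τ y := rfl

variable {c}

theorem stdY_comm (hc : Φ.IsParam c) (y y' : Fin r → ℂ) :
    Φ.stdY c τ y * Φ.stdY c τ y' = Φ.stdY c τ y' * Φ.stdY c τ y := dunkl_comm τ hc y y'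

theorem stdX_comm (x x' : Fin r → ℂ) : stdX V x * stdX V x' = stdX V x' * stdX V x :=
  mulOp_comm x x'

theorem stdW_mul_stdX (w : Φ.W) (x : Fin r → ℂ) :
    Φ.stdW τ w * stdX V x = stdX V (Φ.hRep w x) * Φ.stdW τ w := stdRep_mul_mulOp τ w x

theorem stdW_mul_stdY (hc : Φ.IsParam c) (w : Φ.W) (y : Fin r → ℂ) :
    Φ.stdW τ w * Φ.stdY c τ y = Φ.stdY c τ (Φ.hRep w y) * Φ.stdW τ w :=
  stdRep_mul_dunkl τ hc w y

variable (c) in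
theorem stdY_mul_stdX (y x : Fin r → ℂ) :
    Φ.stdY c τ y * stdX V x = stdX V x * Φ.stdY c τ y + ((x ⬝ᵥ y) • 1 -
      ∑ α ∈ Φ.Pos, (c α * (cplx (α : Euc r) ⬝ᵥ y) * (x ⬝ᵥ coroot (α : Euc r))) •
        Φ.stdW τ (Φ.s α)) := by
  rw [← add_sub_assoc]
  exact dunkl_mulOp c τ x y

/-- The commutator `[y, x]` is symmetric for the identification of `𝔥` with `𝔥^*`. -/
theorem stdY_stdX_symm (y x : Fin r → ℂ) :
    Φ.stdY c τ y * stdX V x - stdX V x * Φ.stdY c τ y =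
      Φ.stdY c τ x * stdX V y - stdX V y * Φ.stdY c τ x := by
  rw [stdY_mul_stdX, stdY_mul_stdX, add_sub_cancel_left, add_sub_cancel_left, dotProduct_comm]
  congr 1
  refine Finset.sum_congr rfl fun α _ => ?_
  congr 1
  simp only [coroot, dotProduct_comm x, dotProduct_comm y, smul_dotProduct, smul_eq_mul]
  ring

variable (c) in
/-- The Dunkl Laplacian `∑ y_i²`. -/
def lapl : Module.End ℂ (Std r V) :=
  ∑ i, Φ.stdY c τ (basisVec i) * Φ.stdY c τ (basisVec i)

theorem stdW_mul_lapl (hc : Φ.IsParam c) (w : Φ.W) :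
    Φ.stdW τ w * lapl c τ = lapl c τ * Φ.stdW τ w := by
  have := sum_hRep_basisVec ((LinearMap.mul ℂ _).compl₁₂ (stdYL c τ) (stdYL c τ)) w
  simp only [LinearMap.compl₁₂_apply, LinearMap.mul_apply', stdYL_apply] at this
  rw [lapl, Finset.mul_sum]
  conv_rhs => rw [← this, Finset.sum_mul]
  refine Finset.sum_congr rfl fun i _ => ?_
  rw [← mul_assoc, stdW_mul_stdY τ hc, mul_assoc, stdW_mul_stdY τ hc, mul_assoc]

theorem lapl_mul_stdY (hc : Φ.IsParam c) (y : Fin r → ℂ) :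
    lapl c τ * Φ.stdY c τ y = Φ.stdY c τ y * lapl c τ := by
  rw [lapl, Finset.mul_sum, Finset.sum_mul]
  refine Finset.sum_congr rfl fun i _ => ?_
  rw [mul_assoc, stdY_comm τ hc _ y, ← mul_assoc, stdY_comm τ hc _ y, mul_assoc]

theorem sum_dotProduct_basisVec_smul {N : Type*} [AddCommGroup N] [Module ℂ N]
    (L : (Fin r → ℂ) →ₗ[ℂ] N) (v : Fin r → ℂ) :
    ∑ i, (v ⬝ᵥ basisVec i) • L (basisVec i) = L v := by
  have hv : v = ∑ i, (v ⬝ᵥ basisVec i) • basisVec i := by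
    ext k; simp [basisVec, Finset.sum_apply, Pi.single_apply]
  conv_rhs => rw [hv, map_sum]
  simp only [map_smul]

/-- Commuting x past y_i y_i leaves reflection terms on both sides of y_i. Summed over i they
assemble to s_α y_α + y_α s_α, where y_α is the Dunkl operator along α; this vanishes because s_α α
= -α. Only the classical term survives. -/
theorem lapl_mul_stdX (hc : Φ.IsParam c) (x : Fin r → ℂ) :
    lapl c τ * stdX V x = stdX V x * lapl c τ + (2 : ℂ) • Φ.stdY c τ x := by
  have hs : ∀ α : Φ.R, Φ.stdW τ (Φ.s α) * Φ.stdY c τ (cplx (α : Euc r)) +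
      Φ.stdY c τ (cplx (α : Euc r)) * Φ.stdW τ (Φ.s α) = 0 := by
    intro α
    rw [stdW_mul_stdY τ hc, hRep_cplx, s_self, cplx_neg, ← stdYL_apply, map_neg, stdYL_apply,
      neg_mul, neg_add_cancel]
  have h1 : ∀ i, Φ.stdY c τ (basisVec i) * Φ.stdY c τ (basisVec i) * stdX V x =
      stdX V x * (Φ.stdY c τ (basisVec i) * Φ.stdY c τ (basisVec i)) +
      (2 : ℂ) • (x ⬝ᵥ basisVec i) • Φ.stdY c τ (basisVec i) -
      ∑ α ∈ Φ.Pos, (c α * (x ⬝ᵥ coroot (α : Euc r))) •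
        (Φ.stdW τ (Φ.s α) * ((cplx (α : Euc r) ⬝ᵥ basisVec i) • Φ.stdY c τ (basisVec i)) +
         ((cplx (α : Euc r) ⬝ᵥ basisVec i) • Φ.stdY c τ (basisVec i)) * Φ.stdW τ (Φ.s α)) := by
    intro i
    rw [mul_assoc, stdY_mul_stdX, mul_add, ← mul_assoc, stdY_mul_stdX]
    simp only [mul_sub, add_mul, sub_mul, Finset.mul_sum, Finset.sum_mul, smul_add,
      Finset.sum_add_distrib, mul_smul_comm, smul_mul_assoc, smul_smul, mul_one, one_mul, mul_assoc,
      two_mul, add_smul]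
    have : ∀ a b d : ℂ, a * (b * d) = a * (d * b) := fun a b d => by ring
    simp only [this _ (_ ⬝ᵥ basisVec i) (x ⬝ᵥ _)]
    abel
  rw [lapl, Finset.sum_mul]
  simp only [h1]
  rw [Finset.sum_sub_distrib, Finset.sum_add_distrib, ← Finset.mul_sum, ← Finset.smul_sum,
    Finset.sum_comm]
  have h2 := sum_dotProduct_basisVec_smul (stdYL c τ)
  simp only [stdYL_apply] at h2
  simp only [← Finset.smul_sum, Finset.sum_add_distrib, ← Finset.mul_sum, ← Finset.sum_mul, h2, hs,
    smul_zero, Finset.sum_const_zero, sub_zero]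

end Std

end RootDatum

end DunklHowe
end

/-! ### Relations among E_1^-, E_3^-, E_2^+ and E_2^- on K. -/

noncomputable section

namespace DunklHowe

variable {r : ℕ} {Φ : RootDatum r}

theorem sum_sum_eq_zero_of_antisymm {N : Type*} [AddCommGroup N] [Module ℂ N]
    (F : Fin r → Fin r → N) (h : ∀ i j, F i j + F j i = 0) : ∑ i, ∑ j, F i j = 0 := by
  have h1 : ∑ i, ∑ j, F i j + ∑ i, ∑ j, F i j = 0 := by
    conv_lhs => right; rw [Finset.sum_comm]
    simp only [← Finset.sum_add_distrib, h, Finset.sum_const_zero]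
  rw [← two_smul ℂ] at h1
  exact (smul_eq_zero.1 h1).resolve_left two_ne_zero

theorem sum_sum_smul_comm {ι κ N : Type*} [AddCommMonoid N] [Module ℂ N] (s : Finset ι)
    (t : Finset κ) (a : κ → ℂ) (F : ι → κ → N) :
    ∑ i ∈ s, ∑ k ∈ t, a k • F i k = ∑ k ∈ t, a k • ∑ i ∈ s, F i k := by
  rw [Finset.sum_comm]
  simp only [Finset.smul_sum]

theorem basisVec_dotProduct (i j : Fin r) :
    (basisVec i ⬝ᵥ basisVec j : ℂ) = if i = j then 1 else 0 := by
  simp [basisVec, Pi.single_apply, eq_comm]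

namespace RootDatum

variable {V : Type*} [AddCommGroup V] [Module ℂ V] {c : Φ.R → ℂ} (τ : Representation ℂ Φ.W V)

theorem kRep_tmul (w : Φ.W) (p : Std r V) (ω : Spinor r) :
    Φ.kRep τ w (p ⊗ₜ ω) = Φ.stdW τ w p ⊗ₜ Φ.spinRep w ω := rfl

variable (c) in
theorem E1minus_tmul (p : Std r V) (ω : Spinor r) :
    Φ.E1minus c τ (p ⊗ₜ ω) = (1 / 2 : ℂ) • lapl c τ p ⊗ₜ[ℂ] ω := by
  simp [E1minus, lapl, LinearMap.sum_apply, TensorProduct.sum_tmul, Finset.smul_sum]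

variable (c) in
theorem E2plus_tmul (p : Std r V) (ω : Spinor r) :
    Φ.E2plus c τ (p ⊗ₜ ω) =
      ∑ i, Φ.stdY c τ (basisVec i) p ⊗ₜ[ℂ] wedge (basisVec i) ω := by
  simp [E2plus, LinearMap.sum_apply]

theorem E2minus_tmul (p : Std r V) (ω : Spinor r) :
    E2minus r V (p ⊗ₜ ω) = ∑ i, stdX V (basisVec i) p ⊗ₜ[ℂ] contr (basisVec i) ω := by
  simp [E2minus, LinearMap.sum_apply]

variable (c) in
/-- The operator `∑ y_i ⊗ y_i`, that is, `-E_3^-`. -/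
def negE3 : Module.End ℂ (KMod r V) :=
  ∑ i, TensorProduct.map (Φ.stdY c τ (basisVec i)) (contr (basisVec i))

variable (c) in
theorem negE3_tmul (p : Std r V) (ω : Spinor r) :
    negE3 c τ (p ⊗ₜ ω) = ∑ i, Φ.stdY c τ (basisVec i) p ⊗ₜ[ℂ] contr (basisVec i) ω := by
  simp [negE3, LinearMap.sum_apply]

variable (c) in
theorem mem_AHarm (θ : KMod r V) :
    θ ∈ Φ.AHarm c τ ↔ Φ.E1minus c τ θ = 0 ∧ negE3 c τ θ = 0 := by
  have h : Φ.E3minus c τ θ = -negE3 c τ θ := rfl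
  rw [AHarm, Submodule.mem_inf, LinearMap.mem_ker, LinearMap.mem_ker, h, neg_eq_zero]

variable {τ} in
theorem stdY_stdY (hc : Φ.IsParam c) (y y' : Fin r → ℂ) (p : Std r V) :
    Φ.stdY c τ y (Φ.stdY c τ y' p) = Φ.stdY c τ y' (Φ.stdY c τ y p) :=
  LinearMap.congr_fun (stdY_comm τ hc y y') p

theorem stdX_stdX (y y' : Fin r → ℂ) (p : Std r V) :
    stdX V y (stdX V y' p) = stdX V y' (stdX V y p) :=
  LinearMap.congr_fun (stdX_comm y y') p

theorem wedge_wedge (x x' : Fin r → ℂ) (ω : Spinor r) :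
    wedge x (wedge x' ω) = -wedge x' (wedge x ω) :=
  LinearMap.congr_fun (wedge_mul_wedge x x') ω

theorem contr_contr (x x' : Fin r → ℂ) (ω : Spinor r) :
    contr x (contr x' ω) = -contr x' (contr x ω) :=
  LinearMap.congr_fun (contr_mul_contr x x') ω

theorem contr_wedge (y x : Fin r → ℂ) (ω : Spinor r) :
    contr y (wedge x ω) = (x ⬝ᵥ y) • ω - wedge x (contr y ω) :=
  LinearMap.congr_fun (contr_mul_wedge y x) ω

/-- Dunkl operators commute while exterior multiplications anticommute, so the double sum is
antisymmetric in its two indices. -/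
theorem E2plus_E2plus (hc : Φ.IsParam c) (θ : KMod r V) :
    Φ.E2plus c τ (Φ.E2plus c τ θ) = 0 := by
  have : Φ.E2plus c τ * Φ.E2plus c τ = 0 := by
    refine TensorProduct.ext' fun p ω => ?_
    rw [Module.End.mul_apply, E2plus_tmul, map_sum]
    simp only [E2plus_tmul]
    refine sum_sum_eq_zero_of_antisymm _ fun i j => ?_
    rw [stdY_stdY hc, wedge_wedge, TensorProduct.tmul_neg, neg_add_cancel]
  exact LinearMap.congr_fun this θ

theorem E2minus_E2minus (θ : KMod r V) : E2minus r V (E2minus r V θ) = 0 := by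
  have : E2minus r V * E2minus r V = 0 := by
    refine TensorProduct.ext' fun p ω => ?_
    rw [Module.End.mul_apply, E2minus_tmul, map_sum]
    simp only [E2minus_tmul]
    refine sum_sum_eq_zero_of_antisymm _ fun i j => ?_
    rw [stdX_stdX, contr_contr, TensorProduct.tmul_neg, neg_add_cancel]
  exact LinearMap.congr_fun this θ

theorem E1minus_E2plus (hc : Φ.IsParam c) (θ : KMod r V) :
    Φ.E1minus c τ (Φ.E2plus c τ θ) = Φ.E2plus c τ (Φ.E1minus c τ θ) := by
  have : Φ.E1minus c τ * Φ.E2plus c τ = Φ.E2plus c τ * Φ.E1minus c τ := by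
    refine TensorProduct.ext' fun p ω => ?_
    simp only [Module.End.mul_apply, E2plus_tmul, E1minus_tmul, map_sum, map_smul, Finset.smul_sum]
    refine Finset.sum_congr rfl fun i _ => ?_
    have := LinearMap.congr_fun (lapl_mul_stdY τ hc (basisVec i)) p
    rw [Module.End.mul_apply, Module.End.mul_apply] at this
    rw [this]
  exact LinearMap.congr_fun this θ

/-- The factor 1/2 in E_1^- cancels the 2 in [∑ y_i², x] = 2y. Together with `negE3_E2minus` this
shows that E_2^- preserves 𝒜. -/
theorem E1minus_E2minus (hc : Φ.IsParam c) (θ : KMod r V) :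
    Φ.E1minus c τ (E2minus r V θ) = E2minus r V (Φ.E1minus c τ θ) + negE3 c τ θ := by
  have : Φ.E1minus c τ * E2minus r V = E2minus r V * Φ.E1minus c τ + negE3 c τ := by
    refine TensorProduct.ext' fun p ω => ?_
    simp only [Module.End.mul_apply, LinearMap.add_apply, E2minus_tmul, E1minus_tmul, negE3_tmul,
      map_sum, map_smul, Finset.smul_sum]
    rw [← Finset.sum_add_distrib]
    refine Finset.sum_congr rfl fun i _ => ?_
    have := LinearMap.congr_fun (lapl_mul_stdX τ hc (basisVec i)) p
    rw [Module.End.mul_apply, LinearMap.add_apply, Module.End.mul_apply, LinearMap.smul_apply] at this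
    rw [this, TensorProduct.add_tmul, smul_add, ← TensorProduct.smul_tmul', smul_smul]
    norm_num
  exact LinearMap.congr_fun this θ

/-- Since the y_i commute, only the Clifford anticommutator of wedge and contraction remains, and it
is δ_ij: what is left is ∑ y_i². -/
theorem E2plus_negE3 (hc : Φ.IsParam c) (θ : KMod r V) :
    Φ.E2plus c τ (negE3 c τ θ) + negE3 c τ (Φ.E2plus c τ θ) = (2 : ℂ) • Φ.E1minus c τ θ := by
  have : Φ.E2plus c τ * negE3 c τ + negE3 c τ * Φ.E2plus c τ = (2 : ℂ) • Φ.E1minus c τ := by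
    refine TensorProduct.ext' fun p ω => ?_
    simp only [Module.End.mul_apply, LinearMap.add_apply, LinearMap.smul_apply, E2plus_tmul,
      E1minus_tmul, negE3_tmul, map_sum]
    conv_lhs => left; rw [Finset.sum_comm]
    simp only [← Finset.sum_add_distrib, contr_wedge,
      TensorProduct.tmul_sub, basisVec_dotProduct]
    rw [smul_smul, show (2 * (1 / 2) : ℂ) = 1 by norm_num, one_smul, lapl, LinearMap.sum_apply,
      TensorProduct.sum_tmul]
    refine Finset.sum_congr rfl fun i _ => ?_
    have h : ∀ j, Φ.stdY c τ (basisVec i) (Φ.stdY c τ (basisVec j) p) ⊗ₜ[ℂ]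
          wedge (basisVec i) (contr (basisVec j) ω) +
        (Φ.stdY c τ (basisVec j) (Φ.stdY c τ (basisVec i) p) ⊗ₜ[ℂ]
          ((if i = j then (1 : ℂ) else 0) • ω) -
        Φ.stdY c τ (basisVec j) (Φ.stdY c τ (basisVec i) p) ⊗ₜ[ℂ]
          wedge (basisVec i) (contr (basisVec j) ω)) =
        if i = j then (Φ.stdY c τ (basisVec i) * Φ.stdY c τ (basisVec i)) p ⊗ₜ ω else 0 := by
      intro j
      rw [stdY_stdY hc, add_sub_cancel]
      split_ifs with hij
      · subst hij; rw [one_smul]; rfl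
      · rw [zero_smul, TensorProduct.tmul_zero]
    simp only [h, Finset.sum_ite_eq, Finset.mem_univ, if_true]
  exact LinearMap.congr_fun this θ

/-- Contractions anticommute, so only the part of [y_i, x_j] antisymmetric in i and j can
contribute, and `stdY_stdX_symm` says that there is none. -/
theorem negE3_E2minus (θ : KMod r V) :
    negE3 c τ (E2minus r V θ) + E2minus r V (negE3 c τ θ) = 0 := by
  have : negE3 c τ * E2minus r V + E2minus r V * negE3 c τ = 0 := by
    refine TensorProduct.ext' fun p ω => ?_
    simp only [Module.End.mul_apply, LinearMap.add_apply, E2minus_tmul, negE3_tmul, map_sum]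
    conv_lhs => right; rw [Finset.sum_comm]
    simp only [← Finset.sum_add_distrib]
    refine sum_sum_eq_zero_of_antisymm _ fun i j => ?_
    have h := LinearMap.congr_fun (stdY_stdX_symm (c := c) τ (basisVec i) (basisVec j)) p
    simp only [LinearMap.sub_apply, Module.End.mul_apply] at h
    rw [contr_contr (basisVec i) (basisVec j)]
    simp only [TensorProduct.tmul_neg]
    have h' := congrArg (· ⊗ₜ[ℂ] contr (basisVec j) (contr (basisVec i) ω)) h
    simp only [TensorProduct.sub_tmul] at h'
    linear_combination (norm := module) -h'
  exact LinearMap.congr_fun this θ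

/-! ### Equivariance -/

/-- The operators E_2^±, E_3^- all come from the W-invariant tensor ∑ e_i ⊗ e_i through equivariant
linear maps A and B, so one invariance argument serves for each of them. -/
theorem kRep_sum {A : (Fin r → ℂ) →ₗ[ℂ] Module.End ℂ (Std r V)}
    {B : (Fin r → ℂ) →ₗ[ℂ] Module.End ℂ (Spinor r)} (w : Φ.W)
    (hA : ∀ x, Φ.stdW τ w * A x = A (Φ.hRep w x) * Φ.stdW τ w)
    (hB : ∀ x, Φ.spinRep w * B x = B (Φ.hRep w x) * Φ.spinRep w) (θ : KMod r V) :
    Φ.kRep τ w ((∑ i, TensorProduct.map (A (basisVec i)) (B (basisVec i))) θ) =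
      (∑ i, TensorProduct.map (A (basisVec i)) (B (basisVec i))) (Φ.kRep τ w θ) := by
  have h : Φ.kRep τ w * (∑ i, TensorProduct.map (A (basisVec i)) (B (basisVec i))) =
      (∑ i, TensorProduct.map (A (basisVec i)) (B (basisVec i))) * Φ.kRep τ w := by
    have := sum_hRep_basisVec
      ((TensorProduct.mapBilinear (RingHom.id ℂ) _ _ _ _).compl₁₂ A B) w
    simp only [LinearMap.compl₁₂_apply, TensorProduct.mapBilinear_apply] at this
    conv_rhs => rw [← this, Finset.sum_mul]
    rw [Finset.mul_sum]
    refine Finset.sum_congr rfl fun i _ => ?_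
    change TensorProduct.map _ _ * _ = _ * TensorProduct.map _ _
    rw [← TensorProduct.map_mul, ← TensorProduct.map_mul, hA, hB]
  exact LinearMap.congr_fun h θ

theorem kRep_E2plus (hc : Φ.IsParam c) (w : Φ.W) (θ : KMod r V) :
    Φ.kRep τ w (Φ.E2plus c τ θ) = Φ.E2plus c τ (Φ.kRep τ w θ) :=
  kRep_sum τ (A := stdYL c τ) (B := wedgeL r) w (stdW_mul_stdY τ hc w) (spinRep_mul_wedge w) θ

theorem kRep_E2minus (w : Φ.W) (θ : KMod r V) :
    Φ.kRep τ w (E2minus r V θ) = E2minus r V (Φ.kRep τ w θ) :=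
  kRep_sum τ (A := stdXL r V) (B := contrL r) w (stdW_mul_stdX τ w) (spinRep_mul_contr w) θ

/-! ### The anticommutator of the two differentials -/

variable (c) in
/-- The anticommutator of `E_2^+` and `E_2^-`. -/
def Hop : Module.End ℂ (KMod r V) :=
  Φ.E2plus c τ * E2minus r V + E2minus r V * Φ.E2plus c τ

variable (c) in
theorem Hop_apply (θ : KMod r V) :
    Hop c τ θ = Φ.E2plus c τ (E2minus r V θ) + E2minus r V (Φ.E2plus c τ θ) := rfl

-- Cartan's formula with a correction. The term δ_ij of [y_i, x_j] and the Clifford relation give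
-- the two Euler operators. The reflection terms contract to s_α ⊗ (α ∧ ∂_{α^∨}), and α ∧ ∂_{α^∨} =
-- 1 - s_α on spinors, which turns them into the difference of s_α ⊗ 1 and the diagonal s_α.
variable (c) in
theorem Hop_tmul (p : Std r V) (ω : Spinor r) :
    Hop c τ (p ⊗ₜ ω) = (∑ i, stdX V (basisVec i) * Φ.stdY c τ (basisVec i)) p ⊗ₜ[ℂ] ω +
      p ⊗ₜ[ℂ] (∑ i, wedge (basisVec i) * contr (basisVec i)) ω -
      ∑ α ∈ Φ.Pos, c α • (Φ.stdW τ (Φ.s α) p ⊗ₜ[ℂ] ω - Φ.kRep τ (Φ.s α) (p ⊗ₜ ω)) := by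
  have h1 : ∀ i j : Fin r, Φ.stdY c τ (basisVec i) (stdX V (basisVec j) p) ⊗ₜ[ℂ]
        wedge (basisVec i) (contr (basisVec j) ω) +
      stdX V (basisVec j) (Φ.stdY c τ (basisVec i) p) ⊗ₜ[ℂ]
        contr (basisVec j) (wedge (basisVec i) ω) =
      ((if i = j then (stdX V (basisVec i) * Φ.stdY c τ (basisVec i)) p ⊗ₜ[ℂ] ω else 0) +
        if i = j then p ⊗ₜ[ℂ] (wedge (basisVec i) * contr (basisVec i)) ω else 0) -
      ∑ α ∈ Φ.Pos, c α • (Φ.stdW τ (Φ.s α) p ⊗ₜ[ℂ]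
        (((cplx (α : Euc r) ⬝ᵥ basisVec i) • wedge (basisVec i))
          (((coroot (α : Euc r) ⬝ᵥ basisVec j) • contr (basisVec j)) ω))) := by
    intro i j
    have h := LinearMap.congr_fun (stdY_mul_stdX c τ (basisVec i) (basisVec j)) p
    simp only [LinearMap.add_apply, LinearMap.sub_apply, LinearMap.smul_apply, LinearMap.sum_apply,
      Module.End.mul_apply, Module.End.one_apply] at h
    rw [h, contr_wedge, TensorProduct.add_tmul, TensorProduct.sub_tmul, TensorProduct.tmul_sub,
      TensorProduct.sum_tmul, basisVec_dotProduct, basisVec_dotProduct]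
    have h2 : ∀ α ∈ Φ.Pos, ((c α * (cplx (α : Euc r) ⬝ᵥ basisVec i) *
        (basisVec j ⬝ᵥ coroot (α : Euc r))) • Φ.stdW τ (Φ.s α) p) ⊗ₜ[ℂ]
          wedge (basisVec i) (contr (basisVec j) ω) = c α • (Φ.stdW τ (Φ.s α) p ⊗ₜ[ℂ]
        (((cplx (α : Euc r) ⬝ᵥ basisVec i) • wedge (basisVec i))
          (((coroot (α : Euc r) ⬝ᵥ basisVec j) • contr (basisVec j)) ω))) := by
      intro α _
      simp only [LinearMap.smul_apply, map_smul, TensorProduct.tmul_smul,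
        ← TensorProduct.smul_tmul', smul_smul, dotProduct_comm (basisVec j)]
      congr 1
      ring
    rw [Finset.sum_congr rfl h2]
    by_cases hij : i = j
    · subst hij
      simp only [if_true, one_smul, Module.End.mul_apply]
      abel
    · simp only [if_neg hij, if_neg (Ne.symm hij), zero_smul, TensorProduct.zero_tmul,
        TensorProduct.tmul_zero]
      abel
  have h3 : ∀ α : Φ.R, ∑ i, ∑ j, Φ.stdW τ (Φ.s α) p ⊗ₜ[ℂ]
        (((cplx (α : Euc r) ⬝ᵥ basisVec i) • wedge (basisVec i))
          (((coroot (α : Euc r) ⬝ᵥ basisVec j) • contr (basisVec j)) ω)) =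
      Φ.stdW τ (Φ.s α) p ⊗ₜ[ℂ] ω - Φ.kRep τ (Φ.s α) (p ⊗ₜ ω) := by
    intro α
    have e1 := sum_dotProduct_basisVec_smul (wedgeL r) (cplx (α : Euc r))
    have e2 := sum_dotProduct_basisVec_smul (contrL r) (coroot (α : Euc r))
    simp only [wedgeL_apply, contrL_apply] at e1 e2
    simp only [← TensorProduct.tmul_sum, ← map_sum]
    simp only [← LinearMap.sum_apply, e1, e2]
    rw [kRep_tmul, spinRep_s, LinearMap.sub_apply, TensorProduct.tmul_sub, Module.End.one_apply,
      Module.End.mul_apply, sub_sub_cancel]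
  rw [Hop_apply, E2minus_tmul, E2plus_tmul, map_sum, map_sum]
  simp only [E2plus_tmul, E2minus_tmul]
  conv_lhs => left; rw [Finset.sum_comm]
  simp only [← Finset.sum_add_distrib, h1, Finset.sum_sub_distrib,
    LinearMap.sum_apply, TensorProduct.sum_tmul, TensorProduct.tmul_sum]
  simp only [Finset.sum_add_distrib, Finset.sum_ite_eq, Finset.mem_univ, if_true]
  congr 1
  simp only [sum_sum_smul_comm, h3]

/-- Since ∑ ⟨α, y_i⟩ x_i = α, the denominators of the divided differences cancel and leave p ⊗ s_α v
- s_α p ⊗ s_α v. The first terms sum to N_c(τ) by Schur's lemma. -/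
theorem sum_mulOp_dunkl [FiniteDimensional ℂ V] [τ.IsIrreducible] (hc : Φ.IsParam c)
    (p : MvPolynomial (Fin r) ℂ) (v : V) :
    (∑ i, mulOp V (basisVec i) * Φ.dunkl c τ (basisVec i)) (p ⊗ₜ v) =
      (∑ i, mulOp V (basisVec i) * Φ.dunkl 0 τ (basisVec i)) (p ⊗ₜ v) - Nc c τ • (p ⊗ₜ[ℂ] v) +
      ∑ α ∈ Φ.Pos, c α • Φ.stdRep τ (Φ.s α) (p ⊗ₜ v) := by
  have h0 : ∀ i : Fin r, mulOp V (basisVec i) (Φ.dunkl c τ (basisVec i) (p ⊗ₜ v)) =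
      mulOp V (basisVec i) (Φ.dunkl 0 τ (basisVec i) (p ⊗ₜ v)) -
      ∑ α ∈ Φ.Pos, c α • ((cplx (α : Euc r) ⬝ᵥ basisVec i) •
        linForm (basisVec i) * Φ.divDiff α p) ⊗ₜ[ℂ] τ (Φ.s α) v := by
    intro i
    rw [dunkl_tmul, dunkl_tmul, map_sub, map_sub, map_sum]
    simp only [Pi.zero_apply, zero_mul, zero_smul, Finset.sum_const_zero, map_zero, sub_zero]
    congr 1
    refine Finset.sum_congr rfl fun α _ => ?_
    rw [map_smul, mulOp, TensorProduct.map_tmul, mul_smul, TensorProduct.smul_tmul', smul_mul_assoc]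
    rfl
  have h1 : ∀ α : Φ.R, ∑ i, ((cplx (α : Euc r) ⬝ᵥ basisVec i) •
        linForm (basisVec i) * Φ.divDiff α p) ⊗ₜ[ℂ] τ (Φ.s α) v =
      p ⊗ₜ[ℂ] τ (Φ.s α) v - Φ.polyRep (Φ.s α) p ⊗ₜ[ℂ] τ (Φ.s α) v := by
    intro α
    rw [← TensorProduct.sum_tmul, ← Finset.sum_mul, sum_dotProduct_basisVec_smul linForm,
      linForm_mul_divDiff, TensorProduct.sub_tmul]
  have h2 : ∑ α ∈ Φ.Pos, c α • (p ⊗ₜ[ℂ] τ (Φ.s α) v) = Nc c τ • (p ⊗ₜ[ℂ] v) := by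
    simp only [← TensorProduct.tmul_smul, ← TensorProduct.tmul_sum, Nc_spec hc]
  simp only [LinearMap.sum_apply, Module.End.mul_apply, h0, Finset.sum_sub_distrib, stdRep,
    Representation.tprod_apply, TensorProduct.map_tmul]
  simp only [sum_sum_smul_comm, h1, smul_sub, Finset.sum_sub_distrib, h2]
  abel

theorem sum_stdX_stdY [FiniteDimensional ℂ V] [τ.IsIrreducible] (hc : Φ.IsParam c) (p : Std r V) :
    (∑ i, stdX V (basisVec i) * Φ.stdY c τ (basisVec i)) p =
      (∑ i, stdX V (basisVec i) * Φ.stdY 0 τ (basisVec i)) p - Nc c τ • p +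
      ∑ α ∈ Φ.Pos, c α • Φ.stdW τ (Φ.s α) p := by
  have : ∑ i, mulOp V (basisVec i) * Φ.dunkl c τ (basisVec i) =
      ∑ i, mulOp V (basisVec i) * Φ.dunkl 0 τ (basisVec i) - Nc c τ • LinearMap.id +
      ∑ α ∈ Φ.Pos, c α • Φ.stdRep τ (Φ.s α) := by
    refine TensorProduct.ext' fun p v => ?_
    rw [sum_mulOp_dunkl τ hc]
    simp [LinearMap.sum_apply]
  have h : ∀ q, (∑ i, mulOp V (basisVec i) * Φ.dunkl c τ (basisVec i)) q =
      (∑ i, mulOp V (basisVec i) * Φ.dunkl 0 τ (basisVec i)) q - Nc c τ • q +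
      ∑ α ∈ Φ.Pos, c α • Φ.stdRep τ (Φ.s α) q := by
    intro q
    rw [this]
    simp [LinearMap.sum_apply]
  exact h p

/-- The one-sided terms s_α ⊗ 1 of `Hop_tmul` cancel those of the deformed Euler operator in
`sum_stdX_stdY`. The dependence on c is thus confined to a scalar and an element of the group
algebra acting diagonally, both harmless for equivariant maps. -/
theorem Hop_eq [FiniteDimensional ℂ V] [τ.IsIrreducible] (hc : Φ.IsParam c) (θ : KMod r V) :
    Hop c τ θ = Hop 0 τ θ - Nc c τ • θ + ∑ α ∈ Φ.Pos, c α • Φ.kRep τ (Φ.s α) θ := by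
  have : Hop c τ + Nc c τ • LinearMap.id = Hop 0 τ + ∑ α ∈ Φ.Pos, c α • Φ.kRep τ (Φ.s α) := by
    refine TensorProduct.ext' fun p ω => ?_
    simp only [LinearMap.add_apply, LinearMap.smul_apply, LinearMap.id_apply, LinearMap.sum_apply,
      Hop_tmul]
    rw [← LinearMap.sum_apply, ← LinearMap.sum_apply, ← LinearMap.sum_apply, sum_stdX_stdY τ hc]
    simp only [TensorProduct.add_tmul, TensorProduct.sub_tmul, TensorProduct.sum_tmul,
      ← TensorProduct.smul_tmul', smul_sub, Finset.sum_sub_distrib, Pi.zero_apply, zero_smul,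
      Finset.sum_const_zero]
    abel
  have h := LinearMap.congr_fun this θ
  simp only [LinearMap.add_apply, LinearMap.smul_apply, LinearMap.id_apply,
    LinearMap.sum_apply] at h
  rw [← sub_eq_iff_eq_add.2 h.symm]
  abel

theorem kRep_Hop (hc : Φ.IsParam c) (w : Φ.W) (θ : KMod r V) :
    Φ.kRep τ w (Hop c τ θ) = Hop c τ (Φ.kRep τ w θ) := by
  rw [Hop_apply, Hop_apply, map_add, kRep_E2plus τ hc, kRep_E2minus, kRep_E2minus,
    kRep_E2plus τ hc]

theorem E2minus_Hop (θ : KMod r V) :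
    E2minus r V (Hop c τ θ) = Hop c τ (E2minus r V θ) := by
  rw [Hop_apply, Hop_apply, map_add, E2minus_E2minus, E2minus_E2minus, map_zero, add_zero,
    zero_add]

/-- The shift by 2 reflects that E_1^- lowers m + l by two; E_3^- lowers m and l by one each, whence
the same shift in `negE3_Hop`. -/
theorem E1minus_Hop (hc : Φ.IsParam c) (θ : KMod r V) :
    Φ.E1minus c τ (Hop c τ θ) =
      Hop c τ (Φ.E1minus c τ θ) + (2 : ℂ) • Φ.E1minus c τ θ := by
  rw [Hop_apply, Hop_apply, map_add, E1minus_E2plus τ hc, E1minus_E2minus τ hc,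
    E1minus_E2minus τ hc, E1minus_E2plus τ hc, map_add, ← E2plus_negE3 τ hc]
  abel

theorem negE3_Hop (hc : Φ.IsParam c) (θ : KMod r V) :
    negE3 c τ (Hop c τ θ) = Hop c τ (negE3 c τ θ) + (2 : ℂ) • negE3 c τ θ := by
  have h1 := E2plus_negE3 τ hc (E2minus r V θ)
  have h2 := negE3_E2minus (c := c) τ (Φ.E2plus c τ θ)
  have h3 := congrArg (Φ.E2plus c τ) (negE3_E2minus (c := c) τ θ)
  have h4 := congrArg (E2minus r V) (E2plus_negE3 τ hc θ)
  have h5 := E1minus_E2minus τ hc θ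
  simp only [map_add, map_smul, map_zero] at h3 h4
  rw [Hop_apply, Hop_apply, map_add]
  linear_combination (norm := module) h1 + h2 - h3 - h4 + (2 : ℂ) • h5

end RootDatum

end DunklHowe
end

/-! ### The bigrading of K and the degrees of the operators. -/

noncomputable section

namespace DunklHowe

variable {r : ℕ} {Φ : RootDatum r} {V : Type*} [AddCommGroup V] [Module ℂ V]

/-- The shift of a family of subspaces that starts with the zero subspace. -/
def shiftFamily {N : Type*} [AddCommGroup N] [Module ℂ N] (F : ℕ → Submodule ℂ N) :
    ℕ → Submodule ℂ N
  | 0 => ⊥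
  | k + 1 => F k

/-! ### The grading of the standard module -/

/-- A pure tensor in the standard module. -/
def stdTmul (p : MvPolynomial (Fin r) ℂ) (v : V) : Std r V := p ⊗ₜ[ℂ] v

theorem stdTmul_mem {m : ℕ} {p : MvPolynomial (Fin r) ℂ} (hp : p.IsHomogeneous m) (v : V) :
    stdTmul p v ∈ stdDeg (r := r) V m := by
  refine ⟨(⟨p, hp⟩ : MvPolynomial.homogeneousSubmodule (Fin r) ℂ m) ⊗ₜ v, ?_⟩
  rfl

theorem stdTmul_mem_of_monomial {S : Submodule ℂ (Std r V)} {p : MvPolynomial (Fin r) ℂ} (v : V)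
    (h : ∀ a ∈ p.support, stdTmul (MvPolynomial.monomial a 1) v ∈ S) : stdTmul p v ∈ S := by
  have h1 : stdTmul p v = ∑ a ∈ p.support, MvPolynomial.coeff a p •
      stdTmul (MvPolynomial.monomial a (1 : ℂ)) v := by
    have : p = ∑ a ∈ p.support, MvPolynomial.coeff a p • MvPolynomial.monomial a (1 : ℂ) := by
      conv_lhs => rw [MvPolynomial.as_sum p]
      refine Finset.sum_congr rfl fun a _ => ?_
      rw [MvPolynomial.smul_monomial, smul_eq_mul, mul_one]
    have e := congrArg (fun q => q ⊗ₜ[ℂ] v) this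
    simp only [TensorProduct.sum_tmul, ← TensorProduct.smul_tmul'] at e
    exact e
  rw [h1]
  exact Submodule.sum_mem _ fun a ha => Submodule.smul_mem _ _ (h a ha)

theorem stdDeg_le {m : ℕ} {S : Submodule ℂ (Std r V)}
    (h : ∀ a : Fin r →₀ ℕ, a.degree = m → ∀ v : V, stdTmul (MvPolynomial.monomial a 1) v ∈ S) :
    stdDeg V m ≤ S := by
  rintro _ ⟨t, rfl⟩
  let f : MvPolynomial.homogeneousSubmodule (Fin r) ℂ m ⊗[ℂ] V →ₗ[ℂ] Std r V :=
    TensorProduct.map (MvPolynomial.homogeneousSubmodule (Fin r) ℂ m).subtype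
      (LinearMap.id : V →ₗ[ℂ] V)
  change f t ∈ S
  induction t using TensorProduct.induction_on with
  | zero => rw [map_zero]; exact S.zero_mem
  | add t t' ht ht' => rw [map_add]; exact S.add_mem ht ht'
  | tmul p v =>
    refine stdTmul_mem_of_monomial v fun a ha => h a ?_ v
    by_contra hne
    exact (MvPolynomial.mem_support_iff.1 ha) (MvPolynomial.IsHomogeneous.coeff_eq_zero p.2 hne)

theorem stdX_stdTmul (x : Fin r → ℂ) (p : MvPolynomial (Fin r) ℂ) (v : V) :
    stdX V x (stdTmul p v) = stdTmul (linForm x * p) v := rfl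

/-- Induction on degree by multiplication with coordinates. It lets statements on the y_i be derived
from their commutators with the x_i, without looking at divided differences of monomials. -/
theorem stdDeg_le_of_stdX (S : ℕ → Submodule ℂ (Std r V)) (h0 : ∀ v : V, stdTmul 1 v ∈ S 0)
    (h1 : ∀ m i, ∀ q ∈ stdDeg V m, q ∈ S m → stdX V (basisVec i) q ∈ S (m + 1)) (m : ℕ) :
    stdDeg V m ≤ S m := by
  induction m with
  | zero =>
    refine stdDeg_le fun a ha v => ?_
    rw [Finsupp.degree_eq_zero_iff] at ha
    subst ha
    exact h0 v
  | succ m ih =>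
    refine stdDeg_le fun a ha v => ?_
    obtain ⟨i, hi⟩ : ∃ i, a i ≠ 0 := by
      by_contra hne
      push Not at hne
      have : a = 0 := Finsupp.ext hne
      rw [this] at ha
      simp at ha
    have hsplit : a = Finsupp.single i 1 + (a - Finsupp.single i 1) := by
      rw [add_tsub_cancel_of_le]
      rwa [Finsupp.single_le_iff, Nat.one_le_iff_ne_zero]
    have hdeg : (a - Finsupp.single i 1).degree = m := by
      rw [hsplit, map_add, Finsupp.degree_single] at ha
      omega
    have hmem : stdTmul (MvPolynomial.monomial (a - Finsupp.single i 1) (1 : ℂ)) v ∈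
        stdDeg (r := r) V m := stdTmul_mem (MvPolynomial.isHomogeneous_monomial _ hdeg) v
    have := h1 m i _ hmem (ih hmem)
    rwa [stdX_stdTmul, basisVec, linForm_single, MvPolynomial.X, MvPolynomial.monomial_mul, one_mul,
      ← hsplit] at this

theorem iSup_stdDeg : ⨆ m, stdDeg (r := r) V m = ⊤ := by
  rw [eq_top_iff]
  intro q _
  change MvPolynomial (Fin r) ℂ ⊗[ℂ] V at q
  induction q using TensorProduct.induction_on with
  | zero => exact Submodule.zero_mem _
  | add t t' ht ht' => exact Submodule.add_mem _ (ht trivial) (ht' trivial)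
  | tmul p v =>
    refine stdTmul_mem_of_monomial v fun a _ => ?_
    exact Submodule.mem_iSup_of_mem a.degree
      (stdTmul_mem (MvPolynomial.isHomogeneous_monomial _ rfl) v)

theorem stdDeg_ext {N : Type*} [AddCommGroup N] [Module ℂ N] {f g : Std r V →ₗ[ℂ] N}
    (h : ∀ m, ∀ q ∈ stdDeg V m, f q = g q) : f = g := by
  have : (⊤ : Submodule ℂ (Std r V)) ≤ LinearMap.eqLocus f g := by
    rw [← iSup_stdDeg]
    exact iSup_le fun m q hq => h m q hq
  exact LinearMap.ext fun q => this trivial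

theorem isHomogeneous_linForm (x : Fin r → ℂ) : (linForm x).IsHomogeneous 1 := by
  rw [linForm_apply]
  refine MvPolynomial.IsHomogeneous.sum _ _ _ fun i _ => ?_
  rw [MvPolynomial.smul_eq_C_mul]
  exact MvPolynomial.isHomogeneous_C_mul_X _ _

theorem stdX_mem {m : ℕ} (x : Fin r → ℂ) {q : Std r V} (hq : q ∈ stdDeg V m) :
    stdX V x q ∈ stdDeg V (m + 1) := by
  have : stdDeg V m ≤ (stdDeg V (m + 1)).comap (stdX V x) := by
    refine stdDeg_le fun a ha v => ?_
    rw [Submodule.mem_comap, stdX_stdTmul, add_comm]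
    exact stdTmul_mem ((isHomogeneous_linForm x).mul (MvPolynomial.isHomogeneous_monomial _ ha)) v
  exact this hq

instance (m : ℕ) [FiniteDimensional ℂ V] : FiniteDimensional ℂ (stdDeg (r := r) V m) := by
  have : FiniteDimensional ℂ (MvPolynomial.homogeneousSubmodule (Fin r) ℂ m) :=
    Module.Finite.iff_fg.2 (MvPolynomial.homogeneousSubmodule_fg _ _ m)
  unfold stdDeg
  exact LinearMap.finiteDimensional_range (V := MvPolynomial.homogeneousSubmodule (Fin r) ℂ m ⊗[ℂ] V)
    (V₂ := Std r V) _

namespace RootDatum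

variable {c : Φ.R → ℂ} (τ : Representation ℂ Φ.W V)

theorem stdW_mem {m : ℕ} (w : Φ.W) {q : Std r V} (hq : q ∈ stdDeg V m) :
    Φ.stdW τ w q ∈ stdDeg V m := by
  have : stdDeg V m ≤ (stdDeg V m).comap (Φ.stdW τ w) := by
    refine stdDeg_le fun a ha v => ?_
    have h := (MvPolynomial.isHomogeneous_monomial (1 : ℂ) ha).aeval
      (fun i => linForm (Φ.hRep w (Pi.single i 1))) fun i => isHomogeneous_linForm _
    rw [one_mul] at h
    exact stdTmul_mem h (τ w v)
  exact this hq

variable (c)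

theorem stdY_stdTmul_one (y : Fin r → ℂ) (v : V) : Φ.stdY c τ y (stdTmul 1 v) = 0 :=
  dunkl_one_tmul c τ y v

theorem stdY_stdX (y x : Fin r → ℂ) (q : Std r V) :
    Φ.stdY c τ y (stdX V x q) = stdX V x (Φ.stdY c τ y q) + ((x ⬝ᵥ y) • q -
      ∑ α ∈ Φ.Pos, (c α * (cplx (α : Euc r) ⬝ᵥ y) * (x ⬝ᵥ coroot (α : Euc r))) •
        Φ.stdW τ (Φ.s α) q) := by
  have := LinearMap.congr_fun (stdY_mul_stdX c τ y x) q
  simpa only [Module.End.mul_apply, LinearMap.add_apply, LinearMap.sub_apply, LinearMap.smul_apply,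
    LinearMap.sum_apply, Module.End.one_apply] using this

/-- The operators `y` lower the degree. -/
theorem stdY_mem_aux (m : ℕ) :
    stdDeg V m ≤ ⨅ y : Fin r → ℂ,
      (shiftFamily (stdDeg V) m).comap (Φ.stdY c τ y) := by
  refine stdDeg_le_of_stdX (fun m => ⨅ y : Fin r → ℂ,
    (shiftFamily (stdDeg V) m).comap (Φ.stdY c τ y))
    (fun v => ?_) (fun m i q hq ih => ?_) m
  · simp only [Submodule.mem_iInf, Submodule.mem_comap, stdY_stdTmul_one]
    exact fun _ => Submodule.zero_mem _
  · rw [Submodule.mem_iInf] at ih ⊢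
    intro y
    have ih := ih y
    rw [Submodule.mem_comap] at ih ⊢
    rw [stdY_stdX]
    refine Submodule.add_mem _ ?_ (Submodule.sub_mem _ (Submodule.smul_mem _ _ hq)
      (Submodule.sum_mem _ fun α _ => Submodule.smul_mem _ _ (stdW_mem τ _ hq)))
    cases m with
    | zero =>
      rw [(Submodule.mem_bot ℂ).1 ih, map_zero]
      exact Submodule.zero_mem _
    | succ m => exact stdX_mem _ ih

theorem stdY_mem {m : ℕ} (y : Fin r → ℂ) {q : Std r V} (hq : q ∈ stdDeg V (m + 1)) :
    Φ.stdY c τ y q ∈ stdDeg V m :=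
  (Submodule.mem_iInf _).1 (stdY_mem_aux c τ (m + 1) hq) y

theorem stdY_eq_zero (y : Fin r → ℂ) {q : Std r V} (hq : q ∈ stdDeg V 0) :
    Φ.stdY c τ y q = 0 :=
  (Submodule.mem_bot ℂ).1 ((Submodule.mem_iInf _).1 (stdY_mem_aux c τ 0 hq) y)

theorem euler_stdDeg {m : ℕ} {q : Std r V} (hq : q ∈ stdDeg V m) :
    ∑ i, stdX V (basisVec i) (Φ.stdY 0 τ (basisVec i) q) = (m : ℂ) • q := by
  let e : Module.End ℂ (Std r V) := ∑ i, stdX V (basisVec i) * Φ.stdY 0 τ (basisVec i)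
  have he : ∀ q, e q = ∑ i, stdX V (basisVec i) (Φ.stdY 0 τ (basisVec i) q) := fun q => by
    simp [e, LinearMap.sum_apply]
  have := stdDeg_le_of_stdX (fun m => LinearMap.eqLocus e ((m : ℂ) • (1 : Module.End ℂ (Std r V))))
    (fun v => ?_) (fun m j q hq ih => ?_) m hq
  · rw [← he]; exact this
  · rw [LinearMap.mem_eqLocus, he]
    simp [stdY_stdTmul_one]
  · rw [LinearMap.mem_eqLocus] at ih ⊢
    have h1 : ∀ i, stdX V (basisVec i) (Φ.stdY 0 τ (basisVec i) (stdX V (basisVec j) q)) =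
        stdX V (basisVec j) (stdX V (basisVec i) (Φ.stdY 0 τ (basisVec i) q)) +
        if j = i then stdX V (basisVec i) q else 0 := by
      intro i
      rw [stdY_stdX, map_add, stdX_stdX, basisVec_dotProduct]
      congr 1
      split_ifs <;> simp
    rw [he]
    simp only [h1, Finset.sum_add_distrib, ← map_sum, ← he, ih, Finset.sum_ite_eq, Finset.mem_univ,
      if_true, LinearMap.smul_apply, Module.End.one_apply, map_smul]
    rw [Nat.cast_succ, add_smul, one_smul]

end RootDatum

/-! ### The grading of the spinors -/

/-- The exterior counterpart of `stdDeg_le_of_stdX`: statements on contractions follow from the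
Clifford relation. -/
theorem exteriorPower_le_of_wedge (S : ℕ → Submodule ℂ (Spinor r)) (h0 : 1 ∈ S 0)
    (h1 : ∀ l x, ∀ ω ∈ ⋀[ℂ]^l (Fin r → ℂ), ω ∈ S l → wedge x ω ∈ S (l + 1)) (l : ℕ) :
    ⋀[ℂ]^l (Fin r → ℂ) ≤ S l := by
  intro ω hω
  refine Submodule.pow_induction_on_left' (M := LinearMap.range (ExteriorAlgebra.ι ℂ))
    (C := fun l ω _ => ω ∈ S l) ?_ ?_ ?_ hω
  · intro a
    rw [Algebra.algebraMap_eq_smul_one]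
    exact Submodule.smul_mem _ _ h0
  · intro x y i _ _ hx hy
    exact Submodule.add_mem _ hx hy
  · rintro _ ⟨x, rfl⟩ i ω hω ih
    exact h1 i x ω hω ih

theorem one_mem_exteriorPower : (1 : Spinor r) ∈ ⋀[ℂ]^0 (Fin r → ℂ) := by
  rw [ExteriorAlgebra.exteriorPower, pow_zero]
  exact Submodule.one_le.1 le_rfl

theorem wedge_mem {l : ℕ} (x : Fin r → ℂ) {ω : Spinor r} (h : ω ∈ ⋀[ℂ]^l (Fin r → ℂ)) :
    wedge x ω ∈ ⋀[ℂ]^(l + 1) (Fin r → ℂ) := by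
  rw [ExteriorAlgebra.exteriorPower, pow_succ']
  exact Submodule.mul_mem_mul ⟨x, rfl⟩ h

theorem contr_mem_aux (l : ℕ) :
    ⋀[ℂ]^l (Fin r → ℂ) ≤ ⨅ y : Fin r → ℂ,
      (shiftFamily (fun k => ⋀[ℂ]^k (Fin r → ℂ)) l).comap (contr y) := by
  refine exteriorPower_le_of_wedge (fun l => ⨅ y : Fin r → ℂ,
    (shiftFamily (fun k => ⋀[ℂ]^k (Fin r → ℂ)) l).comap (contr y))
    ?_ (fun l x ω hω ih => ?_) l
  · simp only [Submodule.mem_iInf, Submodule.mem_comap, contr_one]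
    exact fun _ => Submodule.zero_mem _
  · rw [Submodule.mem_iInf] at ih ⊢
    intro y
    have ih := ih y
    rw [Submodule.mem_comap] at ih ⊢
    rw [RootDatum.contr_wedge]
    refine Submodule.sub_mem _ (Submodule.smul_mem _ _ hω) ?_
    cases l with
    | zero =>
      rw [(Submodule.mem_bot ℂ).1 ih, map_zero]
      exact Submodule.zero_mem _
    | succ l => exact wedge_mem _ ih

theorem contr_mem {l : ℕ} (y : Fin r → ℂ) {ω : Spinor r} (h : ω ∈ ⋀[ℂ]^(l + 1) (Fin r → ℂ)) :
    contr y ω ∈ ⋀[ℂ]^l (Fin r → ℂ) :=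
  (Submodule.mem_iInf _).1 (contr_mem_aux (l + 1) h) y

theorem contr_eq_zero (y : Fin r → ℂ) {ω : Spinor r} (h : ω ∈ ⋀[ℂ]^0 (Fin r → ℂ)) :
    contr y ω = 0 :=
  (Submodule.mem_bot ℂ).1 ((Submodule.mem_iInf _).1 (contr_mem_aux 0 h) y)

theorem spinRep_mem {l : ℕ} (w : Φ.W) {ω : Spinor r} (h : ω ∈ ⋀[ℂ]^l (Fin r → ℂ)) :
    Φ.spinRep w ω ∈ ⋀[ℂ]^l (Fin r → ℂ) := by
  refine exteriorPower_le_of_wedge (fun l => (⋀[ℂ]^l (Fin r → ℂ)).comap (Φ.spinRep w)) ?_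
    (fun l x ω hω ih => ?_) l h
  · rw [Submodule.mem_comap, RootDatum.spinRep_one]
    exact one_mem_exteriorPower
  · rw [Submodule.mem_comap, ← Module.End.mul_apply, RootDatum.spinRep_mul_wedge]
    exact wedge_mem _ ih

theorem euler_exteriorPower {l : ℕ} {ω : Spinor r} (h : ω ∈ ⋀[ℂ]^l (Fin r → ℂ)) :
    ∑ i, wedge (basisVec i) (contr (basisVec i) ω) = (l : ℂ) • ω := by
  let e : Module.End ℂ (Spinor r) := ∑ i, wedge (basisVec i) * contr (basisVec i)
  have he : ∀ ω, e ω = ∑ i, wedge (basisVec i) (contr (basisVec i) ω) := fun ω => by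
    simp [e, LinearMap.sum_apply]
  have := exteriorPower_le_of_wedge
    (fun l => LinearMap.eqLocus e ((l : ℂ) • (1 : Module.End ℂ (Spinor r))))
    ?_ (fun l x ω hω ih => ?_) l h
  · rw [← he]; exact this
  · rw [LinearMap.mem_eqLocus, he]
    simp [contr_one]
  · rw [LinearMap.mem_eqLocus] at ih ⊢
    have h1 : ∀ i, wedge (basisVec i) (contr (basisVec i) (wedge x ω)) =
        wedge x (wedge (basisVec i) (contr (basisVec i) ω)) +
        ((x ⬝ᵥ basisVec i) • wedge (basisVec i)) ω := by
      intro i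
      rw [RootDatum.contr_wedge, map_sub, map_smul, RootDatum.wedge_wedge (basisVec i) x,
        sub_neg_eq_add, add_comm]
      rfl
    have h2 := RootDatum.sum_dotProduct_basisVec_smul (wedgeL r) x
    simp only [wedgeL_apply] at h2
    rw [he]
    simp only [h1, Finset.sum_add_distrib]
    rw [← map_sum, ← he, ih, ← LinearMap.sum_apply, h2]
    simp only [LinearMap.smul_apply, Module.End.one_apply, map_smul]
    rw [Nat.cast_succ, add_smul, one_smul]

theorem iSup_exteriorPower : ⨆ l, ⋀[ℂ]^l (Fin r → ℂ) = ⊤ :=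
  (DirectSum.Decomposition.isInternal
    (fun l => ⋀[ℂ]^l (Fin r → ℂ))).submodule_iSup_eq_top

/-! ### The bigrading of `K` -/

theorem tmul_mem_bideg {m l : ℕ} {p : Std r V} {ω : Spinor r} (hp : p ∈ stdDeg V m)
    (hω : ω ∈ ⋀[ℂ]^l (Fin r → ℂ)) : p ⊗ₜ[ℂ] ω ∈ bideg (r := r) V m l :=
  ⟨(⟨p, hp⟩ : stdDeg V m) ⊗ₜ (⟨ω, hω⟩ : ⋀[ℂ]^l (Fin r → ℂ)), rfl⟩

theorem bideg_le {m l : ℕ} {S : Submodule ℂ (KMod r V)}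
    (h : ∀ p ∈ stdDeg V m, ∀ ω ∈ ⋀[ℂ]^l (Fin r → ℂ), p ⊗ₜ[ℂ] ω ∈ S) : bideg V m l ≤ S := by
  rintro _ ⟨t, rfl⟩
  induction t using TensorProduct.induction_on with
  | zero => rw [map_zero]; exact S.zero_mem
  | add t t' ht ht' => rw [map_add]; exact S.add_mem ht ht'
  | tmul p ω => exact h p p.2 ω ω.2

theorem iSup_bideg : ⨆ i : ℕ × ℕ, bideg (r := r) V i.1 i.2 = ⊤ := by
  rw [eq_top_iff]
  intro q _
  induction q using TensorProduct.induction_on with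
  | zero => exact Submodule.zero_mem _
  | add t t' ht ht' => exact Submodule.add_mem _ (ht trivial) (ht' trivial)
  | tmul p ω =>
    have h1 : (⊤ : Submodule ℂ (Std r V)) ≤ (⨆ i : ℕ × ℕ, bideg (r := r) V i.1 i.2).comap
        ((TensorProduct.mk ℂ _ _).flip ω) := by
      rw [← iSup_stdDeg]
      refine iSup_le fun m p hp => ?_
      have h2 : (⊤ : Submodule ℂ (Spinor r)) ≤ (⨆ i : ℕ × ℕ, bideg (r := r) V i.1 i.2).comap
          (TensorProduct.mk ℂ _ _ p) := by
        rw [← iSup_exteriorPower]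
        refine iSup_le fun l ω hω => ?_
        exact Submodule.mem_iSup_of_mem (m, l) (tmul_mem_bideg hp hω)
      exact h2 trivial
    exact h1 trivial

theorem bideg_ext {N : Type*} [AddCommGroup N] [Module ℂ N] {f g : KMod r V →ₗ[ℂ] N}
    (h : ∀ m l, ∀ θ ∈ bideg V m l, f θ = g θ) : f = g := by
  have : (⊤ : Submodule ℂ (KMod r V)) ≤ LinearMap.eqLocus f g := by
    rw [← iSup_bideg]
    exact iSup_le fun i θ hθ => h i.1 i.2 θ hθ
  exact LinearMap.ext fun θ => this trivial

instance (m l : ℕ) [FiniteDimensional ℂ V] : FiniteDimensional ℂ (bideg (r := r) V m l) := by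
  unfold bideg
  exact LinearMap.finiteDimensional_range _

theorem E2minus_mem {m l : ℕ} {θ : KMod r V} (h : θ ∈ bideg V m (l + 1)) :
    RootDatum.E2minus r V θ ∈ bideg V (m + 1) l := by
  have : bideg V m (l + 1) ≤ (bideg V (m + 1) l).comap (RootDatum.E2minus r V) :=
    bideg_le fun p hp ω hω => by
      rw [Submodule.mem_comap, RootDatum.E2minus_tmul]
      exact Submodule.sum_mem _ fun i _ => tmul_mem_bideg (stdX_mem _ hp) (contr_mem _ hω)
  exact this h

theorem E2minus_eq_zero {m : ℕ} {θ : KMod r V} (h : θ ∈ bideg V m 0) :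
    RootDatum.E2minus r V θ = 0 := by
  have : bideg V m 0 ≤ LinearMap.ker (RootDatum.E2minus r V) :=
    bideg_le fun p hp ω hω => by
      rw [LinearMap.mem_ker, RootDatum.E2minus_tmul]
      exact Finset.sum_eq_zero fun i _ => by rw [contr_eq_zero _ hω, TensorProduct.tmul_zero]
  exact this h

namespace RootDatum

variable (c : Φ.R → ℂ) (τ : Representation ℂ Φ.W V)

theorem kRep_mem {m l : ℕ} (w : Φ.W) {θ : KMod r V} (h : θ ∈ bideg V m l) :
    Φ.kRep τ w θ ∈ bideg V m l := by
  have : bideg V m l ≤ (bideg V m l).comap (Φ.kRep τ w) :=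
    bideg_le fun p hp ω hω => tmul_mem_bideg (stdW_mem τ w hp) (spinRep_mem w hω)
  exact this h

theorem E2plus_mem {m l : ℕ} {θ : KMod r V} (h : θ ∈ bideg V (m + 1) l) :
    Φ.E2plus c τ θ ∈ bideg V m (l + 1) := by
  have : bideg V (m + 1) l ≤ (bideg V m (l + 1)).comap (Φ.E2plus c τ) :=
    bideg_le fun p hp ω hω => by
      rw [Submodule.mem_comap, E2plus_tmul]
      exact Submodule.sum_mem _ fun i _ => tmul_mem_bideg (stdY_mem c τ _ hp) (wedge_mem _ hω)
  exact this h

theorem E2plus_eq_zero {l : ℕ} {θ : KMod r V} (h : θ ∈ bideg V 0 l) : Φ.E2plus c τ θ = 0 := by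
  have : bideg V 0 l ≤ LinearMap.ker (Φ.E2plus c τ) :=
    bideg_le fun p hp ω hω => by
      rw [LinearMap.mem_ker, E2plus_tmul]
      exact Finset.sum_eq_zero fun i _ => by rw [stdY_eq_zero c τ _ hp, TensorProduct.zero_tmul]
  exact this h

theorem bideg_zero_le_AHarm (l : ℕ) : bideg V 0 l ≤ Φ.AHarm c τ :=
  bideg_le fun p hp ω hω => by
    rw [mem_AHarm, E1minus_tmul, negE3_tmul, lapl, LinearMap.sum_apply]
    simp [stdY_eq_zero c τ _ hp]

/-- At c = 0 all reflection terms are absent, and the anticommutator is the sum of the Euler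
operators of ℂ[𝔥] and ⋀𝔥^*, that is, the total degree. -/
theorem Hop_zero_eq {m l : ℕ} {θ : KMod r V} (h : θ ∈ bideg V m l) :
    Hop 0 τ θ = ((m + l : ℕ) : ℂ) • θ := by
  have : bideg V m l ≤ LinearMap.eqLocus (Hop 0 τ)
      (((m + l : ℕ) : ℂ) • (LinearMap.id : Module.End ℂ (KMod r V))) :=
    bideg_le fun p hp ω hω => by
      rw [LinearMap.mem_eqLocus, Hop_tmul]
      simp only [LinearMap.sum_apply, Module.End.mul_apply, euler_stdDeg τ hp,
        euler_exteriorPower hω, Pi.zero_apply, zero_smul, Finset.sum_const_zero, sub_zero,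
        LinearMap.smul_apply, LinearMap.id_apply, TensorProduct.tmul_smul,
        ← TensorProduct.smul_tmul']
      rw [Nat.cast_add, add_smul]
  exact this h

theorem Hop_mem [FiniteDimensional ℂ V] [τ.IsIrreducible] (hc : Φ.IsParam c) {m l : ℕ}
    {θ : KMod r V} (h : θ ∈ bideg V m l) : Hop c τ θ ∈ bideg V m l := by
  rw [Hop_eq τ hc, Hop_zero_eq τ h]
  exact Submodule.add_mem _ (Submodule.sub_mem _ (Submodule.smul_mem _ _ h)
    (Submodule.smul_mem _ _ h))
    (Submodule.sum_mem _ fun α _ => Submodule.smul_mem _ _ (kRep_mem τ _ h))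

end RootDatum

end DunklHowe
end

/-! ### The projection to K_0^0 and the kernel of H_c + k. -/

noncomputable section

namespace DunklHowe

/-- A non-zero finite-dimensional invariant subspace contains an irreducible one. -/
theorem exists_irreducible_subrepresentation {G K : Type*} [Monoid G] [AddCommGroup K] [Module ℂ K]
    (κ : Representation ℂ G K) (N : Submodule ℂ K) [FiniteDimensional ℂ N]
    (hN : ∀ g, ∀ x ∈ N, κ g x ∈ N) (hne : N ≠ ⊥) :
    ∃ S : Subrepresentation κ, S.toSubmodule ≤ N ∧ S.toRepresentation.IsIrreducible := by
  induction hd : Module.finrank ℂ N using Nat.strong_induction_on generalizing N with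
  | _ d ih =>
  by_cases h : ∃ N' : Submodule ℂ K, N' < N ∧ N' ≠ ⊥ ∧ ∀ g, ∀ x ∈ N', κ g x ∈ N'
  · obtain ⟨N', hlt, hne', hN'⟩ := h
    have : FiniteDimensional ℂ N' := Submodule.finiteDimensional_of_le hlt.le
    obtain ⟨S, hS, hS'⟩ := ih _ (hd ▸ Submodule.finrank_lt_finrank_of_lt hlt) N' hN' hne' rfl
    exact ⟨S, hS.trans hlt.le, hS'⟩
  -- No proper nonzero invariant subspace lies in N, so N itself is irreducible.
  · push Not at h
    let T : Subrepresentation κ := ⟨N, fun g _ hx => hN g _ hx⟩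
    refine ⟨T, le_rfl, ?_⟩
    have hbt : ∀ A : Subrepresentation T.toRepresentation, A = ⊥ ∨ A = ⊤ := by
      intro A
      have hle : A.toSubmodule.map N.subtype ≤ N := by
        rintro _ ⟨x, _, rfl⟩; exact x.2
      have hst : ∀ g, ∀ x ∈ A.toSubmodule.map N.subtype, κ g x ∈ A.toSubmodule.map N.subtype := by
        rintro g _ ⟨x, hx, rfl⟩
        exact ⟨_, A.apply_mem_toSubmodule g hx, rfl⟩
      rcases hle.lt_or_eq with hlt | heq
      · left
        have hb : A.toSubmodule.map N.subtype = ⊥ := by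
          by_contra hb
          obtain ⟨g, x, hx, hx'⟩ := h _ hlt hb
          exact hx' (hst g x hx)
        apply Subrepresentation.toSubmodule_injective
        exact Submodule.map_injective_of_injective N.injective_subtype
          (hb.trans (Submodule.map_bot _).symm)
      · right
        apply Subrepresentation.toSubmodule_injective
        refine eq_top_iff.2 fun x _ => ?_
        have hx : (x : K) ∈ A.toSubmodule.map N.subtype := by
          rw [heq]; exact x.2
        obtain ⟨y, hy, hyx⟩ := hx
        rwa [← Subtype.ext hyx]
    have hnt : (⊥ : Subrepresentation T.toRepresentation) ≠ ⊤ := by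
      intro hbot
      apply hne
      rw [eq_bot_iff]
      intro x hx
      have : (⟨x, hx⟩ : N) ∈ (⊤ : Subrepresentation T.toRepresentation) := trivial
      rw [← hbot] at this
      exact (Submodule.mem_bot ℂ).2 (congrArg Subtype.val ((Submodule.mem_bot ℂ).1 this))
    have : Nontrivial (Subrepresentation T.toRepresentation) := ⟨⟨_, _, hnt⟩⟩
    exact ⟨hbt⟩

variable {r : ℕ} {Φ : RootDatum r}

section

variable {V : Type*} [AddCommGroup V] [Module ℂ V]

/-- The projection of the standard module to its part of degree zero. -/
def stdProjZero (r : ℕ) (V : Type*) [AddCommGroup V] [Module ℂ V] : Module.End ℂ (Std r V) :=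
  TensorProduct.map (MvPolynomial.homogeneousComponent 0) (LinearMap.id : V →ₗ[ℂ] V)

theorem stdProjZero_eq_self {q : Std r V} (h : q ∈ stdDeg V 0) : stdProjZero r V q = q := by
  have : stdDeg V 0 ≤ LinearMap.eqLocus (stdProjZero r V) LinearMap.id := by
    refine stdDeg_le fun a ha v => ?_
    change stdTmul (MvPolynomial.homogeneousComponent 0 (MvPolynomial.monomial a 1)) v = _
    rw [MvPolynomial.homogeneousComponent_of_mem (MvPolynomial.isHomogeneous_monomial _ ha)]
    simp
  exact this h

theorem stdProjZero_eq_zero {m : ℕ} {q : Std r V} (h : q ∈ stdDeg V (m + 1)) :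
    stdProjZero r V q = 0 := by
  have : stdDeg V (m + 1) ≤ LinearMap.ker (stdProjZero r V) := by
    refine stdDeg_le fun a ha v => ?_
    change stdTmul (MvPolynomial.homogeneousComponent 0 (MvPolynomial.monomial a 1)) v = _
    rw [MvPolynomial.homogeneousComponent_of_mem (MvPolynomial.isHomogeneous_monomial _ ha),
      if_neg (Nat.succ_ne_zero m).symm]
    exact TensorProduct.zero_tmul _ v
  exact this h

/-- The projection of `K` to `K_0^0`. -/
def projZero (r : ℕ) (V : Type*) [AddCommGroup V] [Module ℂ V] : Module.End ℂ (KMod r V) :=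
  TensorProduct.map (stdProjZero r V) (GradedAlgebra.proj (fun l => ⋀[ℂ]^l (Fin r → ℂ)) 0)

theorem projZero_tmul (p : Std r V) (ω : Spinor r) : projZero r V (p ⊗ₜ ω) =
    stdProjZero r V p ⊗ₜ[ℂ] GradedAlgebra.proj (fun l => ⋀[ℂ]^l (Fin r → ℂ)) 0 ω := rfl

theorem projZero_eq_self {θ : KMod r V} (h : θ ∈ bideg V 0 0) : projZero r V θ = θ := by
  have : bideg V 0 0 ≤ LinearMap.eqLocus (projZero r V) LinearMap.id :=
    bideg_le fun p hp ω hω => by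
      rw [LinearMap.mem_eqLocus, projZero_tmul, stdProjZero_eq_self hp, GradedAlgebra.proj_apply,
        DirectSum.decompose_of_mem_same (fun l => ⋀[ℂ]^l (Fin r → ℂ)) hω]
      rfl
  exact this h

theorem projZero_eq_zero {m l : ℕ} (hml : m + l ≠ 0) {θ : KMod r V} (h : θ ∈ bideg V m l) :
    projZero r V θ = 0 := by
  have : bideg V m l ≤ LinearMap.ker (projZero r V) :=
    bideg_le fun p hp ω hω => by
      rw [LinearMap.mem_ker, projZero_tmul]
      cases m with
      | zero =>
        rw [GradedAlgebra.proj_apply, DirectSum.decompose_of_mem_ne (fun l => ⋀[ℂ]^l (Fin r → ℂ)) hω (by omega),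
          TensorProduct.tmul_zero]
      | succ m => rw [stdProjZero_eq_zero hp, TensorProduct.zero_tmul]
  exact this h

theorem projZero_mem_bideg {m l : ℕ} {θ : KMod r V} (h : θ ∈ bideg V m l) :
    projZero r V θ ∈ bideg V m l := by
  by_cases hml : m + l = 0
  · obtain ⟨rfl, rfl⟩ : m = 0 ∧ l = 0 := by omega
    rwa [projZero_eq_self h]
  · rw [projZero_eq_zero hml h]
    exact Submodule.zero_mem _

theorem projZero_mem (θ : KMod r V) : projZero r V θ ∈ bideg V 0 0 := by
  have : (⊤ : Submodule ℂ (KMod r V)) ≤ (bideg V 0 0).comap (projZero r V) := by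
    rw [← iSup_bideg]
    refine iSup_le fun i θ h => ?_
    rw [Submodule.mem_comap]
    by_cases hi : i.1 + i.2 = 0
    · have := projZero_mem_bideg h
      rwa [(by omega : i.1 = 0), (by omega : i.2 = 0)] at this
    · rw [projZero_eq_zero hi h]
      exact Submodule.zero_mem _
  exact this trivial

theorem projZero_projZero (θ : KMod r V) : projZero r V (projZero r V θ) = projZero r V θ :=
  projZero_eq_self (projZero_mem θ)

/-- A linear map that preserves the bigrading commutes with the projection to `K_0^0`. -/
theorem projZero_comm {f : Module.End ℂ (KMod r V)} (hf : ∀ m l, ∀ θ ∈ bideg V m l, f θ ∈ bideg V m l)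
    (θ : KMod r V) : projZero r V (f θ) = f (projZero r V θ) := by
  have : projZero r V ∘ₗ f = f ∘ₗ projZero r V := by
    refine bideg_ext fun m l θ h => ?_
    simp only [LinearMap.comp_apply]
    by_cases hml : m + l = 0
    · obtain ⟨rfl, rfl⟩ : m = 0 ∧ l = 0 := by omega
      rw [projZero_eq_self h, projZero_eq_self (hf _ _ _ h)]
    · rw [projZero_eq_zero hml h, projZero_eq_zero hml (hf _ _ _ h), map_zero]
  exact LinearMap.congr_fun this θ

theorem projZero_E2minus (θ : KMod r V) : projZero r V (RootDatum.E2minus r V θ) = 0 := by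
  have : projZero r V ∘ₗ RootDatum.E2minus r V = 0 := by
    refine bideg_ext fun m l θ h => ?_
    simp only [LinearMap.comp_apply, LinearMap.zero_apply]
    cases l with
    | zero => rw [E2minus_eq_zero h, map_zero]
    | succ l => exact projZero_eq_zero (by omega) (E2minus_mem h)
  exact LinearMap.congr_fun this θ

namespace RootDatum

variable (c : Φ.R → ℂ) (τ : Representation ℂ Φ.W V)

theorem projZero_E2plus (θ : KMod r V) : projZero r V (Φ.E2plus c τ θ) = 0 := by
  have : projZero r V ∘ₗ Φ.E2plus c τ = 0 := by
    refine bideg_ext fun m l θ h => ?_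
    simp only [LinearMap.comp_apply, LinearMap.zero_apply]
    cases m with
    | zero => rw [E2plus_eq_zero c τ h, map_zero]
    | succ m => exact projZero_eq_zero (by omega) (E2plus_mem c τ h)
  exact LinearMap.congr_fun this θ

/-- Neither E_2^+ nor E_2^- can reach K_0^0: the first raises l and the second raises m. So H_c is
never invertible on K_0^0, which is why P_0 has to be added wherever an inverse is needed. -/
theorem projZero_Hop (θ : KMod r V) : projZero r V (Hop c τ θ) = 0 := by
  rw [Hop_apply, map_add, projZero_E2minus, projZero_E2plus, add_zero]

theorem E2plus_projZero (θ : KMod r V) : Φ.E2plus c τ (projZero r V θ) = 0 :=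
  E2plus_eq_zero c τ (projZero_mem θ)

theorem kRep_projZero (w : Φ.W) (θ : KMod r V) :
    Φ.kRep τ w (projZero r V θ) = projZero r V (Φ.kRep τ w θ) :=
  (projZero_comm (fun _ _ _ h => kRep_mem τ w h) θ).symm

theorem projZero_mem_AHarm (θ : KMod r V) : projZero r V θ ∈ Φ.AHarm c τ :=
  bideg_zero_le_AHarm c τ 0 (projZero_mem θ)

/-! ### Injectivity of the anticommutator -/

theorem iSup_eigenspace_Hop_zero :
    ⨆ n : ℕ, Module.End.eigenspace (Hop 0 τ) (n : ℂ) = ⊤ := by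
  rw [eq_top_iff, ← iSup_bideg]
  refine iSup_le fun i => le_iSup_of_le (i.1 + i.2) fun θ h => ?_
  rw [Module.End.mem_eigenspace_iff, Hop_zero_eq τ h]

/-- The eigenspaces for natural numbers already span K, and eigenspaces for distinct eigenvalues are
independent, so no other eigenvalue is possible. -/
theorem Hop_zero_eigenvalue {μ : ℂ} {θ : KMod r V} (h : Hop 0 τ θ = μ • θ) (hθ : θ ≠ 0) :
    ∃ n : ℕ, μ = n := by
  by_contra hμ
  push Not at hμ
  apply hθ
  have hd := Module.End.eigenspaces_iSupIndep (Hop 0 τ) μ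
  have htop : (⊤ : Submodule ℂ (KMod r V)) ≤
      ⨆ ν, ⨆ (_ : ν ≠ μ), Module.End.eigenspace (Hop 0 τ) ν := by
    rw [← iSup_eigenspace_Hop_zero τ]
    exact iSup_le fun n => le_iSup₂_of_le (n : ℂ) (hμ n).symm le_rfl
  exact Submodule.disjoint_def.1 hd θ (Module.End.mem_eigenspace_iff.2 h) (htop trivial)

theorem eq_zero_of_Hop_zero {θ : KMod r V} (h : Hop 0 τ θ = 0) (h0 : projZero r V θ = 0) :
    θ = 0 := by
  have hd := Module.End.eigenspaces_iSupIndep (Hop 0 τ) 0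
  refine Submodule.disjoint_def.1 hd θ (Module.End.mem_eigenspace_iff.2 (by rw [h, zero_smul])) ?_
  -- Outside K_0^0 the total degree is positive, so removing the K_0^0-component leaves a vector in
  -- the sum of the eigenspaces with nonzero eigenvalue, which meets ker H_0 only in zero.
  have key : ∀ θ : KMod r V, θ - projZero r V θ ∈
      ⨆ ν, ⨆ (_ : ν ≠ 0), Module.End.eigenspace (Hop 0 τ) ν := by
    intro θ
    have hθ : θ ∈ ⨆ i : ℕ × ℕ, bideg (r := r) V i.1 i.2 := by rw [iSup_bideg]; trivial
    refine Submodule.iSup_induction _ (motive := fun θ => θ - projZero r V θ ∈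
      ⨆ ν, ⨆ (_ : ν ≠ 0), Module.End.eigenspace (Hop 0 τ) ν) hθ ?_ ?_ ?_
    · intro i θ h
      by_cases hi : i.1 + i.2 = 0
      · rw [(by omega : i.1 = 0), (by omega : i.2 = 0)] at h
        rw [projZero_eq_self h, sub_self]
        exact Submodule.zero_mem _
      · rw [projZero_eq_zero hi h, sub_zero]
        refine Submodule.mem_iSup_of_mem ((i.1 + i.2 : ℕ) : ℂ) (Submodule.mem_iSup_of_mem
          (by exact_mod_cast hi) ?_)
        rw [Module.End.mem_eigenspace_iff, Hop_zero_eq τ h]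
    · rw [map_zero, sub_zero]
      exact Submodule.zero_mem _
    · intro x y hx hy
      rw [map_add, add_sub_add_comm]
      exact Submodule.add_mem _ hx hy
  have := key θ
  rwa [h0, sub_zero] at this

end RootDatum

end

/-! ### The consequence of genericity for H_c. -/

namespace RootDatum

variable {V : Type u} [AddCommGroup V] [Module ℂ V]

/-- The only non-negative integer of the form `N_c(τ) - N_c(σ)`, for an irreducible `σ`,
is zero. -/
def IsRegularParam (c : Φ.R → ℂ) (τ : Representation ℂ Φ.W V) : Prop :=
  ∀ (S : Type u) [AddCommGroup S] [Module ℂ S] [FiniteDimensional ℂ S]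
    (σ : Representation ℂ Φ.W S), σ.IsIrreducible → ∀ k : ℕ, Nc c τ - Nc c σ = k → k = 0

variable {c : Φ.R → ℂ} {τ : Representation ℂ Φ.W V}

/-- At c = 0 all scalars N vanish, so `IsGeneric` fails as soon as W has an irreducible
representation other than τ. The weaker condition `IsRegularParam` is all that the arguments need,
and it lets the parameters 0 and c play symmetric roles. -/
theorem isRegularParam_zero : IsRegularParam 0 τ := by
  intro S _ _ _ σ _ k hk
  simpa [Nc, eq_comm] using hk

theorem Nc_eq_of_equiv {S : Type*} [AddCommGroup S] [Module ℂ S] {σ : Representation ℂ Φ.W S}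
    (e : τ.Equiv σ) : Nc c τ = Nc c σ := by
  have h : ∀ w, σ w = e.toLinearEquiv.conj (τ w) := by
    intro w
    refine LinearMap.ext fun x => ?_
    obtain ⟨y, rfl⟩ := e.toLinearEquiv.surjective x
    rw [LinearEquiv.conj_apply_apply, LinearEquiv.symm_apply_apply]
    exact (LinearMap.congr_fun (e.isIntertwining' w) y).symm
  rw [Nc, Nc, e.toLinearEquiv.finrank_eq]
  simp only [h, LinearMap.trace_conj']

theorem IsGeneric.isRegularParam (h : Φ.IsGeneric c τ) : IsRegularParam c τ := by
  intro S _ _ _ σ hσ k hk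
  by_cases he : IsEmpty (τ.Equiv σ)
  · exact absurd hk (h S σ hσ he k)
  · rw [not_isEmpty_iff] at he
    obtain ⟨e⟩ := he
    rw [Nc_eq_of_equiv e, sub_self] at hk
    exact_mod_cast hk.symm

/-- The kernel of H_c + k is W-stable, so a nonzero element without K_0^0-component would yield an
irreducible σ of such elements. On σ the element ∑ c_α s_α is the scalar N_c(σ), so H_0 acts by
N_c(τ) - N_c(σ) - k. This is a total degree n, whence N_c(τ) - N_c(σ) = n + k is natural, and
regularity forces n = k = 0; but degree zero means K_0^0, which was excluded. -/
theorem eq_zero_of_Hop_add [FiniteDimensional ℂ V] [τ.IsIrreducible] (hc : Φ.IsParam c)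
    (hreg : IsRegularParam c τ) (k : ℕ) {θ : KMod r V}
    (h : Hop c τ θ + (k : ℂ) • θ = 0) (h0 : projZero r V θ = 0) : θ = 0 := by
  by_contra hθ
  have hmem : θ ∈ ⨆ i : ℕ × ℕ, bideg (r := r) V i.1 i.2 := by rw [iSup_bideg]; trivial
  obtain ⟨s, hs⟩ := Submodule.mem_iSup_iff_exists_finset.1 hmem
  rw [← Finset.sup_eq_iSup] at hs
  -- Cutting down to the finitely many bidegrees that support θ makes the space finite-dimensional
  -- while keeping it W-stable.
  let N : Submodule ℂ (KMod r V) := s.sup (fun i : ℕ × ℕ => bideg (r := r) V i.1 i.2) ⊓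
    (LinearMap.ker (Hop c τ + (k : ℂ) • LinearMap.id) ⊓ LinearMap.ker (projZero r V))
  have hN : ∀ w, ∀ x ∈ N, Φ.kRep τ w x ∈ N := by
    rintro w x ⟨hx1, hx2, hx3⟩
    refine ⟨?_, ?_, ?_⟩
    · have : s.sup (fun i : ℕ × ℕ => bideg (r := r) V i.1 i.2) ≤
          (s.sup (fun i : ℕ × ℕ => bideg (r := r) V i.1 i.2)).comap (Φ.kRep τ w) :=
        Finset.sup_le fun i hi x hx =>
          Finset.le_sup (f := fun i : ℕ × ℕ => bideg (r := r) V i.1 i.2) hi (kRep_mem τ w hx)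
      exact this hx1
    · change Hop c τ (Φ.kRep τ w x) + (k : ℂ) • Φ.kRep τ w x = 0
      have hx2 : Hop c τ x + (k : ℂ) • x = 0 := hx2
      rw [← kRep_Hop τ hc, ← map_smul, ← map_add, hx2, map_zero]
    · change projZero r V (Φ.kRep τ w x) = 0
      rw [← kRep_projZero, LinearMap.mem_ker.1 hx3, map_zero]
  have hNf : FiniteDimensional ℂ N := Submodule.finiteDimensional_inf_left _ _
  have hNne : N ≠ ⊥ := by
    intro hb
    have : θ ∈ N := ⟨hs, h, h0⟩
    rw [hb] at this
    exact hθ ((Submodule.mem_bot ℂ).1 this)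
  obtain ⟨S, hSN, hS⟩ := exists_irreducible_subrepresentation (Φ.kRep τ) N hN hNne
  have hSf : FiniteDimensional ℂ S.toSubmodule := Submodule.finiteDimensional_of_le hSN
  obtain ⟨v, hv⟩ : ∃ v : S.toSubmodule, v ≠ 0 := by
    by_contra hne
    push Not at hne
    apply (bot_ne_top : (⊥ : Subrepresentation S.toRepresentation) ≠ ⊤)
    apply Subrepresentation.toSubmodule_injective
    exact Submodule.ext fun x => by rw [hne x]; simp
  obtain ⟨-, hv2, hv3⟩ := hSN v.2
  have hv2 : Hop c τ v + (k : ℂ) • (v : KMod r V) = 0 := hv2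
  have hv' : (v : KMod r V) ≠ 0 := fun h => hv (Subtype.ext h)
  have hΩ := congrArg Subtype.val (Nc_spec hc S.toRepresentation v)
  rw [AddSubmonoidClass.coe_finsetSum] at hΩ
  have hΩ : ∑ α ∈ Φ.Pos, c α • Φ.kRep τ (Φ.s α) (v : KMod r V) =
    Nc c S.toRepresentation • (v : KMod r V) := hΩ
  rw [Hop_eq τ hc, hΩ] at hv2
  have hH : Hop 0 τ v = (Nc c τ - Nc c S.toRepresentation - k) • (v : KMod r V) := by
    linear_combination (norm := module) hv2
  obtain ⟨n, hn⟩ := Hop_zero_eigenvalue τ hH hv'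
  have hnk := hreg _ S.toRepresentation hS (n + k) (by push_cast; linear_combination hn)
  have hn0 : n = 0 := by omega
  rw [hn, hn0, Nat.cast_zero, zero_smul] at hH
  exact hv' (eq_zero_of_Hop_zero τ hH (LinearMap.mem_ker.1 hv3))

end RootDatum

end DunklHowe
end

/-! ### The Taylor expansion by Dunkl operators and the isomorphism for E_2^+. -/

noncomputable section

namespace DunklHowe

/-- An injective endomorphism is surjective on an invariant finite-dimensional subspace. -/
theorem exists_mem_apply_eq {K : Type*} [AddCommGroup K] [Module ℂ K] {f : Module.End ℂ K}
    (hf : Function.Injective f) {N : Submodule ℂ K} [FiniteDimensional ℂ N]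
    (hN : ∀ x ∈ N, f x ∈ N) {y : K} (hy : y ∈ N) : ∃ x ∈ N, f x = y := by
  have hinj : Function.Injective (f.restrict hN) := fun a b h =>
    Subtype.ext (hf (congrArg Subtype.val h))
  obtain ⟨x, hx⟩ := LinearMap.injective_iff_surjective.1 hinj ⟨y, hy⟩
  exact ⟨x, x.2, congrArg Subtype.val hx⟩

theorem mem_of_apply_mem {K : Type*} [AddCommGroup K] [Module ℂ K] {f : Module.End ℂ K}
    (hf : Function.Injective f) {N : Submodule ℂ K} [FiniteDimensional ℂ N]
    (hN : ∀ x ∈ N, f x ∈ N) {x : K} (hx : f x ∈ N) : x ∈ N := by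
  obtain ⟨x', hx', h⟩ := exists_mem_apply_eq hf hN hx
  rwa [← hf h]

variable {r : ℕ} {Φ : RootDatum r}

section

variable {V : Type*} [AddCommGroup V] [Module ℂ V]

/-- The linear map that is given in degree `m` by the `m`-th member of a family. -/
def assemble (F : ℕ → Module.End ℂ (Std r V)) : Module.End ℂ (Std r V) :=
  TensorProduct.lift (R := ℂ) (M := MvPolynomial (Fin r) ℂ) (N := V) (P₂ := Std r V)
    ((MvPolynomial.basisMonomials (Fin r) ℂ).constr ℂ fun a =>
      F a.degree ∘ₗ TensorProduct.mk ℂ (MvPolynomial (Fin r) ℂ) V (MvPolynomial.monomial a 1))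

theorem assemble_apply (F : ℕ → Module.End ℂ (Std r V)) {m : ℕ} {q : Std r V}
    (hq : q ∈ stdDeg V m) : assemble F q = F m q := by
  have : stdDeg V m ≤ LinearMap.eqLocus (assemble F) (F m) := by
    refine stdDeg_le fun a ha v => ?_
    have h := (MvPolynomial.basisMonomials (Fin r) ℂ).constr_basis ℂ (fun a =>
      F a.degree ∘ₗ TensorProduct.mk ℂ (MvPolynomial (Fin r) ℂ) V (MvPolynomial.monomial a 1)) a
    rw [MvPolynomial.coe_basisMonomials] at h
    have h' := LinearMap.congr_fun h v
    rw [ha] at h'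
    exact h'
  exact this hq

theorem stdProjZero_mem (q : Std r V) : stdProjZero r V q ∈ stdDeg V 0 := by
  have : (⊤ : Submodule ℂ (Std r V)) ≤ (stdDeg V 0).comap (stdProjZero r V) := by
    rw [← iSup_stdDeg]
    refine iSup_le fun m q hq => ?_
    rw [Submodule.mem_comap]
    cases m with
    | zero => rwa [stdProjZero_eq_self hq]
    | succ m => rw [stdProjZero_eq_zero hq]; exact Submodule.zero_mem _
  exact this trivial

namespace RootDatum

variable (c : Φ.R → ℂ) (τ : Representation ℂ Φ.W V)

theorem stdW_stdProjZero (w : Φ.W) (q : Std r V) :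
    Φ.stdW τ w (stdProjZero r V q) = stdProjZero r V (Φ.stdW τ w q) := by
  have : Φ.stdW τ w ∘ₗ stdProjZero r V = stdProjZero r V ∘ₗ Φ.stdW τ w := by
    refine stdDeg_ext fun m q hq => ?_
    simp only [LinearMap.comp_apply]
    cases m with
    | zero => rw [stdProjZero_eq_self hq, stdProjZero_eq_self (stdW_mem τ w hq)]
    | succ m => rw [stdProjZero_eq_zero hq, stdProjZero_eq_zero (stdW_mem τ w hq), map_zero]
  exact LinearMap.congr_fun this q

/-- The part of degree `m` of the Taylor expansion by Dunkl operators. -/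
def taylorPart : ℕ → Module.End ℂ (Std r V)
  | 0 => stdProjZero r V
  -- Modelled on Euler's identity (m + 1) f = ∑ x_i ∂_i f for f homogeneous of degree m + 1, with
  -- ∂_i replaced by the Dunkl operator.
  | m + 1 => (1 / (m + 1 : ℂ)) •
      ∑ i, stdX V (basisVec i) * (taylorPart m * Φ.stdY c τ (basisVec i))

theorem taylorPart_succ (m : ℕ) (q : Std r V) : taylorPart c τ (m + 1) q = (1 / (m + 1 : ℂ)) •
    ∑ i, stdX V (basisVec i) (taylorPart c τ m (Φ.stdY c τ (basisVec i) q)) := by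
  simp [taylorPart, LinearMap.sum_apply]

theorem taylorPart_mem {m : ℕ} {q : Std r V} (hq : q ∈ stdDeg V m) :
    taylorPart c τ m q ∈ stdDeg V m := by
  induction m generalizing q with
  | zero => exact stdProjZero_mem q
  | succ m ih =>
    rw [taylorPart_succ]
    exact Submodule.smul_mem _ _ (Submodule.sum_mem _ fun i _ =>
      stdX_mem _ (ih (stdY_mem c τ _ hq)))

/-- Passing ∂_j through ∑ x_i leaves one copy of the wanted term. By induction, and because the
Dunkl operators commute, the remaining sum is again a Taylor sum, for y_j q, and supplies m + 1
further copies. The total m + 2 is what the normalisation divides by. -/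
theorem stdY_taylorPart {c : Φ.R → ℂ} (hc : Φ.IsParam c) (m : ℕ) (j : Fin r) (q : Std r V) :
    Φ.stdY 0 τ (basisVec j) (taylorPart c τ (m + 1) q) =
      taylorPart c τ m (Φ.stdY c τ (basisVec j) q) := by
  have h : ∀ (i : Fin r) (q : Std r V), Φ.stdY 0 τ (basisVec j) (stdX V (basisVec i) q) =
      stdX V (basisVec i) (Φ.stdY 0 τ (basisVec j) q) + if i = j then q else 0 := by
    intro i q
    rw [stdY_stdX, basisVec_dotProduct]
    split_ifs <;> simp
  induction m generalizing q with
  | zero =>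
    rw [taylorPart_succ]
    simp only [map_smul, map_sum, h]
    have h0 : ∀ q, Φ.stdY 0 τ (basisVec j) (taylorPart c τ 0 q) = 0 := fun q =>
      stdY_eq_zero 0 τ _ (stdProjZero_mem q)
    simp [h0]
  | succ m ih =>
    rw [taylorPart_succ]
    simp only [map_smul, map_sum, h, ih, stdY_stdY hc (basisVec j), Finset.sum_add_distrib,
      Finset.sum_ite_eq', Finset.mem_univ, if_true]
    have h1 := taylorPart_succ c τ m (Φ.stdY c τ (basisVec j) q)
    have hm : (m + 1 : ℂ) ≠ 0 := Nat.cast_add_one_ne_zero m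
    have hm' : ((m + 1 : ℕ) + 1 : ℂ) ≠ 0 := Nat.cast_add_one_ne_zero (m + 1)
    have h2 : ∑ i, stdX V (basisVec i) (taylorPart c τ m (Φ.stdY c τ (basisVec i)
        (Φ.stdY c τ (basisVec j) q))) =
        (m + 1 : ℂ) • taylorPart c τ (m + 1) (Φ.stdY c τ (basisVec j) q) := by
      rw [h1, smul_smul, mul_one_div_cancel hm, one_smul]
    rw [h2]
    nth_rewrite 2 [← one_smul ℂ (taylorPart c τ (m + 1) (Φ.stdY c τ (basisVec j) q))]
    rw [← add_smul, smul_smul]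
    push_cast at hm' ⊢
    rw [one_div_mul_cancel hm', one_smul]

theorem stdW_taylorPart {c : Φ.R → ℂ} (hc : Φ.IsParam c) (w : Φ.W) (m : ℕ) (q : Std r V) :
    Φ.stdW τ w (taylorPart c τ m q) = taylorPart c τ m (Φ.stdW τ w q) := by
  induction m generalizing q with
  | zero => exact stdW_stdProjZero τ w q
  | succ m ih =>
    -- The Taylor sum is bilinear in the pair (x_i, y_i), so the orthonormal basis may be replaced
    -- by its image under w.
    have hB := sum_hRep_basisVec ((LinearMap.mul ℂ (Module.End ℂ (Std r V))).compl₁₂ (stdXL r V)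
      (LinearMap.mulLeft ℂ (taylorPart c τ m) ∘ₗ stdYL c τ)) w
    simp only [LinearMap.compl₁₂_apply, LinearMap.mul_apply', LinearMap.comp_apply,
      LinearMap.mulLeft_apply, stdXL_apply, stdYL_apply] at hB
    have hB := LinearMap.congr_fun hB (Φ.stdW τ w q)
    simp only [LinearMap.sum_apply, Module.End.mul_apply] at hB
    rw [taylorPart_succ, taylorPart_succ, ← hB, map_smul, map_sum]
    congr 1
    refine Finset.sum_congr rfl fun i _ => ?_
    have e1 := fun q => LinearMap.congr_fun (stdW_mul_stdX τ w (basisVec i)) q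
    have e2 := fun q => LinearMap.congr_fun (stdW_mul_stdY τ hc w (basisVec i)) q
    simp only [Module.End.mul_apply] at e1 e2
    rw [e1, ih, e2]

/-- The Taylor expansion by Dunkl operators, a map from `M_c(τ)` to `M_0(τ)`. -/
def taylor : Module.End ℂ (Std r V) := assemble (taylorPart c τ)

theorem taylor_mem {m : ℕ} {q : Std r V} (hq : q ∈ stdDeg V m) : taylor c τ q ∈ stdDeg V m := by
  rw [taylor, assemble_apply _ hq]
  exact taylorPart_mem c τ hq

theorem stdY_taylor {c : Φ.R → ℂ} (hc : Φ.IsParam c) (j : Fin r) (q : Std r V) :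
    Φ.stdY 0 τ (basisVec j) (taylor c τ q) = taylor c τ (Φ.stdY c τ (basisVec j) q) := by
  have : Φ.stdY 0 τ (basisVec j) ∘ₗ taylor c τ = taylor c τ ∘ₗ Φ.stdY c τ (basisVec j) := by
    refine stdDeg_ext fun m q hq => ?_
    simp only [LinearMap.comp_apply]
    cases m with
    | zero =>
      rw [stdY_eq_zero c τ _ hq, map_zero, stdY_eq_zero 0 τ _ (taylor_mem c τ hq)]
    | succ m =>
      rw [taylor, assemble_apply _ hq, assemble_apply _ (stdY_mem c τ _ hq), stdY_taylorPart τ hc]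
  exact LinearMap.congr_fun this q

theorem stdW_taylor {c : Φ.R → ℂ} (hc : Φ.IsParam c) (w : Φ.W) (q : Std r V) :
    Φ.stdW τ w (taylor c τ q) = taylor c τ (Φ.stdW τ w q) := by
  have : Φ.stdW τ w ∘ₗ taylor c τ = taylor c τ ∘ₗ Φ.stdW τ w := by
    refine stdDeg_ext fun m q hq => ?_
    simp only [LinearMap.comp_apply]
    rw [taylor, assemble_apply _ hq, assemble_apply _ (stdW_mem τ w hq), stdW_taylorPart τ hc]
  exact LinearMap.congr_fun this q

theorem stdProjZero_taylor (q : Std r V) :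
    stdProjZero r V (taylor c τ q) = stdProjZero r V q := by
  have : stdProjZero r V ∘ₗ taylor c τ = stdProjZero r V := by
    refine stdDeg_ext fun m q hq => ?_
    simp only [LinearMap.comp_apply]
    cases m with
    | zero =>
      rw [taylor, assemble_apply _ hq]
      exact stdProjZero_eq_self (stdProjZero_mem q)
    | succ m => rw [stdProjZero_eq_zero hq, stdProjZero_eq_zero (taylor_mem c τ hq)]
  exact LinearMap.congr_fun this q

end RootDatum

end

namespace RootDatum

variable {V : Type u} [AddCommGroup V] [Module ℂ V] {c : Φ.R → ℂ} {τ : Representation ℂ Φ.W V}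

/-- Embeds M_c(τ) into K as exterior degree zero, so that the injectivity statement for H_c can be
applied to singular vectors. -/
theorem tmul_one_injective : Function.Injective fun q : Std r V => q ⊗ₜ[ℂ] (1 : Spinor r) := by
  intro q q' h
  have := congrArg (fun t => TensorProduct.rid ℂ (Std r V) (TensorProduct.map LinearMap.id
    (ExteriorAlgebra.algebraMapInv (R := ℂ) (M := Fin r → ℂ)).toLinearMap t)) h
  simpa using this

variable [FiniteDimensional ℂ V] [τ.IsIrreducible]

/-- The standard module has no vectors of positive degree that are killed by all `y`. -/
theorem eq_zero_of_stdY (hc : Φ.IsParam c) (hreg : IsRegularParam c τ) {q : Std r V}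
    (h : ∀ i, Φ.stdY c τ (basisVec i) q = 0) (h0 : stdProjZero r V q = 0) : q = 0 := by
  apply tmul_one_injective
  change q ⊗ₜ[ℂ] (1 : Spinor r) = 0 ⊗ₜ[ℂ] (1 : Spinor r)
  rw [TensorProduct.zero_tmul]
  -- E_2^+ kills q ⊗ 1 because every y_i kills q, and E_2^- kills it because contractions kill 1;
  -- hence H_c(q ⊗ 1) = 0.
  refine eq_zero_of_Hop_add hc hreg 0 ?_ ?_
  · rw [Hop_apply, E2plus_tmul, E2minus_tmul]
    simp [h, contr_one]
  · rw [projZero_tmul, h0, TensorProduct.zero_tmul]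

/-- If q lies in the kernel, so does each y_i q, which has lower degree and hence vanishes by
induction. The constant term of q is preserved by the map, so it vanishes too, and q is a singular
vector without constant term. -/
theorem taylor_injective (hc : Φ.IsParam c) (hreg : IsRegularParam c τ) :
    Function.Injective (taylor c τ) := by
  -- The filtration by degree less than N, so that the induction covers inhomogeneous vectors and
  -- starts from the zero space.
  let D : ℕ → Submodule ℂ (Std r V) := fun N => ⨆ m, ⨆ (_ : m < N), stdDeg V m
  have hD : ∀ N j, ∀ q ∈ D (N + 1), Φ.stdY c τ (basisVec j) q ∈ D N := by
    intro N j
    have : D (N + 1) ≤ (D N).comap (Φ.stdY c τ (basisVec j)) := by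
      refine iSup₂_le fun m hm q hq => ?_
      rw [Submodule.mem_comap]
      cases m with
      | zero => rw [stdY_eq_zero c τ _ hq]; exact Submodule.zero_mem _
      | succ m =>
        exact Submodule.mem_iSup_of_mem m (Submodule.mem_iSup_of_mem (by omega)
          (stdY_mem c τ _ hq))
    exact this
  have key : ∀ N, ∀ q ∈ D N, taylor c τ q = 0 → q = 0 := by
    intro N
    induction N with
    | zero =>
      intro q hq _
      simpa [D] using hq
    | succ N ih =>
      intro q hq h
      refine eq_zero_of_stdY hc hreg (fun i => ih _ (hD N i q hq) ?_) ?_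
      · rw [← stdY_taylor τ hc, h, map_zero]
      · rw [← stdProjZero_taylor c τ, h, map_zero]
  refine (injective_iff_map_eq_zero _).2 fun q h => ?_
  have hq : q ∈ ⨆ m, stdDeg (r := r) V m := by rw [iSup_stdDeg]; trivial
  obtain ⟨s, hs⟩ := Submodule.mem_iSup_iff_exists_finset.1 hq
  refine key (s.sup id + 1) q ?_ h
  refine (iSup₂_le fun m hm => ?_ : _ ≤ D (s.sup id + 1)) hs
  exact le_iSup₂_of_le m (Nat.lt_succ_of_le (Finset.le_sup (f := id) hm)) le_rfl

theorem taylor_bijective (hc : Φ.IsParam c) (hreg : IsRegularParam c τ) :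
    Function.Bijective (taylor c τ) := by
  have hinj := taylor_injective hc hreg
  refine ⟨hinj, ?_⟩
  rw [← LinearMap.range_eq_top, eq_top_iff, ← iSup_stdDeg]
  refine iSup_le fun m q hq => ?_
  obtain ⟨x, -, hx⟩ := exists_mem_apply_eq hinj (fun x hx => taylor_mem c τ hx) hq
  exact ⟨x, hx⟩

/-- The isomorphism from `K_c(τ)` to `K_0(τ)` that is induced by the Taylor expansion. -/
def taylorEquiv (hc : Φ.IsParam c) (hreg : IsRegularParam c τ) : KMod r V ≃ₗ[ℂ] KMod r V :=
  TensorProduct.congr (LinearEquiv.ofBijective (taylor c τ) (taylor_bijective hc hreg))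
    (LinearEquiv.refl ℂ _)

variable (hc : Φ.IsParam c) (hreg : IsRegularParam c τ)

theorem taylorEquiv_tmul (q : Std r V) (ω : Spinor r) :
    taylorEquiv hc hreg (q ⊗ₜ ω) = taylor c τ q ⊗ₜ[ℂ] ω := rfl

theorem taylorEquiv_E2plus (θ : KMod r V) :
    taylorEquiv hc hreg (Φ.E2plus c τ θ) = Φ.E2plus 0 τ (taylorEquiv hc hreg θ) := by
  have : (taylorEquiv hc hreg).toLinearMap ∘ₗ Φ.E2plus c τ =
      Φ.E2plus 0 τ ∘ₗ (taylorEquiv hc hreg).toLinearMap := by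
    refine TensorProduct.ext' fun q ω => ?_
    simp only [LinearMap.comp_apply, LinearEquiv.coe_coe, taylorEquiv_tmul, E2plus_tmul, map_sum,
      stdY_taylor τ hc]
  exact LinearMap.congr_fun this θ

theorem taylorEquiv_negE3 (θ : KMod r V) :
    taylorEquiv hc hreg (negE3 c τ θ) = negE3 0 τ (taylorEquiv hc hreg θ) := by
  have : (taylorEquiv hc hreg).toLinearMap ∘ₗ negE3 c τ =
      negE3 0 τ ∘ₗ (taylorEquiv hc hreg).toLinearMap := by
    refine TensorProduct.ext' fun q ω => ?_
    simp only [LinearMap.comp_apply, LinearEquiv.coe_coe, taylorEquiv_tmul, negE3_tmul, map_sum,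
      stdY_taylor τ hc]
  exact LinearMap.congr_fun this θ

theorem taylorEquiv_E1minus (θ : KMod r V) :
    taylorEquiv hc hreg (Φ.E1minus c τ θ) = Φ.E1minus 0 τ (taylorEquiv hc hreg θ) := by
  have : (taylorEquiv hc hreg).toLinearMap ∘ₗ Φ.E1minus c τ =
      Φ.E1minus 0 τ ∘ₗ (taylorEquiv hc hreg).toLinearMap := by
    refine TensorProduct.ext' fun q ω => ?_
    simp only [LinearMap.comp_apply, LinearEquiv.coe_coe, taylorEquiv_tmul, E1minus_tmul, map_smul,
      lapl, LinearMap.sum_apply, Module.End.mul_apply, map_sum, stdY_taylor τ hc]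
  exact LinearMap.congr_fun this θ

theorem taylorEquiv_kRep (w : Φ.W) (θ : KMod r V) :
    taylorEquiv hc hreg (Φ.kRep τ w θ) = Φ.kRep τ w (taylorEquiv hc hreg θ) := by
  have : (taylorEquiv hc hreg).toLinearMap ∘ₗ Φ.kRep τ w =
      Φ.kRep τ w ∘ₗ (taylorEquiv hc hreg).toLinearMap := by
    refine TensorProduct.ext' fun q ω => ?_
    simp only [LinearMap.comp_apply, LinearEquiv.coe_coe, taylorEquiv_tmul, kRep_tmul,
      stdW_taylor τ hc]
  exact LinearMap.congr_fun this θ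

theorem taylorEquiv_mem {m l : ℕ} {θ : KMod r V} (h : θ ∈ bideg V m l) :
    taylorEquiv hc hreg θ ∈ bideg V m l := by
  have : bideg V m l ≤ (bideg V m l).comap (taylorEquiv hc hreg).toLinearMap :=
    bideg_le fun p hp ω hω => tmul_mem_bideg (taylor_mem c τ hp) hω
  exact this h

theorem taylorEquiv_mem_iff {m l : ℕ} {θ : KMod r V} :
    taylorEquiv hc hreg θ ∈ bideg V m l ↔ θ ∈ bideg V m l :=
  ⟨fun h => mem_of_apply_mem (f := (taylorEquiv hc hreg).toLinearMap)
    (taylorEquiv hc hreg).injective (fun _ hx => taylorEquiv_mem hc hreg hx) h,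
    taylorEquiv_mem hc hreg⟩

theorem taylorEquiv_mem_AHarm {θ : KMod r V} :
    taylorEquiv hc hreg θ ∈ Φ.AHarm 0 τ ↔ θ ∈ Φ.AHarm c τ := by
  rw [mem_AHarm, mem_AHarm, ← taylorEquiv_E1minus, ← taylorEquiv_negE3,
    LinearEquiv.map_eq_zero_iff, LinearEquiv.map_eq_zero_iff]

end RootDatum

end DunklHowe
end

/-! ### From isomorphisms for E_2^+ to isomorphisms for E_2^-. -/

noncomputable section

namespace DunklHowe

variable {r : ℕ} {Φ : RootDatum r}

namespace RootDatum

theorem isParam_zero : Φ.IsParam (0 : Φ.R → ℂ) := fun _ _ _ _ => rfl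

section

variable {V : Type*} [AddCommGroup V] [Module ℂ V] {c : Φ.R → ℂ} (τ : Representation ℂ Φ.W V)

theorem kRep_negE3 (hc : Φ.IsParam c) (w : Φ.W) (θ : KMod r V) :
    Φ.kRep τ w (negE3 c τ θ) = negE3 c τ (Φ.kRep τ w θ) :=
  kRep_sum τ (A := stdYL c τ) (B := contrL r) w (stdW_mul_stdY τ hc w) (spinRep_mul_contr w) θ

theorem kRep_E1minus (hc : Φ.IsParam c) (w : Φ.W) (θ : KMod r V) :
    Φ.kRep τ w (Φ.E1minus c τ θ) = Φ.E1minus c τ (Φ.kRep τ w θ) := by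
  have : Φ.kRep τ w ∘ₗ Φ.E1minus c τ = Φ.E1minus c τ ∘ₗ Φ.kRep τ w := by
    refine TensorProduct.ext' fun p ω => ?_
    have h := LinearMap.congr_fun (stdW_mul_lapl τ hc w) p
    simp only [Module.End.mul_apply] at h
    simp only [LinearMap.comp_apply, E1minus_tmul, map_smul, kRep_tmul, h]
  exact LinearMap.congr_fun this θ

theorem E2plus_mem_AHarm (hc : Φ.IsParam c) {θ : KMod r V} (h : θ ∈ Φ.AHarm c τ) :
    Φ.E2plus c τ θ ∈ Φ.AHarm c τ := by
  rw [mem_AHarm] at h ⊢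
  have := E2plus_negE3 τ hc θ
  rw [h.1, h.2, map_zero, zero_add, smul_zero] at this
  exact ⟨by rw [E1minus_E2plus τ hc, h.1, map_zero], this⟩

theorem E2minus_mem_AHarm (hc : Φ.IsParam c) {θ : KMod r V} (h : θ ∈ Φ.AHarm c τ) :
    E2minus r V θ ∈ Φ.AHarm c τ := by
  rw [mem_AHarm] at h ⊢
  have := negE3_E2minus (c := c) τ θ
  rw [h.2, map_zero, add_zero] at this
  exact ⟨by rw [E1minus_E2minus τ hc, h.1, h.2, map_zero, add_zero], this⟩

theorem E2minus_projZero (θ : KMod r V) : E2minus r V (projZero r V θ) = 0 :=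
  E2minus_eq_zero (projZero_mem θ)

/-- The map `E_2^- e E_2^+ + e E_2^+ E_2^-` that turns an isomorphism `e` of complexes for `E_2^+`
into one for `E_2^-`, completed by `e` on `K_0^0`. -/
def transfer (c : Φ.R → ℂ) (τ : Representation ℂ Φ.W V) (e : KMod r V ≃ₗ[ℂ] KMod r V) :
    Module.End ℂ (KMod r V) :=
  E2minus r V ∘ₗ e.toLinearMap ∘ₗ Φ.E2plus c τ + e.toLinearMap ∘ₗ Φ.E2plus c τ ∘ₗ E2minus r V +
    e.toLinearMap ∘ₗ projZero r V

variable (c) in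
theorem transfer_apply (e : KMod r V ≃ₗ[ℂ] KMod r V) (θ : KMod r V) : transfer c τ e θ =
    E2minus r V (e (Φ.E2plus c τ θ)) + e (Φ.E2plus c τ (E2minus r V θ)) + e (projZero r V θ) :=
  rfl

variable {c' : Φ.R → ℂ} {e : KMod r V ≃ₗ[ℂ] KMod r V}

/-- Both sides reduce to E_2^- e E_2^+ E_2^-, as in the proof that a null-homotopic map is a chain
map. The summand with P_0 does not interfere: E_2^- kills K_0^0 and its image has no component
there. -/
theorem transfer_E2minus (he0 : ∀ θ, projZero r V (e θ) = e (projZero r V θ)) (θ : KMod r V) :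
    transfer c τ e (E2minus r V θ) = E2minus r V (transfer c τ e θ) := by
  rw [transfer_apply, transfer_apply, E2minus_E2minus, projZero_E2minus, map_add, map_add,
    E2minus_E2minus, ← he0, E2minus_projZero]
  simp

/-- The identity E_2^+ E_2^- E_2^+ = H_{c'} E_2^+ for the parameter c', carried through e, moves the
inner occurrences of e to the left, where they cancel against the inverse. What remains is E_2^-
H_{c'} E_2^+ + H_{c'} E_2^+ E_2^- with E_2^+ for c, and this equals H_{c'} H_c because E_2^-
commutes with H_{c'}. -/
theorem transfer_transfer (hc : Φ.IsParam c)
    (he : ∀ θ, e (Φ.E2plus c τ θ) = Φ.E2plus c' τ (e θ))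
    (heH : ∀ θ, e (Hop c' τ θ) = Hop c' τ (e θ))
    (he0 : ∀ θ, projZero r V (e θ) = e (projZero r V θ)) (θ : KMod r V) :
    transfer c' τ e.symm (transfer c τ e θ) = Hop c' τ (Hop c τ θ) + projZero r V θ := by
  have h1 : ∀ θ, Φ.E2plus c' τ (E2minus r V (e (Φ.E2plus c τ θ))) =
      e (Hop c' τ (Φ.E2plus c τ θ)) := by
    intro θ
    rw [heH, Hop_apply, ← he, E2plus_E2plus τ hc, map_zero, map_zero, add_zero]
  have h2 : Φ.E2plus c' τ (transfer c τ e θ) = e (Hop c' τ (Φ.E2plus c τ θ)) := by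
    rw [transfer_apply, map_add, map_add, h1, ← he, ← he, E2plus_E2plus τ hc, E2plus_projZero,
      map_zero, add_zero, add_zero]
  have h3 : projZero r V (transfer c τ e θ) = e (projZero r V θ) := by
    rw [transfer_apply, map_add, map_add, projZero_E2minus, he0, projZero_E2plus, he0,
      projZero_projZero, map_zero, zero_add, zero_add]
  have h4 : Φ.E2plus c' τ (E2minus r V (transfer c τ e θ)) =
      e (Hop c' τ (Φ.E2plus c τ (E2minus r V θ))) := by
    rw [← transfer_E2minus τ he0, transfer_apply, E2minus_E2minus, projZero_E2minus]
    simp only [map_zero, add_zero, h1]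
  rw [transfer_apply, h2, h3, h4]
  simp only [LinearEquiv.symm_apply_apply]
  rw [E2minus_Hop, Hop_apply c τ θ, map_add]
  abel

theorem transfer_kRep (hc : Φ.IsParam c) (hek : ∀ w θ, e (Φ.kRep τ w θ) = Φ.kRep τ w (e θ))
    (w : Φ.W) (θ : KMod r V) :
    transfer c τ e (Φ.kRep τ w θ) = Φ.kRep τ w (transfer c τ e θ) := by
  rw [transfer_apply, transfer_apply, map_add, map_add, ← kRep_E2plus τ hc, hek, ← kRep_E2minus,
    ← kRep_E2minus, ← kRep_E2plus τ hc, hek, ← kRep_projZero, hek]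

theorem transfer_mem {m l : ℕ} (heb : ∀ m l, ∀ θ ∈ bideg V m l, e θ ∈ bideg V m l)
    {θ : KMod r V} (h : θ ∈ bideg V m l) : transfer c τ e θ ∈ bideg V m l := by
  rw [transfer_apply]
  refine Submodule.add_mem _ (Submodule.add_mem _ ?_ ?_) (heb _ _ _ (projZero_mem_bideg h))
  · cases m with
    | zero => rw [E2plus_eq_zero c τ h, map_zero, map_zero]; exact Submodule.zero_mem _
    | succ m => exact E2minus_mem (heb _ _ _ (E2plus_mem c τ h))
  · cases l with
    | zero => rw [E2minus_eq_zero h, map_zero, map_zero]; exact Submodule.zero_mem _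
    | succ l => exact heb _ _ _ (E2plus_mem c τ (E2minus_mem h))

theorem transfer_mem_AHarm (hc : Φ.IsParam c) (hc' : Φ.IsParam c')
    (heA : ∀ θ ∈ Φ.AHarm c τ, e θ ∈ Φ.AHarm c' τ) {θ : KMod r V} (h : θ ∈ Φ.AHarm c τ) :
    transfer c τ e θ ∈ Φ.AHarm c' τ := by
  rw [transfer_apply]
  exact Submodule.add_mem _ (Submodule.add_mem _
    (E2minus_mem_AHarm τ hc' (heA _ (E2plus_mem_AHarm τ hc h)))
    (heA _ (E2plus_mem_AHarm τ hc (E2minus_mem_AHarm τ hc h))))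
    (heA _ (projZero_mem_AHarm c τ θ))

variable [FiniteDimensional ℂ V] [τ.IsIrreducible]

/-- The commutation with the anticommutator does not depend on the parameter. -/
theorem apply_Hop_of_apply_Hop (hc : Φ.IsParam c) (hc' : Φ.IsParam c') (a : ℂ)
    {f : Module.End ℂ (KMod r V)} (hf : ∀ w θ, Φ.kRep τ w (f θ) = f (Φ.kRep τ w θ))
    (h : ∀ θ, f (Hop c τ θ) = Hop c τ (f θ) + a • f θ) (θ : KMod r V) :
    f (Hop c' τ θ) = Hop c' τ (f θ) + a • f θ := by
  have h1 := h θ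
  -- The difference of the anticommutators for two parameters is a scalar plus a diagonal group
  -- algebra element, with which the equivariant f commutes.
  rw [Hop_eq τ hc, Hop_eq τ hc] at h1
  rw [Hop_eq τ hc', Hop_eq τ hc']
  simp only [map_add, map_sub, map_smul, map_sum, hf] at h1 ⊢
  linear_combination (norm := module) h1

/-- Immediate for c = 0, where the anticommutator is the total degree; `apply_Hop_of_apply_Hop`
carries it to every parameter. -/
theorem apply_Hop_of_mem_bideg (hc : Φ.IsParam c) {f : Module.End ℂ (KMod r V)}
    (hf : ∀ w θ, Φ.kRep τ w (f θ) = f (Φ.kRep τ w θ))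
    (hb : ∀ m l, ∀ θ ∈ bideg V m l, f θ ∈ bideg V m l) (θ : KMod r V) :
    f (Hop c τ θ) = Hop c τ (f θ) := by
  have h0 : ∀ θ, f (Hop 0 τ θ) = Hop 0 τ (f θ) + (0 : ℂ) • f θ := by
    intro θ
    have : f ∘ₗ Hop 0 τ = Hop 0 τ ∘ₗ f := by
      refine bideg_ext fun m l θ h => ?_
      simp only [LinearMap.comp_apply, Hop_zero_eq τ h, Hop_zero_eq τ (hb m l θ h), map_smul]
    rw [zero_smul, add_zero]
    exact LinearMap.congr_fun this θ
  have := apply_Hop_of_apply_Hop τ isParam_zero hc 0 hf h0 θ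
  rwa [zero_smul, add_zero] at this

end

section

variable {V : Type u} [AddCommGroup V] [Module ℂ V] {c c' : Φ.R → ℂ} {τ : Representation ℂ Φ.W V}
  [FiniteDimensional ℂ V] [τ.IsIrreducible]

/-- For k ≠ 0 the condition on the K_0^0-component is automatic: P_0 H_c = 0, so applying P_0 to the
equation leaves k P_0 θ = 0. -/
theorem eq_zero_of_Hop_add_of_ne_zero (hc : Φ.IsParam c) (hreg : IsRegularParam c τ) {k : ℕ}
    (hk : k ≠ 0) {θ : KMod r V} (h : Hop c τ θ + (k : ℂ) • θ = 0) : θ = 0 := by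
  refine eq_zero_of_Hop_add hc hreg k h ?_
  have := congrArg (projZero r V) h
  rw [map_add, projZero_Hop, zero_add, map_smul, map_zero, smul_eq_zero] at this
  exact this.resolve_left (by exact_mod_cast hk)

/-- The operator `H_{c'} H_c + P_0`, where `P_0` is the projection to `K_0^0`. -/
def HopHop (c c' : Φ.R → ℂ) (τ : Representation ℂ Φ.W V) : Module.End ℂ (KMod r V) :=
  Hop c' τ ∘ₗ Hop c τ + projZero r V

omit [FiniteDimensional ℂ V] [τ.IsIrreducible] in
theorem HopHop_apply (θ : KMod r V) :
    HopHop c c' τ θ = Hop c' τ (Hop c τ θ) + projZero r V θ := rfl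

variable (hc : Φ.IsParam c) (hreg : IsRegularParam c τ) (hc' : Φ.IsParam c')
  (hreg' : IsRegularParam c' τ)

include hc hreg hc' hreg'

/-- Since P_0 H_{c'} = 0, applying P_0 shows that a kernel vector has no K_0^0-component. Then
H_{c'} and H_c are stripped off in turn, the first because H_c θ has no K_0^0-component either. -/
theorem HopHop_injective : Function.Injective (HopHop c c' τ) := by
  refine (injective_iff_map_eq_zero _).2 fun θ h => ?_
  rw [HopHop_apply] at h
  have h0 := congrArg (projZero r V) h
  rw [map_add, projZero_Hop, zero_add, projZero_projZero, map_zero] at h0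
  rw [h0, add_zero] at h
  have h1 := eq_zero_of_Hop_add hc' hreg' 0 (by simpa using h) (projZero_Hop c τ θ)
  exact eq_zero_of_Hop_add hc hreg 0 (by simpa using h1) h0

omit hreg hreg' in
theorem HopHop_mem {m l : ℕ} {θ : KMod r V} (h : θ ∈ bideg V m l) :
    HopHop c c' τ θ ∈ bideg V m l :=
  Submodule.add_mem _ (Hop_mem _ τ hc' (Hop_mem _ τ hc h)) (projZero_mem_bideg h)

theorem HopHop_mem_iff {m l : ℕ} {θ : KMod r V} :
    HopHop c c' τ θ ∈ bideg V m l ↔ θ ∈ bideg V m l :=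
  ⟨fun h => mem_of_apply_mem (HopHop_injective hc hreg hc' hreg')
    (fun _ hx => HopHop_mem hc hc' hx) h, HopHop_mem hc hc'⟩

theorem HopHop_surjective : Function.Surjective (HopHop c c' τ) := by
  rw [← LinearMap.range_eq_top, eq_top_iff, ← iSup_bideg]
  refine iSup_le fun i θ h => ?_
  obtain ⟨x, -, hx⟩ := exists_mem_apply_eq (HopHop_injective hc hreg hc' hreg')
    (fun _ hx => HopHop_mem hc hc' hx) h
  exact ⟨x, hx⟩

/-- Moving f to the right through H_{c'} H_c gives (H_{c'} + 2)(H_c + 2) f, and both factors are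
injective on all of K. The shift relation for f at its own parameter c₀ transfers to c and c'
because f is equivariant. -/
theorem eq_zero_of_apply_HopHop {f : Module.End ℂ (KMod r V)} {c₀ : Φ.R → ℂ} (hc₀ : Φ.IsParam c₀)
    (hf : ∀ w θ, Φ.kRep τ w (f θ) = f (Φ.kRep τ w θ))
    (hH : ∀ θ, f (Hop c₀ τ θ) = Hop c₀ τ (f θ) + (2 : ℂ) • f θ)
    (h0 : ∀ θ, f (projZero r V θ) = 0) {θ : KMod r V} (h : f (HopHop c c' τ θ) = 0) : f θ = 0 := by
  rw [HopHop_apply, map_add, h0, add_zero, apply_Hop_of_apply_Hop τ hc₀ hc' 2 hf hH,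
    apply_Hop_of_apply_Hop τ hc₀ hc 2 hf hH] at h
  exact eq_zero_of_Hop_add_of_ne_zero hc hreg two_ne_zero
    (eq_zero_of_Hop_add_of_ne_zero hc' hreg' two_ne_zero h)

/-- Reflects membership in 𝒜: it gives the half of the equivalence in `exists_lowering_equiv` that
does not follow from 𝒜 being preserved. -/
theorem mem_AHarm_of_HopHop_mem {c₀ : Φ.R → ℂ} (hc₀ : Φ.IsParam c₀) {θ : KMod r V}
    (h : HopHop c c' τ θ ∈ Φ.AHarm c₀ τ) : θ ∈ Φ.AHarm c₀ τ := by
  rw [mem_AHarm] at h ⊢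
  have h0 := fun θ => (mem_AHarm c₀ τ _).1 (projZero_mem_AHarm c₀ τ θ)
  exact ⟨eq_zero_of_apply_HopHop hc hreg hc' hreg' hc₀ (kRep_E1minus τ hc₀) (E1minus_Hop τ hc₀)
      (fun θ => (h0 θ).1) h.1,
    eq_zero_of_apply_HopHop hc hreg hc' hreg' hc₀ (kRep_negE3 τ hc₀) (negE3_Hop τ hc₀)
      (fun θ => (h0 θ).2) h.2⟩

end

/-! ### The isomorphism for the lowering differential -/

section

variable {V : Type u} [AddCommGroup V] [Module ℂ V] {c : Φ.R → ℂ} {τ : Representation ℂ Φ.W V}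
  [FiniteDimensional ℂ V] [τ.IsIrreducible]

theorem taylorEquiv_symm_kRep (hc : Φ.IsParam c) (hreg : IsRegularParam c τ) (w : Φ.W)
    (θ : KMod r V) : (taylorEquiv hc hreg).symm (Φ.kRep τ w θ) =
      Φ.kRep τ w ((taylorEquiv hc hreg).symm θ) := by
  rw [LinearEquiv.symm_apply_eq, taylorEquiv_kRep, LinearEquiv.apply_symm_apply]

theorem taylorEquiv_symm_E2plus (hc : Φ.IsParam c) (hreg : IsRegularParam c τ)
    (θ : KMod r V) : (taylorEquiv hc hreg).symm (Φ.E2plus 0 τ θ) =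
      Φ.E2plus c τ ((taylorEquiv hc hreg).symm θ) := by
  rw [LinearEquiv.symm_apply_eq, taylorEquiv_E2plus, LinearEquiv.apply_symm_apply]

theorem taylorEquiv_symm_mem_AHarm (hc : Φ.IsParam c) (hreg : IsRegularParam c τ)
    {θ : KMod r V} : (taylorEquiv hc hreg).symm θ ∈ Φ.AHarm c τ ↔ θ ∈ Φ.AHarm 0 τ := by
  rw [← taylorEquiv_mem_AHarm hc hreg, LinearEquiv.apply_symm_apply]

theorem taylorEquiv_symm_mem_iff (hc : Φ.IsParam c) (hreg : IsRegularParam c τ) (m l : ℕ)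
    (θ : KMod r V) : (taylorEquiv hc hreg).symm θ ∈ bideg V m l ↔ θ ∈ bideg V m l := by
  rw [← taylorEquiv_mem_iff hc hreg, LinearEquiv.apply_symm_apply]

/-- An isomorphism for the raising differentials gives one for the lowering differential. -/
theorem exists_lowering_equiv {c' : Φ.R → ℂ} (hc : Φ.IsParam c) (hreg : IsRegularParam c τ)
    (hc' : Φ.IsParam c') (hreg' : IsRegularParam c' τ) {e : KMod r V ≃ₗ[ℂ] KMod r V}
    (hk : ∀ w θ, e (Φ.kRep τ w θ) = Φ.kRep τ w (e θ))
    (hb : ∀ m l θ, e θ ∈ bideg V m l ↔ θ ∈ bideg V m l)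
    (hA : ∀ θ, e θ ∈ Φ.AHarm c' τ ↔ θ ∈ Φ.AHarm c τ)
    (he : ∀ θ, e (Φ.E2plus c τ θ) = Φ.E2plus c' τ (e θ)) :
    ∃ D : KMod r V ≃ₗ[ℂ] KMod r V, (∀ w θ, D (Φ.kRep τ w θ) = Φ.kRep τ w (D θ)) ∧
      (∀ m l θ, D θ ∈ bideg V m l ↔ θ ∈ bideg V m l) ∧
      (∀ θ, D θ ∈ Φ.AHarm c' τ ↔ θ ∈ Φ.AHarm c τ) ∧
      ∀ θ, D (E2minus r V θ) = E2minus r V (D θ) := by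
  have hk' : ∀ w θ, e.symm (Φ.kRep τ w θ) = Φ.kRep τ w (e.symm θ) := fun w θ => by
    rw [LinearEquiv.symm_apply_eq, hk, LinearEquiv.apply_symm_apply]
  have he' : ∀ θ, e.symm (Φ.E2plus c' τ θ) = Φ.E2plus c τ (e.symm θ) := fun θ => by
    rw [LinearEquiv.symm_apply_eq, he, LinearEquiv.apply_symm_apply]
  have heb : ∀ m l, ∀ θ ∈ bideg V m l, e θ ∈ bideg V m l := fun m l θ h => (hb m l θ).2 h
  have heb' : ∀ m l, ∀ θ ∈ bideg V m l, e.symm θ ∈ bideg V m l := fun m l θ h => by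
    rwa [← hb, LinearEquiv.apply_symm_apply]
  have heA : ∀ θ ∈ Φ.AHarm c τ, e θ ∈ Φ.AHarm c' τ := fun θ h => (hA θ).2 h
  have heA' : ∀ θ ∈ Φ.AHarm c' τ, e.symm θ ∈ Φ.AHarm c τ := fun θ h => by
    rwa [← hA, LinearEquiv.apply_symm_apply]
  have h0 : ∀ θ, projZero r V (e θ) = e (projZero r V θ) :=
    projZero_comm (f := e.toLinearMap) heb
  have h0' : ∀ θ, projZero r V (e.symm θ) = e.symm (projZero r V θ) :=
    projZero_comm (f := e.symm.toLinearMap) heb'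
  -- Although e changes the parameter of E_2^+, it commutes with each anticommutator at a fixed
  -- parameter, being bigraded and equivariant.
  have hH : ∀ θ, e (Hop c' τ θ) = Hop c' τ (e θ) :=
    apply_Hop_of_mem_bideg τ hc' (f := e.toLinearMap) (fun w θ => (hk w θ).symm) heb
  have hH' : ∀ θ, e.symm (Hop c τ θ) = Hop c τ (e.symm θ) :=
    apply_Hop_of_mem_bideg τ hc (f := e.symm.toLinearMap) (fun w θ => (hk' w θ).symm) heb'
  have hgf : ∀ θ, transfer c' τ e.symm (transfer c τ e θ) = HopHop c c' τ θ := fun θ => by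
    rw [transfer_transfer τ hc he hH h0, HopHop_apply]
  have hfg : ∀ θ, transfer c τ e (transfer c' τ e.symm θ) = HopHop c' c τ θ := fun θ => by
    have := transfer_transfer τ hc' he' hH' h0' θ
    rwa [LinearEquiv.symm_symm, ← HopHop_apply] at this
  -- One composite with the reverse transfer is injective and the other is surjective.
  have hf : Function.Bijective (transfer c τ e) := by
    refine ⟨fun a b hab => HopHop_injective hc hreg hc' hreg' ?_, fun b => ?_⟩
    · rw [← hgf, ← hgf, hab]
    · obtain ⟨a, ha⟩ := HopHop_surjective hc' hreg' hc hreg b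
      exact ⟨_, (hfg a).trans ha⟩
  refine ⟨LinearEquiv.ofBijective _ hf, fun w θ => ?_, fun m l θ => ?_, fun θ => ?_, fun θ => ?_⟩
  · exact transfer_kRep τ hc hk w θ
  · rw [LinearEquiv.ofBijective_apply]
    refine ⟨fun h => ?_, fun h => transfer_mem τ heb h⟩
    -- For the converse inclusion the reverse transfer is applied; it changes θ only by an
    -- invertible operator that preserves bidegrees.
    rw [← HopHop_mem_iff hc hreg hc' hreg', ← hgf]
    exact transfer_mem τ heb' h
  · rw [LinearEquiv.ofBijective_apply]
    refine ⟨fun h => ?_, fun h => transfer_mem_AHarm τ hc hc' heA h⟩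
    refine mem_AHarm_of_HopHop_mem hc hreg hc' hreg' hc ?_
    rw [← hgf]
    exact transfer_mem_AHarm τ hc' hc heA' h
  · exact transfer_E2minus τ h0 θ

end

end RootDatum

/-! ### The complexes -/

section Isotypic

variable {G K S : Type*} [Monoid G] [AddCommGroup K] [Module ℂ K] [AddCommGroup S] [Module ℂ S]
  (κ : Representation ℂ G K) (σ : Representation ℂ G S)

theorem apply_mem_isotypic {f : Module.End ℂ K} (hf : ∀ w θ, f (κ w θ) = κ w (f θ)) {θ : K}
    (h : θ ∈ isotypic κ σ) : f θ ∈ isotypic κ σ := by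
  have : isotypic κ σ ≤ (isotypic κ σ).comap f := by
    refine iSup_le fun j => ?_
    rintro _ ⟨s, rfl⟩
    let j' : σ.IntertwiningMap κ :=
      { toLinearMap := f ∘ₗ j.toLinearMap
        isIntertwining' := fun w => LinearMap.ext fun s => by
          have := LinearMap.congr_fun (j.isIntertwining' w) s
          simp only [LinearMap.comp_apply] at this ⊢
          rw [this, hf] }
    exact Submodule.mem_iSup_of_mem j' ⟨s, rfl⟩
  exact this h

theorem rep_mem_isotypic (w : G) {θ : K} (h : θ ∈ isotypic κ σ) : κ w θ ∈ isotypic κ σ := by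
  have : isotypic κ σ ≤ (isotypic κ σ).comap (κ w) := by
    refine iSup_le fun j => ?_
    rintro _ ⟨s, rfl⟩
    exact Submodule.mem_iSup_of_mem j ⟨σ w s, LinearMap.congr_fun (j.isIntertwining' w) s⟩
  exact this h

theorem apply_mem_isotypic_iff {e : K ≃ₗ[ℂ] K} (he : ∀ w θ, e (κ w θ) = κ w (e θ)) {θ : K} :
    e θ ∈ isotypic κ σ ↔ θ ∈ isotypic κ σ := by
  refine ⟨fun h => ?_, apply_mem_isotypic (f := e.toLinearMap) κ σ he⟩
  have := apply_mem_isotypic (f := e.symm.toLinearMap) κ σ (fun w θ => by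
    rw [LinearEquiv.coe_coe, LinearEquiv.symm_apply_eq, he, LinearEquiv.apply_symm_apply]) h
  simpa using this

/-- The restriction of an automorphism to subspaces that correspond under it. -/
def restrictEquiv (e : K ≃ₗ[ℂ] K) {A B : Submodule ℂ K} (h : ∀ θ, e θ ∈ B ↔ θ ∈ A) : A ≃ₗ[ℂ] B :=
  LinearEquiv.ofSubmodules e A B (by
    ext θ
    refine ⟨?_, fun hθ => ⟨e.symm θ, (h _).1 (by simpa using hθ), by simp⟩⟩
    rintro ⟨x, hx, rfl⟩
    exact (h x).2 hx)

theorem coe_restrictEquiv (e : K ≃ₗ[ℂ] K) {A B : Submodule ℂ K} (h : ∀ θ, e θ ∈ B ↔ θ ∈ A)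
    (θ : A) : (restrictEquiv e h θ : K) = e θ := rfl

theorem isEquivariant_restrictEquiv {e : K ≃ₗ[ℂ] K} (he : ∀ w θ, e (κ w θ) = κ w (e θ))
    {A B : Submodule ℂ K} (h : ∀ θ, e θ ∈ B ↔ θ ∈ A) (hA : ∀ w, ∀ θ ∈ A, κ w θ ∈ A) :
    IsEquivariant κ (restrictEquiv e h) :=
  fun w θ => ⟨⟨κ w θ, hA w θ θ.2⟩, rfl, he w θ⟩

theorem upIso_of_equiv {e : K ≃ₗ[ℂ] K} (he : ∀ w θ, e (κ w θ) = κ w (e θ))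
    {C C' : ℕ → Submodule ℂ K} (h : ∀ l θ, e θ ∈ C' l ↔ θ ∈ C l)
    (hC : ∀ l w, ∀ θ ∈ C l, κ w θ ∈ C l) {d d' : Module.End ℂ K} (hd : ∀ θ, e (d θ) = d' (e θ)) :
    UpIso κ C C' d d' := by
  refine ⟨fun l => restrictEquiv e (h l),
    fun l => isEquivariant_restrictEquiv κ he (h l) (hC l), fun l θ θ' hθ => ?_⟩
  rw [coe_restrictEquiv, coe_restrictEquiv, hθ, hd]

theorem downIso_of_equiv {e : K ≃ₗ[ℂ] K} (he : ∀ w θ, e (κ w θ) = κ w (e θ))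
    {C C' : ℕ → Submodule ℂ K} (h : ∀ l θ, e θ ∈ C' l ↔ θ ∈ C l)
    (hC : ∀ l w, ∀ θ ∈ C l, κ w θ ∈ C l) {d d' : Module.End ℂ K} (hd : ∀ θ, e (d θ) = d' (e θ)) :
    DownIso κ C C' d d' := by
  refine ⟨fun l => restrictEquiv e (h l),
    fun l => isEquivariant_restrictEquiv κ he (h l) (hC l), fun l θ θ' hθ => ?_⟩
  rw [coe_restrictEquiv, coe_restrictEquiv, hθ, hd]

end Isotypic

namespace RootDatum

section

variable {V S : Type*} [AddCommGroup V] [Module ℂ V] [AddCommGroup S] [Module ℂ S] {c c' : Φ.R → ℂ}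
  {τ : Representation ℂ Φ.W V} {σ : Representation ℂ Φ.W S} {n : ℕ}

/-- At most the index m = n - l contributes to the supremum. The alternative θ = 0 accounts for l >
n, where no index does. -/
theorem mem_ACplx {l : ℕ} {θ : KMod r V} : θ ∈ Φ.ACplx c τ n σ l ↔
    θ = 0 ∨ ∃ m, m + l = n ∧ θ ∈ Φ.AHarm c τ ∧ θ ∈ bideg V m l ∧ θ ∈ isotypic (Φ.kRep τ) σ := by
  constructor
  · intro h
    by_cases hl : l ≤ n
    · have : Φ.ACplx c τ n σ l ≤ Φ.AHarmIso c τ σ (n - l) l := by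
        refine iSup₂_le fun m hm => ?_
        rw [(by omega : n - l = m)]
      exact Or.inr ⟨n - l, by omega, this h⟩
    · have : Φ.ACplx c τ n σ l ≤ ⊥ := iSup₂_le fun m hm => by omega
      exact Or.inl ((Submodule.mem_bot ℂ).1 (this h))
  · rintro (rfl | ⟨m, hm, h⟩)
    · exact Submodule.zero_mem _
    · exact Submodule.mem_iSup_of_mem m (Submodule.mem_iSup_of_mem hm h)

theorem kRep_mem_AHarm (hc : Φ.IsParam c) (w : Φ.W) {θ : KMod r V} (h : θ ∈ Φ.AHarm c τ) :
    Φ.kRep τ w θ ∈ Φ.AHarm c τ := by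
  rw [mem_AHarm] at h ⊢
  rw [← kRep_E1minus τ hc, ← kRep_negE3 τ hc, h.1, h.2, map_zero]
  exact ⟨rfl, rfl⟩

theorem kRep_mem_ACplx (hc : Φ.IsParam c) (l : ℕ) (w : Φ.W) (θ : KMod r V)
    (h : θ ∈ Φ.ACplx c τ n σ l) : Φ.kRep τ w θ ∈ Φ.ACplx c τ n σ l := by
  rw [mem_ACplx] at h ⊢
  rcases h with rfl | ⟨m, hm, hA, hb, hi⟩
  · exact Or.inl (map_zero _)
  · exact Or.inr ⟨m, hm, kRep_mem_AHarm hc w hA, kRep_mem τ w hb, rep_mem_isotypic _ _ w hi⟩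

theorem isUpComplex_ACplx (hc : Φ.IsParam c) :
    IsUpComplex (Φ.ACplx c τ n σ) (Φ.E2plus c τ) where
  map_mem l θ h := by
    rw [mem_ACplx] at h ⊢
    rcases h with rfl | ⟨m, hm, hA, hb, hi⟩
    · exact Or.inl (map_zero _)
    · cases m with
      | zero => exact Or.inl (E2plus_eq_zero c τ hb)
      | succ m =>
        exact Or.inr ⟨m, by omega, E2plus_mem_AHarm τ hc hA, E2plus_mem c τ hb,
          apply_mem_isotypic _ _ (fun w θ => (kRep_E2plus τ hc w θ).symm) hi⟩
  sq_zero _ θ _ := E2plus_E2plus τ hc θ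

theorem isDownComplex_ACplx (hc : Φ.IsParam c) :
    IsDownComplex (Φ.ACplx c τ n σ) (E2minus r V) where
  map_mem l θ h := by
    rw [mem_ACplx] at h ⊢
    rcases h with rfl | ⟨m, hm, hA, hb, hi⟩
    · exact Or.inl (map_zero _)
    · exact Or.inr ⟨m + 1, by omega, E2minus_mem_AHarm τ hc hA, E2minus_mem hb,
        apply_mem_isotypic _ _ (fun w θ => (kRep_E2minus τ w θ).symm) hi⟩
  map_zero θ h := by
    rcases mem_ACplx.1 h with rfl | ⟨m, hm, hA, hb, hi⟩
    · exact map_zero _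
    · exact E2minus_eq_zero hb
  sq_zero _ θ _ := E2minus_E2minus θ

theorem apply_mem_ACplx_iff {e : KMod r V ≃ₗ[ℂ] KMod r V}
    (hk : ∀ w θ, e (Φ.kRep τ w θ) = Φ.kRep τ w (e θ))
    (hb : ∀ m l θ, e θ ∈ bideg V m l ↔ θ ∈ bideg V m l)
    (hA : ∀ θ, e θ ∈ Φ.AHarm c' τ ↔ θ ∈ Φ.AHarm c τ) (l : ℕ) (θ : KMod r V) :
    e θ ∈ Φ.ACplx c' τ n σ l ↔ θ ∈ Φ.ACplx c τ n σ l := by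
  simp only [mem_ACplx, hA, hb, apply_mem_isotypic_iff _ σ hk, LinearEquiv.map_eq_zero_iff]

end

end RootDatum

end DunklHowe

end

open RootDatum in
theorem mainTheorem9 {r : ℕ} (Φ : RootDatum r) (c : Φ.R → ℂ) (hc : Φ.IsParam c)
    {V : Type u} [AddCommGroup V] [Module ℂ V] [FiniteDimensional ℂ V]
    (τ : Representation ℂ Φ.W V) [τ.IsIrreducible] (hgen : Φ.IsGeneric c τ) :
    (∀ (S : Type u) [AddCommGroup S] [Module ℂ S] [FiniteDimensional ℂ S]
      (σ : Representation ℂ Φ.W S) [σ.IsIrreducible] (n : ℕ),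
      (IsUpComplex (Φ.ACplx 0 τ n σ) (Φ.E2plus 0 τ) ∧
        IsUpComplex (Φ.ACplx c τ n σ) (Φ.E2plus c τ) ∧
        UpIso (Φ.kRep τ) (Φ.ACplx 0 τ n σ) (Φ.ACplx c τ n σ) (Φ.E2plus 0 τ) (Φ.E2plus c τ)) ∧
      (IsDownComplex (Φ.ACplx 0 τ n σ) (RootDatum.E2minus r V) ∧
        IsDownComplex (Φ.ACplx c τ n σ) (RootDatum.E2minus r V) ∧
        DownIso (Φ.kRep τ) (Φ.ACplx 0 τ n σ) (Φ.ACplx c τ n σ)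
          (RootDatum.E2minus r V) (RootDatum.E2minus r V))) ∧
    ∃ φ : Φ.Monog 0 τ ≃ₗ[ℂ] Φ.Monog c τ, IsEquivariant (Φ.kRep τ) φ ∧
      ∀ (m l : ℕ) (θ : Φ.Monog 0 τ),
        (θ : KMod r V) ∈ bideg V m l ↔ (φ θ : KMod r V) ∈ bideg V m l := by
  have hreg := hgen.isRegularParam
  have hc0 : Φ.IsParam (0 : Φ.R → ℂ) := isParam_zero
  have hk := taylorEquiv_symm_kRep hc hreg
  have hb := taylorEquiv_symm_mem_iff hc hreg
  have hA := fun θ => taylorEquiv_symm_mem_AHarm hc hreg (θ := θ)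
  have hd := taylorEquiv_symm_E2plus hc hreg
  -- The inverse Taylor map goes from parameter 0 to c and settles E_2^+; the transfer built from it
  -- goes in the same direction and settles E_2^-.
  obtain ⟨D, hDk, hDb, hDA, hDd⟩ := exists_lowering_equiv hc0 isRegularParam_zero hc hreg hk hb hA hd
  refine ⟨fun S _ _ _ σ _ n => ⟨⟨isUpComplex_ACplx hc0, isUpComplex_ACplx hc, ?_⟩,
    isDownComplex_ACplx hc0, isDownComplex_ACplx hc, ?_⟩, ?_⟩
  · exact upIso_of_equiv _ hk (apply_mem_ACplx_iff hk hb hA) (kRep_mem_ACplx hc0) hd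
  · exact downIso_of_equiv _ hDk (apply_mem_ACplx_iff hDk hDb hDA) (kRep_mem_ACplx hc0) hDd
  -- The map D is the suitable one here: it matches the spaces 𝒜 and commutes with E_2^-, so it
  -- matches the kernels of E_2^- inside them.
  · have hM : ∀ θ, D θ ∈ Φ.Monog c τ ↔ θ ∈ Φ.Monog 0 τ := fun θ => by
      rw [Monog, Monog, Submodule.mem_inf, Submodule.mem_inf, hDA, LinearMap.mem_ker,
        LinearMap.mem_ker, ← hDd, LinearEquiv.map_eq_zero_iff]
    refine ⟨restrictEquiv D hM, isEquivariant_restrictEquiv _ hDk hM fun w θ h => ?_,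
      fun m l θ => (hDb m l θ).symm⟩
    refine ⟨kRep_mem_AHarm hc0 w h.1, ?_⟩
    change E2minus r V (Φ.kRep τ w θ) = 0
    rw [← kRep_E2minus, LinearMap.mem_ker.1 h.2, map_zero]
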